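/- **Setting.** Let $n,N,m\ge 1$ be integers. Let $K:\mathbb{R}^n\times\mathbb{R}^n\to\mathbb{R}$ be an RBF kernel, i.e. $K(x,y)$ depends only on $\|x-y\|_2$, with spectral distribution $\mathcal{D}$: an isotropic probability distribution on $\mathbb{R}^n$ (invariant under all linear isometries) such that $K(x,y)=\mathbb{E}_{\omega\sim\mathcal{D}}[\cos(\omega^\top(x-y))]$ for all $x,y$. No smoothness or tail condition is imposed on $K$ or $\mathcal{D}$. For a sample $\omega_1,\dots,\omega_m\in\mathbb{R}^n$ let $$\Phi_m(x)=\tfrac{1}{\sqrt m}\big(\cos(\omega_1^\top x),\dots,\cos(\omega_m^\top x),\sin(\omega_1^\top x),\dots,\sin(\omega_m^\top x)\big)\in\mathbb{R}^{2m}.$$ For a dataset $x_1,\dots,x_N\in\mathbb{R}^n$ put $\mathbf{K}=(K(x_i,x_j))_{i,j}$ and $\widehat{\mathbf{K}}=(\Phi_m(x_i)^\top\Phi_m(x_j))_{i,j}$. Write $\widehat{\mathbf{K}}_{iid}$ if $\omega_1,\dots,\omega_m$ are independent samples from $\mathcal{D}$. Write $\widehat{\mathbf{K}}_{ort}$ if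 they are (block-)orthogonal Monte Carlo samples: the indices are split into consecutive blocks of size $n$ (the last one possibly smaller), $\omega_k=l_kv_k$, where within each block the directions $v_k$ are the Gram–Schmidt orthonormalization of independent standard Gaussian vectors, different blocks are independent, and the lengths $l_k$ are independent of each other and of the directions, each distributed as $\|\omega\|_2$ for $\omega\sim\mathcal{D}$. A symmetric matrix $A$ is a $\Delta$-spectral approximation of a symmetric matrix $B$ if $(1-\Delta)B\preceq A\preceq(1+\Delta)B$. For $\lambda>0$ let $\widehat\Delta_{iid}$ and $\widehat\Delta_{ort}$ be the infimum of the $\Delta>0$ for which $\widehat{\mathbf{K}}_{iid}+\lambda N\mathbf{I}_N$, respectively $\widehat{\mathbf{K}}_{ort}+\lambda N\mathbf{I}_N$, is a $\Delta$-spectral approximation of $\mathbf{K}+\lambda N\mathbf{I}_N$. Let $\sigma_{\min}$ be the smallest singular value of $\mathbf{K}+\lambda N\mathbf{I}_N$. **Statement.** For every $A>1$ there are constants $C_{iid},C_{ort}>0$, depending only on $A$, such that the functions $p^{iid}_m(x)=A\,e^{-C_{iid}mx^2}$ and $p^{ort}_m(x)=A\,e^{-C_{ort}mx^2}$ satisfy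 $p^{ort}_m(x)<p^{iid}_m(x)$ for all $m\ge1$, $x>0$, and the following holds. For all $n,N,m\ge1$, all $K$ and $\mathcal{D}$ as above, every compact $\mathcal{M}\subseteq\mathbb{R}^n$, every dataset $x_1,\dots,x_N$ with $x_i-x_j\in\mathcal{M}$ for all $i,j$, every $\lambda>0$ and every $a>0$, $$\mathbb{P}[\widehat\Delta_{iid}>a]\le p^{iid}_m\Big(\frac{a\,\sigma_{\min}}{N}\Big)\qquad\text{and}\qquad \mathbb{P}[\widehat\Delta_{ort}>a]\le p^{ort}_m\Big(\frac{a\,\sigma_{\min}}{N}\Big).$$ In particular, neither bound contains a factor depending on the dataset size. -/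

import Mathlib

open MeasureTheory ProbabilityTheory
open scoped Matrix

noncomputable section

namespace OMCRidge

/-- The data space `ℝⁿ` with its Euclidean norm. -/
abbrev Vec (n : ℕ) : Type := EuclideanSpace ℝ (Fin n)

/-! ### RBF kernels and their spectral distributions -/

/-- A radial basis function kernel: its value depends only on `‖x - y‖`. -/
def IsRBF {n : ℕ} (K : Vec n → Vec n → ℝ) : Prop :=
  ∃ r : ℝ → ℝ, ∀ x y, K x y = r ‖x - y‖

/-- `D` is isotropic: invariant under every linear isometry of `ℝⁿ`. -/
def IsIsotropic {n : ℕ} (D : Measure (Vec n)) : Prop :=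
  ∀ U : Vec n ≃ₗᵢ[ℝ] Vec n, D.map U = D

/-- `D` is the spectral (Fourier) distribution of the kernel `K`:
`K(x, y) = 𝔼_{ω ∼ D} cos(ωᵀ(x - y))`. -/
def IsSpectralDistribution {n : ℕ} (D : Measure (Vec n)) (K : Vec n → Vec n → ℝ) : Prop :=
  ∀ x y, K x y = ∫ ω, Real.cos (inner ℝ ω (x - y)) ∂D

/-! ### Independent and block-orthogonal samples -/

/-- The joint law of `m` independent samples from `D`. -/
def iidLaw {n : ℕ} (D : Measure (Vec n)) (m : ℕ) : Measure (Fin m → Vec n) :=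
  Measure.pi fun _ => D

/-- The `b`-th block of (at most) `n` consecutive vectors among `g 0, …, g (m - 1)`; the missing
positions of an incomplete last block are filled with `0`. -/
def block {n m : ℕ} (g : Fin m → Vec n) (b : ℕ) (j : Fin n) : Vec n :=
  if h : b * n + j < m then g ⟨b * n + j, h⟩ else 0

/-- The direction of the `k`-th sample: position `k % n` of the Gram-Schmidt orthonormalization of
the block with number `k / n`. -/
def direction {n m : ℕ} [NeZero n] (g : Fin m → Vec n) (k : Fin m) : Vec n :=
  InnerProductSpace.gramSchmidtNormed ℝ (block g (k / n)) (Fin.ofNat n k)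

/-- Gram-Schmidt orthogonalization within each block, followed by renormalization: the `k`-th
sample gets the length `l k`. -/
def blockOrthogonalize {n m : ℕ} [NeZero n] (q : (Fin m → Vec n) × (Fin m → ℝ)) :
    Fin m → Vec n :=
  fun k => q.2 k • direction q.1 k

/-- The joint law of `m` (block-)orthogonal Monte Carlo samples with marginal distribution `D`:
orthonormalize independent standard Gaussian vectors block by block, and give the resulting
directions independent lengths that are distributed as `‖ω‖` for `ω ∼ D`. -/
def omcLaw {n : ℕ} [NeZero n] (D : Measure (Vec n)) (m : ℕ) : Measure (Fin m → Vec n) :=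
  ((Measure.pi fun _ : Fin m => stdGaussian (Vec n)).prod
    (Measure.pi fun _ : Fin m => D.map fun ω => ‖ω‖)).map blockOrthogonalize

lemma measurable_gramSchmidt {n : ℕ} {α : Type*} [MeasurableSpace α] {f : α → Fin n → Vec n}
    (hf : ∀ j, Measurable fun a => f a j) (j : Fin n) :
    Measurable fun a => InnerProductSpace.gramSchmidt ℝ (f a) j := by
  induction j using WellFoundedLT.induction with
  | ind j ih =>
    have e : (fun a => InnerProductSpace.gramSchmidt ℝ (f a) j) = fun a => f a j -
        ∑ i ∈ Finset.Iio j, (inner ℝ (InnerProductSpace.gramSchmidt ℝ (f a) i) (f a j) /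
          ‖InnerProductSpace.gramSchmidt ℝ (f a) i‖ ^ 2) •
            InnerProductSpace.gramSchmidt ℝ (f a) i := by
      funext a
      rw [InnerProductSpace.gramSchmidt_def]
      simp only [Submodule.starProjection_singleton, RCLike.ofReal_real_eq_id, id]
    rw [e]
    refine (hf j).sub (Finset.measurable_sum _ fun i hi => ?_)
    have hi := ih i (Finset.mem_Iio.1 hi)
    have hj := hf j
    exact ((hi.inner hj).div (hi.norm.pow_const 2)).smul hi

lemma measurable_blockOrthogonalize {n m : ℕ} [NeZero n] :
    Measurable (blockOrthogonalize : (Fin m → Vec n) × (Fin m → ℝ) → Fin m → Vec n) := by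
  refine measurable_pi_lambda _ fun k => ?_
  have hb : ∀ j : Fin n, Measurable fun q : (Fin m → Vec n) × (Fin m → ℝ) =>
      block q.1 (k / n) j := by
    intro j
    unfold block
    split_ifs <;> fun_prop
  have h := measurable_gramSchmidt hb (Fin.ofNat n k)
  have h2 : Measurable fun q : (Fin m → Vec n) × (Fin m → ℝ) => q.2 k := by fun_prop
  unfold blockOrthogonalize direction InnerProductSpace.gramSchmidtNormed
  simp only [RCLike.ofReal_real_eq_id, id]
  exact h2.smul (h.norm.inv.smul h)

instance {n : ℕ} [NeZero n] (D : Measure (Vec n)) [IsProbabilityMeasure D] (m : ℕ) :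
    IsProbabilityMeasure (omcLaw D m) := by
  have : IsProbabilityMeasure (D.map fun ω => ‖ω‖) :=
    Measure.isProbabilityMeasure_map (by fun_prop)
  exact Measure.isProbabilityMeasure_map measurable_blockOrthogonalize.aemeasurable

/-! ### Random features and kernel matrices -/

/-- The random feature map `Φ_m : ℝⁿ → ℝ^{2m}` of the sample `W`: the numbers
`cos(ω_kᵀ y) / √m` followed by the numbers `sin(ω_kᵀ y) / √m`. -/
def featureMap {n m : ℕ} (W : Fin m → Vec n) (y : Vec n) : Fin m ⊕ Fin m → ℝ :=
  Sum.elim (fun k => Real.cos (inner ℝ (W k) y) / √m) (fun k => Real.sin (inner ℝ (W k) y) / √m)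

/-- The exact kernel matrix of the dataset `x`. -/
def kernelMatrix {n N : ℕ} (K : Vec n → Vec n → ℝ) (x : Fin N → Vec n) :
    Matrix (Fin N) (Fin N) ℝ :=
  Matrix.of fun i j => K (x i) (x j)

/-- The approximate kernel matrix of the dataset `x`, from the random features of `W`. -/
def approxKernelMatrix {n m N : ℕ} (W : Fin m → Vec n) (x : Fin N → Vec n) :
    Matrix (Fin N) (Fin N) ℝ :=
  Matrix.of fun i j => featureMap W (x i) ⬝ᵥ featureMap W (x j)

/-- The ridge-regularized matrix `A + λ N I_N`. -/
def regularized {N : ℕ} (lam : ℝ) (A : Matrix (Fin N) (Fin N) ℝ) : Matrix (Fin N) (Fin N) ℝ :=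
  A + (lam * N) • (1 : Matrix (Fin N) (Fin N) ℝ)

/-! ### Spectral approximation -/

/-- `A` is a `Δ`-spectral approximation of `B`: `(1 - Δ) B ⪯ A ⪯ (1 + Δ) B`. -/
def IsSpectralApprox {N : ℕ} (Δ : ℝ) (A B : Matrix (Fin N) (Fin N) ℝ) : Prop :=
  (A - (1 - Δ) • B).PosSemidef ∧ ((1 + Δ) • B - A).PosSemidef

/-- The smallest `Δ` (the infimum of the positive `Δ`) for which `A` is a `Δ`-spectral
approximation of `B`. -/
def spectralError {N : ℕ} (A B : Matrix (Fin N) (Fin N) ℝ) : ℝ :=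
  sInf {Δ : ℝ | 0 < Δ ∧ IsSpectralApprox Δ A B}

/-- The spectral parameter `Δ̂` of the approximate regularized kernel matrix obtained from the
samples `W`. -/
def deltaHat {n m N : ℕ} (K : Vec n → Vec n → ℝ) (x : Fin N → Vec n) (lam : ℝ)
    (W : Fin m → Vec n) : ℝ :=
  spectralError (regularized lam (approxKernelMatrix W x)) (regularized lam (kernelMatrix K x))

/-- The smallest singular value of an `N × N` matrix, `N ≥ 1` (Mathlib lists the singular values
in decreasing order, starting with index `0`). -/
def sigmaMin {N : ℕ} (A : Matrix (Fin N) (Fin N) ℝ) : ℝ :=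
  (Matrix.toEuclideanLin A).singularValues (N - 1)

/-- The failure bound `A e^{-C m x²}`, free of the dataset size. -/
def failureBound (A C : ℝ) (m : ℕ) (x : ℝ) : ℝ :=
  A * Real.exp (-(C * m * x ^ 2))

end OMCRidge

end

noncomputable section

namespace OMCRidge

/-! Each frequency contributes a centered random matrix of kernel errors, viewed as a vector in
`ℝ^(N × N)` with the Frobenius norm. Its norm is at most `2N`. If the average of these vectors has
norm at most `a σ_min`, then by Cauchy-Schwarz the error of the quadratic form is at most `a σ_min
|x|²`, hence at most `a` times the regularized form. So a Gaussian tail for the norm of the sum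
suffices. Bounding this norm directly, instead of taking a union bound over entries, is what keeps
the dataset size out of the prefactor.

The tail bound uses only one property of the sample (`IsMomentDominated`): `E ∏ F(ω_k) ≤ (E
F(ω)⁴)^(m/4)` for continuous `F` bounded between positive constants. Applied to exponentials of
centered linear functionals, with `exp x ≤ x + exp(x²)`, it gives a sub-Gaussian bound in each
direction. Averaging over a standard Gaussian direction `g`, through `E_g exp⟨τS, g⟩ =
exp(τ²‖S‖²/2)`, turns this into a bound on `E exp(τ²‖S‖²/2)` by an absolute constant
(`lintegral_exp_sq_norm_sum_le`), and Markov's inequality finishes.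

For independent samples, moment domination is Jensen's inequality. For orthogonal samples it
follows, block by block, from a Brascamp-Lieb inequality for a uniform orthonormal frame: `E ∏
f_k(v_k)^(1/4) ≤ ∏ (E f_k(v_k))^(1/4)` (`IsHaarFrame.brascampLieb`). Its proof is variational. On a
compact, convex, rotation-invariant class of functions of mean one the left side has a maximizer.
Rotating two vectors of the frame preserves the law; since fourth roots leave a strictly positive
remainder in the arithmetic-geometric mean inequality, this bounds the mean square increments of the
components by a weighted sum of second differences along the frame. Up to third order these equal
second differences along rotations in fixed coordinate planes, both being the spherical Laplacian,
and the latter are first variations, hence nonpositive in the mean at a maximizer. So the mean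
square increment under a rotation by `ε` is `O(ε³)`; chaining many small rotations makes it zero,
the maximizer is constant, and its value is one.

Both laws receive the same rate this way. The strict inequality between the two bounds is arranged
by halving the rate stated for independent samples; it does not compare the two probabilities
themselves. -/

/-! ### Rotations in coordinate planes -/

/-- Rotation by the angle `θ` in the plane spanned by `e a` and `e b`. -/
def planeRot {n : ℕ} (e : Fin n → Vec n) (a b : Fin n) (θ : ℝ) (x : Vec n) : Vec n :=
  x + (Real.cos θ - 1) • (inner ℝ (e a) x • e a + inner ℝ (e b) x • e b) +
    Real.sin θ • (inner ℝ (e a) x • e b - inner ℝ (e b) x • e a)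

lemma exists_orthonormalBasis_coe_eq {n : ℕ} {v : Fin n → Vec n} (hv : Orthonormal ℝ v) :
    ∃ b : OrthonormalBasis (Fin n) ℝ (Vec n), ⇑b = v := by
  obtain ⟨b, hb⟩ := Orthonormal.exists_orthonormalBasis_extension_of_card_eq
    (ι := Fin n) (E := Vec n) (𝕜 := ℝ) (by simp) (v := v) (s := Set.univ)
    (hv.comp _ Subtype.val_injective)
  exact ⟨b, funext fun i => hb i trivial⟩

lemma planeRot_self_left {n : ℕ} {v : Fin n → Vec n} (hv : Orthonormal ℝ v) {i j : Fin n}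
    (hij : i ≠ j) (θ : ℝ) : planeRot v i j θ (v i) = Real.cos θ • v i + Real.sin θ • v j := by
  have h1 : inner ℝ (v i) (v i) = (1 : ℝ) := by simp [hv.1]
  have h2 : inner ℝ (v j) (v i) = (0 : ℝ) := hv.2 hij.symm
  simp only [planeRot, h1, h2]
  module

lemma planeRot_self_right {n : ℕ} {v : Fin n → Vec n} (hv : Orthonormal ℝ v) {i j : Fin n}
    (hij : i ≠ j) (θ : ℝ) : planeRot v i j θ (v j) = Real.cos θ • v j - Real.sin θ • v i := by
  have h1 : inner ℝ (v j) (v j) = (1 : ℝ) := by simp [hv.1]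
  have h2 : inner ℝ (v i) (v j) = (0 : ℝ) := hv.2 hij
  simp only [planeRot, h1, h2]
  module

lemma planeRot_of_ne {n : ℕ} {v : Fin n → Vec n} (hv : Orthonormal ℝ v) {i j k : Fin n}
    (hi : k ≠ i) (hj : k ≠ j) (θ : ℝ) : planeRot v i j θ (v k) = v k := by
  have h1 : inner ℝ (v i) (v k) = (0 : ℝ) := hv.2 hi.symm
  have h2 : inner ℝ (v j) (v k) = (0 : ℝ) := hv.2 hj.symm
  simp only [planeRot, h1, h2]
  module

lemma norm_planeRot {n : ℕ} {e : Fin n → Vec n} (he : Orthonormal ℝ e) {a b : Fin n}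
    (hab : a ≠ b) (θ : ℝ) (x : Vec n) : ‖planeRot e a b θ x‖ = ‖x‖ := by
  have h1 : inner ℝ (e a) (e a) = (1 : ℝ) := by simp [he.1]
  have h2 : inner ℝ (e b) (e b) = (1 : ℝ) := by simp [he.1]
  have h3 : inner ℝ (e a) (e b) = (0 : ℝ) := he.2 hab
  have h4 : inner ℝ (e b) (e a) = (0 : ℝ) := he.2 hab.symm
  have hcs := Real.sin_sq_add_cos_sq θ
  rw [← sq_eq_sq₀ (norm_nonneg _) (norm_nonneg _), ← real_inner_self_eq_norm_sq,
    ← real_inner_self_eq_norm_sq]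
  simp only [planeRot, inner_add_left, inner_add_right, inner_sub_left, inner_sub_right,
    real_inner_smul_left, real_inner_smul_right, h1, h2, h3, h4, real_inner_comm (e a) x,
    real_inner_comm (e b) x]
  rw [real_inner_comm x (e a), real_inner_comm x (e b)]
  linear_combination ((inner ℝ x (e a)) ^ 2 + (inner ℝ x (e b)) ^ 2) * hcs

/-- `planeRot` as a linear isometry equivalence. -/
def planeRotIso {n : ℕ} (e : OrthonormalBasis (Fin n) ℝ (Vec n)) {a b : Fin n} (hab : a ≠ b)
    (θ : ℝ) : Vec n ≃ₗᵢ[ℝ] Vec n :=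
  LinearIsometry.toLinearIsometryEquiv
    { toFun := planeRot e a b θ
      map_add' := fun x y => by
        simp only [planeRot, inner_add_right]
        module
      map_smul' := fun c x => by
        simp only [planeRot, real_inner_smul_right, RingHom.id_apply]
        module
      norm_map' := norm_planeRot e.orthonormal hab θ } rfl

lemma map_planeRot {n : ℕ} (U : Vec n ≃ₗᵢ[ℝ] Vec n) (e : Fin n → Vec n) (a b : Fin n) (θ : ℝ)
    (x : Vec n) : U (planeRot e a b θ x) = planeRot (fun k => U (e k)) a b θ (U x) := by
  simp [planeRot, map_add, map_sub, map_smul]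

/-- Rotation by the angle `θ` of the `i`-th and the `j`-th vector of a frame. -/
def pairRot {n : ℕ} (i j : Fin n) (θ : ℝ) (v : Fin n → Vec n) : Fin n → Vec n :=
  Function.update (Function.update v i (Real.cos θ • v i + Real.sin θ • v j)) j
    (Real.cos θ • v j - Real.sin θ • v i)

lemma pairRot_left {n : ℕ} {i j : Fin n} (hij : i ≠ j) (θ : ℝ) (v : Fin n → Vec n) :
    pairRot i j θ v i = Real.cos θ • v i + Real.sin θ • v j := by
  simp [pairRot, Function.update_of_ne hij]

lemma pairRot_right {n : ℕ} (i j : Fin n) (θ : ℝ) (v : Fin n → Vec n) :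
    pairRot i j θ v j = Real.cos θ • v j - Real.sin θ • v i := by
  simp [pairRot]

lemma pairRot_of_ne {n : ℕ} {i j k : Fin n} (hi : k ≠ i) (hj : k ≠ j) (θ : ℝ)
    (v : Fin n → Vec n) : pairRot i j θ v k = v k := by
  simp [pairRot, Function.update_of_ne hi, Function.update_of_ne hj]

/-- The isometry on the right depends on the frame. This yields orthonormality of the rotated frame,
but invariance of a law under `pairRot` needs right invariance and cannot be read off from left
invariance. -/
lemma pairRot_eq_planeRot {n : ℕ} {v : Fin n → Vec n} (hv : Orthonormal ℝ v) {i j : Fin n}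
    (hij : i ≠ j) (θ : ℝ) : pairRot i j θ v = fun k => planeRot v i j θ (v k) := by
  funext k
  by_cases hi : k = i
  · subst hi
    rw [pairRot_left hij, planeRot_self_left hv hij]
  by_cases hj : k = j
  · subst hj
    rw [pairRot_right, planeRot_self_right hv hij]
  rw [pairRot_of_ne hi hj, planeRot_of_ne hv hi hj]

lemma orthonormal_pairRot {n : ℕ} {v : Fin n → Vec n} (hv : Orthonormal ℝ v) {i j : Fin n}
    (hij : i ≠ j) (θ : ℝ) : Orthonormal ℝ (pairRot i j θ v) := by
  obtain ⟨b, rfl⟩ := exists_orthonormalBasis_coe_eq hv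
  rw [pairRot_eq_planeRot hv hij]
  exact hv.comp_linearIsometryEquiv (planeRotIso b hij θ)

lemma pairRot_add {n : ℕ} {i j : Fin n} (hij : i ≠ j) (θ φ : ℝ) (v : Fin n → Vec n) :
    pairRot i j θ (pairRot i j φ v) = pairRot i j (θ + φ) v := by
  funext k
  by_cases hi : k = i
  · subst hi
    rw [pairRot_left hij, pairRot_left hij, pairRot_left hij, pairRot_right, Real.cos_add,
      Real.sin_add]
    module
  by_cases hj : k = j
  · subst hj
    rw [pairRot_right, pairRot_right, pairRot_right, pairRot_left hij, Real.cos_add,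
      Real.sin_add]
    module
  rw [pairRot_of_ne hi hj, pairRot_of_ne hi hj, pairRot_of_ne hi hj]

/-! ### Uniformly distributed orthonormal frames -/

/-- `μ` is the uniform distribution on the orthonormal frames of `ℝⁿ`. -/
structure IsHaarFrame {n : ℕ} (μ : Measure (Fin n → Vec n)) : Prop where
  isProbabilityMeasure : IsProbabilityMeasure μ
  orthonormal : ∀ᵐ v ∂μ, Orthonormal ℝ v
  map_left : ∀ U : Vec n ≃ₗᵢ[ℝ] Vec n, μ.map (fun v k => U (v k)) = μ
  map_right : ∀ r : Fin n → Vec n, Orthonormal ℝ r →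
    μ.map (fun v k => ∑ j, r k j • v j) = μ

variable {n : ℕ} {μ : Measure (Fin n → Vec n)}

lemma measurable_pairRot (i j : Fin n) (θ : ℝ) :
    Measurable (pairRot i j θ : (Fin n → Vec n) → Fin n → Vec n) := by
  refine measurable_pi_lambda _ fun k => ?_
  unfold pairRot
  by_cases hj : k = j
  · subst hj
    simp only [Function.update_self]
    fun_prop
  by_cases hi : k = i
  · subst hi
    simp only [Function.update_of_ne hj, Function.update_self]
    fun_prop
  simp only [Function.update_of_ne hj, Function.update_of_ne hi]
  fun_prop

/-- Mixing two vectors of a frame is right multiplication by a plane rotation matrix, whose columns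
are the rotated standard basis. -/
lemma IsHaarFrame.map_pairRot (h : IsHaarFrame μ) {i j : Fin n} (hij : i ≠ j) (θ : ℝ) :
    μ.map (pairRot i j θ) = μ := by
  have he := (EuclideanSpace.basisFun (Fin n) ℝ).orthonormal
  have key := h.map_right _ (orthonormal_pairRot he hij θ)
  have e : (fun (v : Fin n → Vec n) k =>
      ∑ l, pairRot i j θ (EuclideanSpace.basisFun (Fin n) ℝ) k l • v l) = pairRot i j θ := by
    funext v k
    by_cases hi : k = i
    · subst hi
      simp [pairRot_left hij, add_smul, Finset.sum_add_distrib, ite_smul]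
    by_cases hj : k = j
    · subst hj
      simp [pairRot_right, sub_smul, Finset.sum_sub_distrib, ite_smul]
    simp [pairRot_of_ne hi hj, ite_smul]
  rwa [e] at key

lemma IsHaarFrame.integral_pairRot (h : IsHaarFrame μ) {i j : Fin n} (hij : i ≠ j) (θ : ℝ)
    {F : (Fin n → Vec n) → ℝ} (hF : Measurable F) :
    ∫ v, F (pairRot i j θ v) ∂μ = ∫ v, F v ∂μ := by
  conv_rhs => rw [← h.map_pairRot hij θ]
  rw [integral_map (measurable_pairRot i j θ).aemeasurable hF.aestronglyMeasurable]

lemma IsHaarFrame.integral_left (h : IsHaarFrame μ) (U : Vec n ≃ₗᵢ[ℝ] Vec n)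
    {F : (Fin n → Vec n) → ℝ} (hF : Measurable F) :
    ∫ v, F (fun k => U (v k)) ∂μ = ∫ v, F v ∂μ := by
  conv_rhs => rw [← h.map_left U]
  have hU : Measurable U := U.continuous.measurable
  have hm : Measurable fun (v : Fin n → Vec n) k => U (v k) :=
    measurable_pi_lambda _ fun k => hU.comp (measurable_pi_apply k)
  rw [integral_map hm.aemeasurable hF.aestronglyMeasurable]

end OMCRidge
end

noncomputable section

namespace OMCRidge

variable {n : ℕ} {μ : Measure (Fin n → Vec n)}

/-! ### The functional of the Brascamp-Lieb inequality and its variations -/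

/-- The product of the fourth roots of the `f k (v k)`, for positive `f k`. -/
def weight {n : ℕ} (f : Fin n → Vec n → ℝ) (v : Fin n → Vec n) : ℝ :=
  Real.exp (1 / 4 * ∑ k, Real.log (f k (v k)))

/-- The functions `f k` are measurable with values in `[δ, B]`. -/
structure Pinched {n : ℕ} (δ B : ℝ) (f : Fin n → Vec n → ℝ) : Prop where
  measurable : ∀ k, Measurable (f k)
  le : ∀ k x, δ ≤ f k x
  ge : ∀ k x, f k x ≤ B

lemma Pinched.convexComb {δ B : ℝ} {f g : Fin n → Vec n → ℝ} (hf : Pinched δ B f)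
    (hg : Pinched δ B g) {s : ℝ} (h0 : 0 ≤ s) (h1 : s ≤ 1) :
    Pinched δ B (fun k x => (1 - s) * f k x + s * g k x) where
  measurable k := ((hf.measurable k).const_mul _).add ((hg.measurable k).const_mul _)
  le k x := by nlinarith [hf.le k x, hg.le k x]
  ge k x := by nlinarith [hf.ge k x, hg.ge k x]

lemma Pinched.measurable_eval {δ B : ℝ} {f : Fin n → Vec n → ℝ} (hf : Pinched δ B f) (k : Fin n) :
    Measurable fun v : Fin n → Vec n => f k (v k) :=
  (hf.measurable k).comp (measurable_pi_apply k)

lemma Pinched.measurable_weight {δ B : ℝ} {f : Fin n → Vec n → ℝ} (hf : Pinched δ B f) :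
    Measurable (weight f) := by
  unfold weight
  exact Real.measurable_exp.comp ((Finset.measurable_sum _ fun k _ =>
    Real.measurable_log.comp (hf.measurable_eval k)).const_mul _)

lemma weight_pos (f : Fin n → Vec n → ℝ) (v : Fin n → Vec n) : 0 < weight f v := Real.exp_pos _

lemma Pinched.weight_le {δ B : ℝ} {f : Fin n → Vec n → ℝ} (hf : Pinched δ B f) (hδ : 0 < δ)
    (v : Fin n → Vec n) : weight f v ≤ Real.exp (1 / 4 * (n * Real.log B)) := by
  unfold weight
  gcongr
  calc ∑ k, Real.log (f k (v k)) ≤ ∑ _k : Fin n, Real.log B :=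
        Finset.sum_le_sum fun k _ => Real.log_le_log (hδ.trans_le (hf.le _ _)) (hf.ge _ _)
    _ = n * Real.log B := by simp

lemma Pinched.le_weight {δ B : ℝ} {f : Fin n → Vec n → ℝ} (hf : Pinched δ B f) (hδ : 0 < δ)
    (v : Fin n → Vec n) : Real.exp (1 / 4 * (n * Real.log δ)) ≤ weight f v := by
  unfold weight
  gcongr
  calc n * Real.log δ = ∑ _k : Fin n, Real.log δ := by simp
    _ ≤ ∑ k, Real.log (f k (v k)) :=
        Finset.sum_le_sum fun k _ => Real.log_le_log hδ (hf.le _ _)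

lemma integrable_of_measurable_of_bounded {α : Type*} [MeasurableSpace α] {ν : Measure α}
    [IsFiniteMeasure ν] {F : α → ℝ} (hF : Measurable F) (C : ℝ) (hC : ∀ a, |F a| ≤ C) :
    Integrable F ν :=
  Integrable.of_bound hF.aestronglyMeasurable C (Filter.Eventually.of_forall hC)

lemma Pinched.integrable_weight_mul [IsFiniteMeasure μ] {δ B : ℝ} {f : Fin n → Vec n → ℝ}
    (hf : Pinched δ B f) (hδ : 0 < δ) {F : (Fin n → Vec n) → ℝ} (hF : Measurable F) (C : ℝ)
    (hC : ∀ v, |F v| ≤ C) : Integrable (fun v => weight f v * F v) μ := by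
  refine integrable_of_measurable_of_bounded (hf.measurable_weight.mul hF)
    (Real.exp (1 / 4 * (n * Real.log B)) * C) fun v => ?_
  rw [abs_mul, abs_of_pos (weight_pos f v)]
  exact mul_le_mul (hf.weight_le hδ v) (hC v) (abs_nonneg _) (Real.exp_pos _).le

lemma Pinched.integrable_weight [IsFiniteMeasure μ] {δ B : ℝ} {f : Fin n → Vec n → ℝ}
    (hf : Pinched δ B f) (hδ : 0 < δ) : Integrable (weight f) μ := by
  simpa using hf.integrable_weight_mul (μ := μ) hδ (measurable_const (a := (1 : ℝ))) 1 (by simp)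

/-- A one-sided second-order expansion with explicit constant; it replaces differentiation under the
integral in the first variation. -/
lemma sub_two_mul_sq_le_log {u : ℝ} (hu : -(1 / 2) ≤ u) : u - 2 * u ^ 2 ≤ Real.log (1 + u) := by
  have h1 : 0 < 1 + u := by linarith
  refine le_trans ?_ (Real.one_sub_inv_le_log_of_pos h1)
  have : 1 - (1 + u)⁻¹ - (u - 2 * u ^ 2) = u ^ 2 * (1 + 2 * u) / (1 + u) := by
    field_simp
    ring
  have h2 : 0 ≤ u ^ 2 * (1 + 2 * u) / (1 + u) :=
    div_nonneg (mul_nonneg (sq_nonneg u) (by linarith)) h1.le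
  linarith

/-- The relative increment of `f k` in the direction of `g k`. -/
lemma Pinched.abs_sub_div_le {δ B : ℝ} {f : Fin n → Vec n → ℝ} (hf : Pinched δ B f) (hδ : 0 < δ)
    (k : Fin n) (x : Vec n) {y : ℝ} (h1 : δ ≤ y) (h2 : y ≤ B) :
    |(y - f k x) / f k x| ≤ B / δ := by
  have a1 := hf.le k x
  have a2 := hf.ge k x
  rw [abs_div, abs_of_pos (hδ.trans_le a1)]
  exact div_le_div₀ (by linarith) (abs_le.2 ⟨by linarith, by linarith⟩) hδ a1

/-- First variation at a maximizer in the direction of `g`. -/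
lemma integral_weight_mul_sum_nonpos [IsProbabilityMeasure μ] {δ B : ℝ} (hδ : 0 < δ)
    {f g : Fin n → Vec n → ℝ} (hf : Pinched δ B f) (hg : Pinched δ B g)
    (hmax : ∀ s : ℝ, 0 < s → s ≤ 1 →
      ∫ v, weight (fun k x => (1 - s) * f k x + s * g k x) v ∂μ ≤ ∫ v, weight f v ∂μ) :
    ∫ v, weight f v * ∑ k, (g k (v k) - f k (v k)) / f k (v k) ∂μ ≤ 0 := by
  rcases isEmpty_or_nonempty (Fin n) with hn | ⟨⟨k0⟩⟩
  · simp
  have hB : δ ≤ B := (hf.le k0 0).trans (hf.ge k0 0)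
  set Z : ℝ := B / δ with hZ
  have hZ1 : 1 ≤ Z := (one_le_div hδ).2 hB
  set I := ∫ v, weight f v * ∑ k, (g k (v k) - f k (v k)) / f k (v k) ∂μ with hI
  set J := ∫ v, weight f v ∂μ with hJ
  have hz : ∀ k (v : Fin n → Vec n), |(g k (v k) - f k (v k)) / f k (v k)| ≤ Z :=
    fun k v => hf.abs_sub_div_le hδ k _ (hg.le _ _) (hg.ge _ _)
  have hm : Measurable fun v : Fin n → Vec n => ∑ k, (g k (v k) - f k (v k)) / f k (v k) :=
    Finset.measurable_sum _ fun k _ =>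
      ((hg.measurable_eval k).sub (hf.measurable_eval k)).div (hf.measurable_eval k)
  have hsum : ∀ v : Fin n → Vec n, |∑ k, (g k (v k) - f k (v k)) / f k (v k)| ≤ n * Z := by
    intro v
    refine (Finset.abs_sum_le_sum_abs _ _).trans ?_
    calc _ ≤ ∑ _k : Fin n, Z := Finset.sum_le_sum fun k _ => hz k v
      _ = n * Z := by simp
  have hint1 := hf.integrable_weight_mul (μ := μ) hδ hm _ hsum
  have hint2 := hf.integrable_weight (μ := μ) hδ
  -- Maximality, divided by `s`, leaves an error linear in `s`. The bound on `s` keeps the relative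
  -- change of every component above `-1/2`, where the expansion of the logarithm is valid.
  have key : ∀ s : ℝ, 0 < s → s ≤ 1 / (2 * Z) → I ≤ s * (2 * n * Z ^ 2 * J) := by
    intro s hs0 hs1
    have hsZ : s * Z ≤ 1 / 2 := by
      have := mul_le_mul_of_nonneg_right hs1 (by linarith : (0 : ℝ) ≤ Z)
      calc s * Z ≤ 1 / (2 * Z) * Z := this
        _ = 1 / 2 := by field_simp
    have hs1' : s ≤ 1 := by nlinarith
    have hP := hf.convexComb hg hs0.le hs1'
    have hpt : ∀ v : Fin n → Vec n,
        weight f v + s / 4 * (weight f v * ∑ k, (g k (v k) - f k (v k)) / f k (v k)) -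
          s ^ 2 / 2 * n * Z ^ 2 * weight f v ≤
        weight (fun k x => (1 - s) * f k x + s * g k x) v := by
      intro v
      have hlog : ∀ k, Real.log (f k (v k)) + (s * ((g k (v k) - f k (v k)) / f k (v k)) -
          2 * (s * Z) ^ 2) ≤ Real.log ((1 - s) * f k (v k) + s * g k (v k)) := by
        intro k
        have hfp : 0 < f k (v k) := hδ.trans_le (hf.le _ _)
        set z := (g k (v k) - f k (v k)) / f k (v k) with hzdef
        have hzk := abs_le.1 (hz k v)
        have hu : -(1 / 2) ≤ s * z := by nlinarith [hzk.1]
        have e : (1 - s) * f k (v k) + s * g k (v k) = f k (v k) * (1 + s * z) := by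
          rw [hzdef]; field_simp; ring
        rw [e, Real.log_mul hfp.ne' (by linarith)]
        have h3 := sub_two_mul_sq_le_log hu
        have h4 : (s * z) ^ 2 ≤ (s * Z) ^ 2 := by
          rw [mul_pow, mul_pow]
          exact mul_le_mul_of_nonneg_left (sq_le_sq' hzk.1 hzk.2) (sq_nonneg s)
        linarith
      have hS : ∑ k, Real.log (f k (v k)) +
          (s * ∑ k, (g k (v k) - f k (v k)) / f k (v k) - n * (2 * (s * Z) ^ 2)) ≤
          ∑ k, Real.log ((1 - s) * f k (v k) + s * g k (v k)) := by
        refine le_trans (le_of_eq ?_) (Finset.sum_le_sum fun k _ => hlog k)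
        simp [Finset.sum_add_distrib, Finset.sum_sub_distrib, Finset.mul_sum]
      have h5 : weight f v * Real.exp (1 / 4 * (s * ∑ k, (g k (v k) - f k (v k)) / f k (v k) -
          n * (2 * (s * Z) ^ 2))) ≤ weight (fun k x => (1 - s) * f k x + s * g k x) v := by
        unfold weight
        rw [← Real.exp_add, ← mul_add]
        gcongr
      refine le_trans ?_ h5
      have h6 := Real.add_one_le_exp (1 / 4 * (s * ∑ k, (g k (v k) - f k (v k)) / f k (v k) -
          n * (2 * (s * Z) ^ 2)))
      have h7 := mul_le_mul_of_nonneg_left h6 (weight_pos f v).le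
      refine le_trans (le_of_eq ?_) h7
      ring
    have h8 := integral_mono ((hint2.add (hint1.const_mul (s / 4))).sub
      (hint2.const_mul (s ^ 2 / 2 * n * Z ^ 2))) (hP.integrable_weight (μ := μ) hδ) hpt
    have h9 : ∫ v, weight f v + s / 4 * (weight f v * ∑ k, (g k (v k) - f k (v k)) / f k (v k)) -
          s ^ 2 / 2 * n * Z ^ 2 * weight f v ∂μ = J + s / 4 * I - s ^ 2 / 2 * n * Z ^ 2 * J := by
      have e := integral_sub (hint2.add (hint1.const_mul (s / 4)))
        (hint2.const_mul (s ^ 2 / 2 * n * Z ^ 2))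
      simp only [Pi.add_apply] at e
      rw [e, integral_add hint2 (hint1.const_mul _), integral_const_mul, integral_const_mul]
    have h10 := hmax s hs0 hs1'
    have h11 : J + s / 4 * I - s ^ 2 / 2 * n * Z ^ 2 * J ≤ J := by
      rw [← h9]; exact h8.trans h10
    have h12 : s * I ≤ s * (s * (2 * n * Z ^ 2 * J)) := by nlinarith
    exact le_of_mul_le_mul_left h12 hs0
  by_contra! hpos
  have hJ0 : 0 ≤ J := integral_nonneg fun v => (weight_pos f v).le
  set D := 2 * n * Z ^ 2 * J with hD
  have hD0 : 0 ≤ D := by positivity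
  -- If `I` were positive, this `s` would make the error smaller than `I`; the `+ 1` covers the case
  -- `D = 0`.
  have hs : 0 < min (1 / (2 * Z)) (I / (2 * (D + 1))) := lt_min (by positivity) (by positivity)
  have h1 := key _ hs (min_le_left _ _)
  have h2 : min (1 / (2 * Z)) (I / (2 * (D + 1))) * D ≤ I / (2 * (D + 1)) * D :=
    mul_le_mul_of_nonneg_right (min_le_right _ _) hD0
  have h3 : I / (2 * (D + 1)) * D < I := by
    rw [div_mul_eq_mul_div, div_lt_iff₀ (by positivity)]
    nlinarith
  linarith

/-- Variation by a rotation of the `i`-th and the `j`-th vector of the frame. -/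
lemma IsHaarFrame.integral_sq_sub_le (h : IsHaarFrame μ) {δ B : ℝ} (hδ : 0 < δ)
    {f : Fin n → Vec n → ℝ} (hf : Pinched δ B f) {i j : Fin n} (hij : i ≠ j) (θ : ℝ) :
    Real.exp (1 / 4 * (n * Real.log δ)) / (4 * B ^ 2) *
      ∫ v, (f i (Real.cos θ • v i + Real.sin θ • v j) - f i (v i)) ^ 2 ∂μ ≤
    ∫ v, weight f v * ((f i (Real.cos θ • v i + Real.sin θ • v j) - f i (v i)) / f i (v i) +
      (f j (Real.cos θ • v j - Real.sin θ • v i) - f j (v j)) / f j (v j)) ∂μ := by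
  have := h.isProbabilityMeasure
  have hB0 : 0 < B := hδ.trans_le ((hf.le i 0).trans (hf.ge i 0))
  set w0 := Real.exp (1 / 4 * (n * Real.log δ)) with hw0
  have hw0p : 0 < w0 := Real.exp_pos _
  have hmi : Measurable fun v : Fin n → Vec n => f i (Real.cos θ • v i + Real.sin θ • v j) :=
    (hf.measurable i).comp (by fun_prop)
  have hmj : Measurable fun v : Fin n → Vec n => f j (Real.cos θ • v j - Real.sin θ • v i) :=
    (hf.measurable j).comp (by fun_prop)
  have hei := hf.measurable_eval i
  have hej := hf.measurable_eval j
  have hbd : ∀ k x y, |f k x - f k y| ≤ B := fun k x y => abs_le.2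
    ⟨by linarith [hf.le k x, hf.ge k y], by linarith [hf.le k y, hf.ge k x]⟩
  have hint1 : Integrable (fun v : Fin n → Vec n =>
      (f i (Real.cos θ • v i + Real.sin θ • v j) - f i (v i)) ^ 2) μ :=
    integrable_of_measurable_of_bounded ((hmi.sub hei).pow_const 2) (B ^ 2) fun v => by
      rw [abs_pow]; exact pow_le_pow_left₀ (abs_nonneg _) (hbd _ _ _) 2
  have hint2 : Integrable (fun v : Fin n → Vec n => weight f v *
      ((f i (Real.cos θ • v i + Real.sin θ • v j) - f i (v i)) / f i (v i) +
      (f j (Real.cos θ • v j - Real.sin θ • v i) - f j (v j)) / f j (v j))) μ := by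
    refine hf.integrable_weight_mul hδ (((hmi.sub hei).div hei).add ((hmj.sub hej).div hej))
      (B / δ + B / δ) fun v => (abs_add_le _ _).trans (add_le_add ?_ ?_)
    · exact hf.abs_sub_div_le hδ _ _ (hf.le _ _) (hf.ge _ _)
    · exact hf.abs_sub_div_le hδ _ _ (hf.le _ _) (hf.ge _ _)
  have hint3 := hf.integrable_weight (μ := μ) hδ
  have hpt : ∀ v : Fin n → Vec n, weight f (pairRot i j θ v) + w0 / (4 * B ^ 2) / 4 *
      (f i (Real.cos θ • v i + Real.sin θ • v j) - f i (v i)) ^ 2 ≤ weight f v +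
      1 / 4 * (weight f v *
      ((f i (Real.cos θ • v i + Real.sin θ • v j) - f i (v i)) / f i (v i) +
      (f j (Real.cos θ • v j - Real.sin θ • v i) - f j (v j)) / f j (v j))) := by
    intro v
    have hw : w0 ≤ weight f v := hf.le_weight hδ v
    set xi := f i (v i) with hxi
    set xj := f j (v j) with hxj
    set yi := f i (Real.cos θ • v i + Real.sin θ • v j) with hyi
    set yj := f j (Real.cos θ • v j - Real.sin θ • v i) with hyj
    have hxi0 : 0 < xi := hδ.trans_le (hf.le _ _)
    have hxj0 : 0 < xj := hδ.trans_le (hf.le _ _)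
    have hyi0 : 0 < yi := hδ.trans_le (hf.le _ _)
    have hyj0 : 0 < yj := hδ.trans_le (hf.le _ _)
    have hxiB : xi ≤ B := hf.ge _ _
    have hyiB : yi ≤ B := hf.ge _ _
    -- `p` and `q` are the fourth roots of the ratios of new to old values: the rotation multiplies
    -- the weight by `p q`, while the relative increments are `p⁴ - 1` and `q⁴ - 1`.
    set p := Real.exp (1 / 4 * (Real.log yi - Real.log xi)) with hp
    set q := Real.exp (1 / 4 * (Real.log yj - Real.log xj)) with hq
    have hp4 : yi = xi * p ^ 4 := by
      rw [hp, ← Real.exp_nat_mul, Nat.cast_ofNat, ← mul_assoc]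
      norm_num
      rw [Real.exp_sub, Real.exp_log hyi0, Real.exp_log hxi0]
      field_simp
    have hq4 : yj = xj * q ^ 4 := by
      rw [hq, ← Real.exp_nat_mul, Nat.cast_ofNat, ← mul_assoc]
      norm_num
      rw [Real.exp_sub, Real.exp_log hyj0, Real.exp_log hxj0]
      field_simp
    have hp0 : 0 < p := Real.exp_pos _
    have hrot : weight f (pairRot i j θ v) = weight f v * (p * q) := by
      have hs : ∑ k, (Real.log (f k (pairRot i j θ v k)) - Real.log (f k (v k))) =
          (Real.log yi - Real.log xi) + (Real.log yj - Real.log xj) := by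
        rw [Fintype.sum_eq_add i j hij]
        · rw [pairRot_left hij, pairRot_right]
        · rintro k ⟨h1, h2⟩
          rw [pairRot_of_ne h1 h2, sub_self]
      unfold weight
      rw [hp, hq, ← Real.exp_add, ← Real.exp_add]
      congr 1
      rw [Finset.sum_sub_distrib] at hs
      linarith
    have e1 : (yi - xi) / xi = p ^ 4 - 1 := by rw [hp4]; field_simp
    have e2 : (yj - xj) / xj = q ^ 4 - 1 := by rw [hq4]; field_simp
    rw [hrot, e1, e2]
    -- `xi p²` is the geometric mean of `xi` and `yi`, so it is at most `B`.
    have h1 : (yi - xi) ^ 2 ≤ 4 * B ^ 2 * (1 - p ^ 2) ^ 2 := by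
      have a1 : xi * p ^ 2 ≤ B := by
        refine abs_le_of_sq_le_sq' ?_ hB0.le |>.2
        calc (xi * p ^ 2) ^ 2 = xi * yi := by rw [hp4]; ring
          _ ≤ B * B := mul_le_mul hxiB hyiB hyi0.le hB0.le
          _ = B ^ 2 := by ring
      have a2 : (xi * (1 + p ^ 2)) ^ 2 ≤ (2 * B) ^ 2 :=
        pow_le_pow_left₀ (by positivity) (by linarith) 2
      calc (yi - xi) ^ 2 = (xi * (1 + p ^ 2)) ^ 2 * (1 - p ^ 2) ^ 2 := by rw [hp4]; ring
        _ ≤ (2 * B) ^ 2 * (1 - p ^ 2) ^ 2 := mul_le_mul_of_nonneg_right a2 (sq_nonneg _)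
        _ = _ := by ring
    have h2 : w0 / (4 * B ^ 2) / 4 * (yi - xi) ^ 2 ≤ 1 / 4 * (weight f v * (1 - p ^ 2) ^ 2) := by
      calc w0 / (4 * B ^ 2) / 4 * (yi - xi) ^ 2
          ≤ w0 / (4 * B ^ 2) / 4 * (4 * B ^ 2 * (1 - p ^ 2) ^ 2) :=
            mul_le_mul_of_nonneg_left h1 (by positivity)
        _ = 1 / 4 * (w0 * (1 - p ^ 2) ^ 2) := by field_simp
        _ ≤ _ := by gcongr
    -- The difference of the two sides is `(p - q)²/2 + (1 - q²)²/4`. The term `(1 - p²)²` is what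
    -- the exponent `1/4` buys: with square roots in place of fourth roots only `(p - q)²/2` would
    -- remain, which gives no control when `p = q`.
    have h3 : p * q + 1 / 4 * (1 - p ^ 2) ^ 2 ≤ 1 + 1 / 4 * (p ^ 4 - 1 + (q ^ 4 - 1)) := by
      nlinarith [sq_nonneg (p - q), sq_nonneg (1 - q ^ 2)]
    have h4 := mul_le_mul_of_nonneg_left h3 (weight_pos f v).le
    linarith
  have hint4 : Integrable (fun v => weight f (pairRot i j θ v)) μ :=
    integrable_of_measurable_of_bounded
      (hf.measurable_weight.comp (measurable_pairRot i j θ))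
      (Real.exp (1 / 4 * (n * Real.log B))) fun v => by
        rw [abs_of_pos (weight_pos _ _)]; exact hf.weight_le hδ _
  -- After integration the two weights cancel, because the law of the frame is invariant under
  -- `pairRot`.
  have hmono := integral_mono (hint4.add (hint1.const_mul (w0 / (4 * B ^ 2) / 4)))
    (hint3.add (hint2.const_mul (1 / 4))) hpt
  simp only [Pi.add_apply] at hmono
  rw [integral_add hint4 (hint1.const_mul _), integral_add hint3 (hint2.const_mul _),
    integral_const_mul, integral_const_mul,
    h.integral_pairRot hij θ hf.measurable_weight] at hmono
  linarith

end OMCRidge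
end

noncomputable section

namespace OMCRidge

variable {n : ℕ} {μ : Measure (Fin n → Vec n)}

/-! ### Comparison of rotations within a frame with rotations in fixed planes -/

/-- Second difference of `f` at `u i`, along the other vectors of the frame `u`. -/
def frameDiff (f : Vec n → ℝ) (u : Fin n → Vec n) (i : Fin n) (ε : ℝ) : ℝ :=
  ∑ j ∈ Finset.univ.erase i, ((f (Real.cos ε • u i + Real.sin ε • u j) - f (u i)) +
    (f (Real.cos ε • u i - Real.sin ε • u j) - f (u i)))

/-- Second difference of `f` at `x`, along the rotations in the planes spanned by vectors of `e`. -/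
def planeDiff (f : Vec n → ℝ) (e : Fin n → Vec n) (x : Vec n) (ε : ℝ) : ℝ :=
  ∑ a, ∑ b ∈ Finset.univ.erase a, (f (planeRot e a b ε x) - f x)

/-- The two second differences agree up to third order, uniformly in the orthonormal bases. -/
def IsComparable (C ε₀ : ℝ) (f : Vec n → ℝ) : Prop :=
  ∀ (e u : OrthonormalBasis (Fin n) ℝ (Vec n)) (i : Fin n) (ε : ℝ), 0 < ε → ε ≤ ε₀ →
    |frameDiff f u i ε - planeDiff f e (u i) ε| ≤ C * ε ^ 3

/-- Taylor expansion of `exp` to second order. As `cos ε - 1` is `O(ε²)`, the only quadratic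
contribution not absorbed into `ε³` is the square of the sine term. -/
lemma exists_abs_exp_rot_sub_le (κ : ℝ) (hκ : 1 ≤ κ) : ∃ C ε₀ : ℝ, 0 < C ∧ 0 < ε₀ ∧
    ∀ ε p q : ℝ, 0 < ε → ε ≤ ε₀ → |p| ≤ κ → |q| ≤ κ →
      |Real.exp ((Real.cos ε - 1) * p + Real.sin ε * q) - 1 -
        ((Real.cos ε - 1) * p + Real.sin ε * q + Real.sin ε ^ 2 * q ^ 2 / 2)| ≤ C * ε ^ 3 := by
  refine ⟨(2 * κ) ^ 3 + 2 * κ ^ 2, 1 / (2 * κ), by positivity, by positivity, ?_⟩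
  intro ε p q h0 h1 hp hq
  have hε1 : ε * (2 * κ) ≤ 1 := by rwa [le_div_iff₀ (by positivity)] at h1
  have hε2 : ε ≤ 1 := by nlinarith
  have hs : |Real.sin ε| ≤ ε := by
    simpa [abs_of_pos h0] using Real.abs_sin_le_abs (x := ε)
  have hc0 : |Real.cos ε - 1| ≤ ε ^ 2 / 2 := by
    rw [abs_le]
    exact ⟨by have := Real.one_sub_sq_div_two_le_cos (x := ε); linarith,
      by have := Real.cos_le_one ε; have := sq_nonneg ε; linarith⟩
  have hcp : |(Real.cos ε - 1) * p| ≤ ε ^ 2 / 2 * κ := by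
    rw [abs_mul]; exact mul_le_mul hc0 hp (abs_nonneg _) (by positivity)
  have hsq : |Real.sin ε * q| ≤ ε * κ := by
    rw [abs_mul]; exact mul_le_mul hs hq (abs_nonneg _) h0.le
  set A := (Real.cos ε - 1) * p with hA
  set D := Real.sin ε * q with hD
  have hεε : ε ^ 2 ≤ ε := by nlinarith
  have hh : |A + D| ≤ ε * (2 * κ) := by
    refine (abs_add_le _ _).trans ?_
    nlinarith
  have h3 := Real.exp_bound (x := A + D) (hh.trans hε1) (n := 3) (by norm_num)
  have h4 : |A + D| ^ 3 ≤ (ε * (2 * κ)) ^ 3 := pow_le_pow_left₀ (abs_nonneg _) hh 3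
  have h5 : |Real.exp (A + D) - (1 + (A + D) + (A + D) ^ 2 / 2)| ≤ (2 * κ) ^ 3 * ε ^ 3 := by
    have e : ∑ m ∈ Finset.range 3, (A + D) ^ m / (m.factorial : ℝ) =
        1 + (A + D) + (A + D) ^ 2 / 2 := by
      simp [Finset.sum_range_succ, Nat.factorial]
    rw [e] at h3
    refine h3.trans ?_
    have : (0 : ℝ) ≤ |A + D| ^ 3 := by positivity
    norm_num [Nat.factorial]
    nlinarith
  have h6 : |A * D + A ^ 2 / 2| ≤ 2 * κ ^ 2 * ε ^ 3 := by
    have a1 : |A * D| ≤ ε ^ 2 / 2 * κ * (ε * κ) := by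
      rw [abs_mul]; exact mul_le_mul hcp hsq (abs_nonneg _) (by positivity)
    have a2 : |A ^ 2 / 2| ≤ (ε ^ 2 / 2 * κ) ^ 2 / 2 := by
      rw [abs_div, abs_pow, abs_two]
      gcongr
    have a3 : ε ^ 4 ≤ ε ^ 3 := pow_le_pow_of_le_one h0.le hε2 (by norm_num)
    have a4 := mul_le_mul_of_nonneg_left a3 (sq_nonneg κ)
    have a5 : (0 : ℝ) ≤ κ ^ 2 * ε ^ 3 := by positivity
    refine (abs_add_le _ _).trans ?_
    nlinarith
  have e : Real.exp (A + D) - 1 - (A + D + Real.sin ε ^ 2 * q ^ 2 / 2) =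
      (Real.exp (A + D) - (1 + (A + D) + (A + D) ^ 2 / 2)) + (A * D + A ^ 2 / 2) := by
    rw [hD]; ring
  rw [e]
  refine (abs_add_le _ _).trans ?_
  linarith

lemma inner_planeRot (e : Fin n → Vec n) (a b : Fin n) (θ : ℝ) (x y : Vec n) :
    inner ℝ (planeRot e a b θ x) y = inner ℝ x y +
      ((Real.cos θ - 1) * (inner ℝ (e a) x * inner ℝ (e a) y + inner ℝ (e b) x * inner ℝ (e b) y) +
      Real.sin θ * (inner ℝ (e a) x * inner ℝ (e b) y - inner ℝ (e b) x * inner ℝ (e a) y)) := by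
  simp only [planeRot, inner_add_left, inner_sub_left, real_inner_smul_left]
  ring

lemma sum_sq_inner (e : OrthonormalBasis (Fin n) ℝ (Vec n)) (y : Vec n) :
    ∑ a, inner ℝ (e a) y ^ 2 = ‖y‖ ^ 2 := by
  rw [← real_inner_self_eq_norm_sq, ← e.sum_inner_mul_inner y y]
  refine Finset.sum_congr rfl fun a _ => ?_
  rw [real_inner_comm y (e a), sq]

lemma sum_inner_mul_inner' (e : OrthonormalBasis (Fin n) ℝ (Vec n)) (x y : Vec n) :
    ∑ a, inner ℝ (e a) x * inner ℝ (e a) y = inner ℝ x y := by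
  rw [← e.sum_inner_mul_inner x y]
  refine Finset.sum_congr rfl fun a _ => ?_
  rw [real_inner_comm x (e a)]

/-- The quadratic main terms of both second differences of `exp ⟨·, y⟩` coincide. -/
lemma sum_main_terms_eq (e u : OrthonormalBasis (Fin n) ℝ (Vec n)) (i : Fin n) (y : Vec n)
    (c s : ℝ) :
    ∑ j ∈ Finset.univ.erase i, ((c * inner ℝ (u i) y + s * inner ℝ (u j) y +
        s ^ 2 * inner ℝ (u j) y ^ 2 / 2) +
      (c * inner ℝ (u i) y + s * (-inner ℝ (u j) y) + s ^ 2 * (-inner ℝ (u j) y) ^ 2 / 2)) =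
    ∑ a, ∑ b ∈ Finset.univ.erase a,
      (c * (inner ℝ (e a) (u i) * inner ℝ (e a) y + inner ℝ (e b) (u i) * inner ℝ (e b) y) +
      s * (inner ℝ (e a) (u i) * inner ℝ (e b) y - inner ℝ (e b) (u i) * inner ℝ (e a) y) +
      s ^ 2 * (inner ℝ (e a) (u i) * inner ℝ (e b) y - inner ℝ (e b) (u i) * inner ℝ (e a) y) ^ 2
        / 2) := by
  have hx : ∑ a, inner ℝ (e a) (u i) ^ 2 = 1 := by
    rw [sum_sq_inner, u.norm_eq_one, one_pow]
  have hy := sum_sq_inner e y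
  have hxy := sum_inner_mul_inner' e (u i) y
  have huy := sum_sq_inner u y
  set t := inner ℝ (u i) y with ht
  set X : Fin n → ℝ := fun a => inner ℝ (e a) (u i) with hX
  set Y : Fin n → ℝ := fun a => inner ℝ (e a) y with hY
  -- Both sums equal `2(n-1)ct + s²(‖y‖² - t²)`. The terms linear in `s` cancel, by the two signs in
  -- the frame sum and by antisymmetry under `a ↔ b` in the plane sum. To second order this is the
  -- Laplacian of the sphere written as the sum of the squared generators of rotations.
  have hL : ∑ j ∈ Finset.univ.erase i, ((c * t + s * inner ℝ (u j) y +
        s ^ 2 * inner ℝ (u j) y ^ 2 / 2) +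
      (c * t + s * (-inner ℝ (u j) y) + s ^ 2 * (-inner ℝ (u j) y) ^ 2 / 2)) =
      2 * (n - 1) * c * t + s ^ 2 * (‖y‖ ^ 2 - t ^ 2) := by
    have h1 := Finset.sum_erase_eq_sub (f := fun j => (c * t + s * inner ℝ (u j) y +
        s ^ 2 * inner ℝ (u j) y ^ 2 / 2) +
      (c * t + s * (-inner ℝ (u j) y) + s ^ 2 * (-inner ℝ (u j) y) ^ 2 / 2)) (Finset.mem_univ i)
    rw [h1, ← huy]
    have h2 : ∑ j, ((c * t + s * inner ℝ (u j) y + s ^ 2 * inner ℝ (u j) y ^ 2 / 2) +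
      (c * t + s * (-inner ℝ (u j) y) + s ^ 2 * (-inner ℝ (u j) y) ^ 2 / 2)) =
        ∑ j : Fin n, (2 * (c * t) + s ^ 2 * inner ℝ (u j) y ^ 2) :=
      Finset.sum_congr rfl fun j _ => by ring
    rw [h2, Finset.sum_add_distrib]
    simp only [← Finset.mul_sum, Finset.sum_const, Finset.card_univ, Fintype.card_fin, nsmul_eq_mul]
    rw [← ht]
    ring
  have hR : ∑ a, ∑ b ∈ Finset.univ.erase a,
      (c * (X a * Y a + X b * Y b) + s * (X a * Y b - X b * Y a) +
        s ^ 2 * (X a * Y b - X b * Y a) ^ 2 / 2) =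
      2 * (n - 1) * c * t + s ^ 2 * (‖y‖ ^ 2 - t ^ 2) := by
    have h1 : ∀ a, ∑ b ∈ Finset.univ.erase a,
      (c * (X a * Y a + X b * Y b) + s * (X a * Y b - X b * Y a) +
        s ^ 2 * (X a * Y b - X b * Y a) ^ 2 / 2) =
        n * c * (X a * Y a) + c * t + s * (X a * ∑ b, Y b - Y a * ∑ b, X b) +
        s ^ 2 / 2 * (X a ^ 2 * ‖y‖ ^ 2 - 2 * (X a * Y a) * t + Y a ^ 2) - 2 * c * (X a * Y a) := by
      intro a
      have e1 : ∀ b, c * (X a * Y a + X b * Y b) + s * (X a * Y b - X b * Y a) +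
          s ^ 2 * (X a * Y b - X b * Y a) ^ 2 / 2 = c * (X a * Y a) + c * (X b * Y b) +
          s * X a * Y b - s * Y a * X b + s ^ 2 / 2 * X a ^ 2 * Y b ^ 2 -
          s ^ 2 * (X a * Y a) * (X b * Y b) + s ^ 2 / 2 * Y a ^ 2 * X b ^ 2 := fun b => by ring
      have e2 : ∑ b, X b * Y b = t := hxy
      have e3 : ∑ b, X b ^ 2 = 1 := hx
      have e4 : ∑ b, Y b ^ 2 = ‖y‖ ^ 2 := hy
      rw [Finset.sum_erase_eq_sub (Finset.mem_univ a), Finset.sum_congr rfl fun b _ => e1 b]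
      simp only [Finset.sum_add_distrib, Finset.sum_sub_distrib, ← Finset.mul_sum, e2, e3, e4,
        Finset.sum_const, Finset.card_univ, Fintype.card_fin, nsmul_eq_mul]
      ring
    rw [Finset.sum_congr rfl fun a _ => h1 a]
    simp only [Finset.sum_sub_distrib, Finset.sum_add_distrib, ← Finset.mul_sum, ← Finset.sum_mul]
    have e1 : ∑ a, X a * Y a = t := hxy
    have e2 : ∑ a, X a ^ 2 = 1 := hx
    have e3 : ∑ a, Y a ^ 2 = ‖y‖ ^ 2 := hy
    rw [e1, e2, e3]
    simp only [Finset.sum_const, Finset.card_univ, Fintype.card_fin, nsmul_eq_mul]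
    ring
  exact hL.trans hR.symm

/-- Under a rotation the exponent changes by `(cos ε - 1) p + sin ε q` with bounded `p` and `q`, so
the uniform Taylor bound applies to every summand, and the main terms agree by `sum_main_terms_eq`.
-/
lemma IsComparable.exp_inner (y : Vec n) :
    ∃ C ε₀ : ℝ, 0 < C ∧ 0 < ε₀ ∧ IsComparable C ε₀ fun x => Real.exp (inner ℝ x y) := by
  set κ : ℝ := 1 + 2 * ‖y‖ with hκ
  have hκ1 : 1 ≤ κ := by rw [hκ]; linarith [norm_nonneg y]
  obtain ⟨C, ε₀, hC, hε₀, hb⟩ := exists_abs_exp_rot_sub_le κ hκ1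
  -- At most `n` frame directions with two differences each, and at most `n²` ordered pairs of
  -- planes, each costing one Taylor error; the `+ 1` keeps the constant positive for `n = 0`.
  refine ⟨Real.exp ‖y‖ * (C * (2 * n + n * n) + 1), ε₀, by positivity, hε₀, ?_⟩
  intro e u i ε h0 h1
  set c := Real.cos ε - 1 with hc
  set s := Real.sin ε with hs
  set t := inner ℝ (u i) y with ht
  have hin : ∀ b : OrthonormalBasis (Fin n) ℝ (Vec n), ∀ k, |inner ℝ (b k) y| ≤ ‖y‖ := fun b k => by
    simpa using abs_real_inner_le_norm (b k) y
  have hin1 : ∀ k, |inner ℝ (e k) (u i)| ≤ 1 := fun k => by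
    simpa using abs_real_inner_le_norm (e k) (u i)
  have hyκ : ‖y‖ ≤ κ := by rw [hκ]; linarith [norm_nonneg y]
  have hprod : ∀ a b, |inner ℝ (e a) (u i) * inner ℝ (e b) y| ≤ ‖y‖ := fun a b => by
    rw [abs_mul]
    simpa using mul_le_mul (hin1 a) (hin e b) (abs_nonneg _) zero_le_one
  set P : Fin n → Fin n → ℝ := fun a b =>
    inner ℝ (e a) (u i) * inner ℝ (e a) y + inner ℝ (e b) (u i) * inner ℝ (e b) y with hP
  set Q : Fin n → Fin n → ℝ := fun a b =>
    inner ℝ (e a) (u i) * inner ℝ (e b) y - inner ℝ (e b) (u i) * inner ℝ (e a) y with hQ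
  have hPb : ∀ a b, |P a b| ≤ κ := fun a b => by
    refine (abs_add_le _ _).trans ?_
    linarith [hprod a a, hprod b b]
  have hQb : ∀ a b, |Q a b| ≤ κ := fun a b => by
    refine (abs_sub _ _).trans ?_
    linarith [hprod a b, hprod b a]
  set G : ℝ → ℝ → ℝ := fun p q => Real.exp (c * p + s * q) - 1 with hG
  set M : ℝ → ℝ → ℝ := fun p q => c * p + s * q + s ^ 2 * q ^ 2 / 2 with hM
  have hGM : ∀ p q, |p| ≤ κ → |q| ≤ κ → |G p q - M p q| ≤ C * ε ^ 3 := fun p q hp hq =>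
    hb ε p q h0 h1 hp hq
  have hF : frameDiff (fun x => Real.exp (inner ℝ x y)) u i ε = Real.exp t *
      ∑ j ∈ Finset.univ.erase i, (G t (inner ℝ (u j) y) + G t (-inner ℝ (u j) y)) := by
    rw [frameDiff, Finset.mul_sum]
    refine Finset.sum_congr rfl fun j _ => ?_
    simp only [hG, inner_add_left, inner_sub_left, real_inner_smul_left]
    rw [mul_add, mul_sub, mul_sub, ← Real.exp_add, ← Real.exp_add, mul_one, ← ht]
    congr 3 <;> (rw [hc, hs]; ring)
  have hPl : planeDiff (fun x => Real.exp (inner ℝ x y)) e (u i) ε = Real.exp t *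
      ∑ a, ∑ b ∈ Finset.univ.erase a, G (P a b) (Q a b) := by
    rw [planeDiff, Finset.mul_sum]
    refine Finset.sum_congr rfl fun a _ => ?_
    rw [Finset.mul_sum]
    refine Finset.sum_congr rfl fun b _ => ?_
    have hexp : ∀ z, Real.exp (t + z) - Real.exp t = Real.exp t * (Real.exp z - 1) := fun z => by
      rw [Real.exp_add]; ring
    simp only [hG, inner_planeRot]
    exact hexp _
  have hmain : ∑ j ∈ Finset.univ.erase i, (M t (inner ℝ (u j) y) + M t (-inner ℝ (u j) y)) =
      ∑ a, ∑ b ∈ Finset.univ.erase a, M (P a b) (Q a b) := sum_main_terms_eq e u i y c s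
  have htb : |t| ≤ κ := (hin u i).trans hyκ
  have hcard : ∀ a : Fin n, ((Finset.univ.erase a).card : ℝ) ≤ n := fun a => by
    have := Finset.card_le_univ (Finset.univ.erase a)
    simp only [Fintype.card_fin] at this
    exact_mod_cast this
  have hCε : 0 ≤ C * ε ^ 3 := by positivity
  have hd1 : |∑ j ∈ Finset.univ.erase i, (G t (inner ℝ (u j) y) + G t (-inner ℝ (u j) y)) -
      ∑ j ∈ Finset.univ.erase i, (M t (inner ℝ (u j) y) + M t (-inner ℝ (u j) y))| ≤
      n * (2 * (C * ε ^ 3)) := by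
    rw [← Finset.sum_sub_distrib]
    refine (Finset.abs_sum_le_sum_abs _ _).trans ?_
    refine (Finset.sum_le_card_nsmul _ _ (2 * (C * ε ^ 3)) fun j _ => ?_).trans ?_
    · have b1 := hGM t (inner ℝ (u j) y) htb ((hin u j).trans hyκ)
      have b2 := hGM t (-inner ℝ (u j) y) htb (by rw [abs_neg]; exact (hin u j).trans hyκ)
      calc _ = |(G t (inner ℝ (u j) y) - M t (inner ℝ (u j) y)) +
            (G t (-inner ℝ (u j) y) - M t (-inner ℝ (u j) y))| := by congr 1; ring
        _ ≤ _ := (abs_add_le _ _).trans (by linarith)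
    · rw [nsmul_eq_mul]
      exact mul_le_mul_of_nonneg_right (hcard i) (by positivity)
  have hd2 : |∑ a, ∑ b ∈ Finset.univ.erase a, G (P a b) (Q a b) -
      ∑ a, ∑ b ∈ Finset.univ.erase a, M (P a b) (Q a b)| ≤ n * (n * (C * ε ^ 3)) := by
    rw [← Finset.sum_sub_distrib]
    refine (Finset.abs_sum_le_sum_abs _ _).trans ?_
    refine (Finset.sum_le_card_nsmul _ _ (n * (C * ε ^ 3)) fun a _ => ?_).trans ?_
    · rw [← Finset.sum_sub_distrib]
      refine (Finset.abs_sum_le_sum_abs _ _).trans ?_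
      refine (Finset.sum_le_card_nsmul _ _ (C * ε ^ 3) fun b _ => hGM _ _ (hPb a b)
        (hQb a b)).trans ?_
      rw [nsmul_eq_mul]
      exact mul_le_mul_of_nonneg_right (hcard a) hCε
    · simp
  rw [hF, hPl, ← mul_sub, abs_mul, abs_of_pos (Real.exp_pos t)]
  have hexp : Real.exp t ≤ Real.exp ‖y‖ := Real.exp_le_exp.2 ((le_abs_self _).trans (hin u i))
  rw [hmain] at hd1
  have hd3 : |∑ j ∈ Finset.univ.erase i, (G t (inner ℝ (u j) y) + G t (-inner ℝ (u j) y)) -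
      ∑ a, ∑ b ∈ Finset.univ.erase a, G (P a b) (Q a b)| ≤ (C * (2 * n + n * n) + 1) * ε ^ 3 := by
    refine (abs_sub_le _ (∑ a, ∑ b ∈ Finset.univ.erase a, M (P a b) (Q a b)) _).trans ?_
    rw [abs_sub_comm] at hd2
    have : (0 : ℝ) ≤ ε ^ 3 := by positivity
    linarith
  calc _ ≤ Real.exp ‖y‖ * ((C * (2 * n + n * n) + 1) * ε ^ 3) :=
        mul_le_mul hexp hd3 (abs_nonneg _) (Real.exp_pos _).le
    _ = _ := by ring

lemma IsComparable.mono {C C' ε₀ ε₁ : ℝ} {f : Vec n → ℝ} (hf : IsComparable C ε₀ f)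
    (hC : C ≤ C') (hε : ε₁ ≤ ε₀) : IsComparable C' ε₁ f := fun e u i ε h0 h1 =>
  (hf e u i ε h0 (h1.trans hε)).trans (mul_le_mul_of_nonneg_right hC (by positivity))

lemma frameDiff_linear (f g : Vec n → ℝ) (r s : ℝ) (u : Fin n → Vec n) (i : Fin n) (ε : ℝ) :
    frameDiff (fun x => r * f x + s * g x) u i ε = r * frameDiff f u i ε + s * frameDiff g u i ε := by
  simp only [frameDiff, Finset.mul_sum, ← Finset.sum_add_distrib]
  exact Finset.sum_congr rfl fun j _ => by ring

lemma planeDiff_linear (f g : Vec n → ℝ) (r s : ℝ) (e : Fin n → Vec n) (x : Vec n) (ε : ℝ) :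
    planeDiff (fun x => r * f x + s * g x) e x ε = r * planeDiff f e x ε + s * planeDiff g e x ε := by
  simp only [planeDiff, Finset.mul_sum, ← Finset.sum_add_distrib]
  exact Finset.sum_congr rfl fun a _ => Finset.sum_congr rfl fun b _ => by ring

lemma IsComparable.linear {C D ε₀ : ℝ} {f g : Vec n → ℝ} (hf : IsComparable C ε₀ f)
    (hg : IsComparable D ε₀ g) (r s : ℝ) :
    IsComparable (|r| * C + |s| * D) ε₀ fun x => r * f x + s * g x := fun e u i ε h0 h1 => by
  rw [frameDiff_linear, planeDiff_linear]
  have h2 := mul_le_mul_of_nonneg_left (hf e u i ε h0 h1) (abs_nonneg r)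
  have h3 := mul_le_mul_of_nonneg_left (hg e u i ε h0 h1) (abs_nonneg s)
  rw [← abs_mul] at h2 h3
  calc _ = |r * (frameDiff f u i ε - planeDiff f e (u i) ε) +
        s * (frameDiff g u i ε - planeDiff g e (u i) ε)| := by congr 1; ring
    _ ≤ _ := (abs_add_le _ _).trans (by linarith)

/-- All rotated points stay on the unit sphere, so the extension of a function off the sphere is
irrelevant. -/
lemma IsComparable.congr {C ε₀ : ℝ} {f g : Vec n → ℝ} (hf : IsComparable C ε₀ f)
    (hfg : ∀ x, ‖x‖ = 1 → f x = g x) : IsComparable C ε₀ g := fun e u i ε h0 h1 => by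
  have h2 : frameDiff g u i ε = frameDiff f u i ε := by
    refine Finset.sum_congr rfl fun j hj => ?_
    have hij : i ≠ j := (Finset.ne_of_mem_erase hj).symm
    have hp := fun θ => (orthonormal_pairRot u.orthonormal hij θ).1 i
    simp only [pairRot_left hij] at hp
    have h3 := hp (-ε)
    rw [Real.cos_neg, Real.sin_neg, neg_smul, ← sub_eq_add_neg] at h3
    rw [hfg _ (hp ε), hfg _ h3, hfg _ (u.norm_eq_one i)]
  have h4 : planeDiff g e (u i) ε = planeDiff f e (u i) ε := by
    refine Finset.sum_congr rfl fun a _ => Finset.sum_congr rfl fun b hb => ?_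
    have hab : a ≠ b := (Finset.ne_of_mem_erase hb).symm
    rw [hfg _ (u.norm_eq_one i), hfg _ ((norm_planeRot e.orthonormal hab ε _).trans
      (u.norm_eq_one i))]
  rw [h2, h4]
  exact hf e u i ε h0 h1

/-- Both difference operators are equivariant under isometries. Quantifying over all bases in
`IsComparable` makes the constants survive unchanged. -/
lemma IsComparable.comp_isometry {C ε₀ : ℝ} {f : Vec n → ℝ} (hf : IsComparable C ε₀ f)
    (U : Vec n ≃ₗᵢ[ℝ] Vec n) : IsComparable C ε₀ fun x => f (U x) := fun e u i ε h0 h1 => by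
  have h := hf (e.map U) (u.map U) i ε h0 h1
  have h2 : frameDiff (fun x => f (U x)) u i ε = frameDiff f (u.map U) i ε := by
    simp [frameDiff]
  have h3 : planeDiff (fun x => f (U x)) e (u i) ε = planeDiff f (e.map U) (u.map U i) ε := by
    simp only [planeDiff, map_planeRot, OrthonormalBasis.map_apply]
    rfl
  rw [h2, h3]
  exact h

end OMCRidge
end

noncomputable section

namespace OMCRidge

variable {n : ℕ} {μ : Measure (Fin n → Vec n)}

/-! ### Maximizers of the functional are constant -/

lemma sum_erase_comm (t : Fin n → Fin n → ℝ) :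
    ∑ i, ∑ j ∈ Finset.univ.erase i, t i j = ∑ i, ∑ j ∈ Finset.univ.erase i, t j i := by
  refine Finset.sum_comm' fun x y => ?_
  simp [eq_comm]

/-- Summed over ordered pairs, the right-hand sides of the rotation estimate form the weighted
second differences along the frame. Replacing these by differences in fixed planes costs `O(ε³)`,
and what remains is a sum of first variations at a maximizer, hence nonpositive. -/
lemma IsHaarFrame.integral_sq_sub_le_of_isMax (h : IsHaarFrame μ) {δ B C ε₀ : ℝ} (hδ : 0 < δ)
    (hC : 0 ≤ C) {f : Fin n → Vec n → ℝ} (hf : Pinched δ B f)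
    (hcomp : ∀ k, IsComparable C ε₀ (f k))
    (hmax : ∀ U : Vec n ≃ₗᵢ[ℝ] Vec n, ∀ s : ℝ, 0 < s → s ≤ 1 →
      ∫ v, weight (fun k x => (1 - s) * f k x + s * f k (U x)) v ∂μ ≤ ∫ v, weight f v ∂μ)
    {i j : Fin n} (hij : i ≠ j) :
    ∃ C' : ℝ, ∀ ε : ℝ, 0 < ε → ε ≤ ε₀ →
      ∫ v, (f i (Real.cos ε • v i + Real.sin ε • v j) - f i (v i)) ^ 2 ∂μ ≤ C' * ε ^ 3 := by
  have := h.isProbabilityMeasure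
  have hB0 : 0 < B := hδ.trans_le ((hf.le i 0).trans (hf.ge i 0))
  set κ := Real.exp (1 / 4 * (n * Real.log δ)) / (4 * B ^ 2) with hκ
  have hκ0 : 0 < κ := by positivity
  set W := Real.exp (1 / 4 * (n * Real.log B)) with hW
  have hW0 : 0 < W := Real.exp_pos _
  refine ⟨W * (n * (C / δ)) / κ, fun ε h0 h1 => ?_⟩
  have hme : ∀ k, Measurable fun v : Fin n → Vec n => f k (v k) := hf.measurable_eval
  have hm1 : ∀ k l, Measurable fun v : Fin n → Vec n =>
      f k (Real.cos ε • v k + Real.sin ε • v l) := fun k l => (hf.measurable k).comp (by fun_prop)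
  have hm2 : ∀ k l, Measurable fun v : Fin n → Vec n =>
      f k (Real.cos ε • v k - Real.sin ε • v l) := fun k l => (hf.measurable k).comp (by fun_prop)
  set D : Fin n → Fin n → ℝ := fun k l =>
    ∫ v, (f k (Real.cos ε • v k + Real.sin ε • v l) - f k (v k)) ^ 2 ∂μ with hD
  have hD0 : ∀ k l, 0 ≤ D k l := fun k l => integral_nonneg fun v => sq_nonneg _
  set t : Fin n → Fin n → (Fin n → Vec n) → ℝ := fun k l v => weight f v *
    ((f k (Real.cos ε • v k + Real.sin ε • v l) - f k (v k)) / f k (v k) +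
      (f l (Real.cos ε • v l - Real.sin ε • v k) - f l (v l)) / f l (v l)) with ht
  have htint : ∀ k l, Integrable (t k l) μ := fun k l => by
    refine hf.integrable_weight_mul hδ ((((hm1 k l).sub (hme k)).div (hme k)).add
      (((hm2 l k).sub (hme l)).div (hme l))) (B / δ + B / δ) fun v =>
        (abs_add_le _ _).trans (add_le_add ?_ ?_)
    · exact hf.abs_sub_div_le hδ _ _ (hf.le _ _) (hf.ge _ _)
    · exact hf.abs_sub_div_le hδ _ _ (hf.le _ _) (hf.ge _ _)
  -- Every pair contributes a nonnegative amount, so the sum bounds each single pair.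
  have hstep : κ * D i j ≤ ∫ v, ∑ k, ∑ l ∈ Finset.univ.erase k, t k l v ∂μ := by
    rw [integral_finsetSum _ fun k _ => integrable_finsetSum _ fun l _ => htint k l]
    have e : ∀ k, ∫ v, ∑ l ∈ Finset.univ.erase k, t k l v ∂μ =
        ∑ l ∈ Finset.univ.erase k, ∫ v, t k l v ∂μ := fun k =>
      integral_finsetSum _ fun l _ => htint k l
    simp only [e]
    have hle : ∀ k, ∀ l ∈ Finset.univ.erase k, κ * D k l ≤ ∫ v, t k l v ∂μ := fun k l hl =>
      h.integral_sq_sub_le hδ hf (Finset.ne_of_mem_erase hl).symm ε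
    have hnn : ∀ k, ∀ l ∈ Finset.univ.erase k, 0 ≤ ∫ v, t k l v ∂μ := fun k l hl =>
      (mul_nonneg hκ0.le (hD0 k l)).trans (hle k l hl)
    have hmem : j ∈ Finset.univ.erase i := by simp [hij.symm]
    calc κ * D i j ≤ ∫ v, t i j v ∂μ := hle i j hmem
      _ ≤ ∑ l ∈ Finset.univ.erase i, ∫ v, t i l v ∂μ :=
        Finset.single_le_sum (f := fun l => ∫ v, t i l v ∂μ) (hnn i) hmem
      _ ≤ _ := Finset.single_le_sum (f := fun k => ∑ l ∈ Finset.univ.erase k, ∫ v, t k l v ∂μ)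
        (fun k _ => Finset.sum_nonneg (hnn k)) (Finset.mem_univ i)
  -- Exchanging the names of the two indices turns the increments with `- sin ε` into the backward
  -- halves of `frameDiff`.
  have hsum : ∀ v, ∑ k, ∑ l ∈ Finset.univ.erase k, t k l v =
      weight f v * ∑ k, frameDiff (f k) v k ε / f k (v k) := by
    intro v
    simp only [ht, ← Finset.mul_sum, Finset.sum_add_distrib]
    congr 1
    rw [sum_erase_comm fun k l =>
      (f l (Real.cos ε • v l - Real.sin ε • v k) - f l (v l)) / f l (v l),
      ← Finset.sum_add_distrib]
    refine Finset.sum_congr rfl fun k _ => ?_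
    rw [frameDiff, Finset.sum_add_distrib, add_div, Finset.sum_div, Finset.sum_div]
  set e := EuclideanSpace.basisFun (Fin n) ℝ with he
  have hmR : ∀ a b k, Measurable fun v : Fin n → Vec n => f k (planeRot e a b ε (v k)) := by
    intro a b k
    refine (hf.measurable k).comp ?_
    unfold planeRot
    fun_prop
  have hplane : ∀ v, weight f v * ∑ k, planeDiff (f k) e (v k) ε / f k (v k) =
      ∑ a, ∑ b ∈ Finset.univ.erase a,
        weight f v * ∑ k, (f k (planeRot e a b ε (v k)) - f k (v k)) / f k (v k) := by
    intro v
    simp only [← Finset.mul_sum]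
    congr 1
    simp only [planeDiff, Finset.sum_div]
    rw [Finset.sum_comm]
    exact Finset.sum_congr rfl fun a _ => Finset.sum_comm
  have hRint : ∀ a b, Integrable (fun v => weight f v *
      ∑ k, (f k (planeRot e a b ε (v k)) - f k (v k)) / f k (v k)) μ := by
    intro a b
    refine hf.integrable_weight_mul hδ (Finset.measurable_sum _ fun k _ =>
      ((hmR a b k).sub (hme k)).div (hme k)) (∑ _k : Fin n, B / δ) fun v => ?_
    exact (Finset.abs_sum_le_sum_abs _ _).trans (Finset.sum_le_sum fun k _ =>
      hf.abs_sub_div_le hδ _ _ (hf.le _ _) (hf.ge _ _))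
  -- For a fixed plane the same isometry acts on all components at once, so `f ∘ U` is an admissible
  -- direction of variation. This fails for rotations in planes that move with the frame.
  have hplane_le : ∫ v, weight f v * ∑ k, planeDiff (f k) e (v k) ε / f k (v k) ∂μ ≤ 0 := by
    simp only [hplane]
    rw [integral_finsetSum _ fun a _ => integrable_finsetSum _ fun b _ => hRint a b]
    refine Finset.sum_nonpos fun a _ => ?_
    rw [integral_finsetSum _ fun b _ => hRint a b]
    refine Finset.sum_nonpos fun b hb => ?_
    have hab : a ≠ b := (Finset.ne_of_mem_erase hb).symm
    have hg : Pinched δ B fun k x => f k (planeRotIso e hab ε x) :=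
      ⟨fun k => (hf.measurable k).comp (planeRotIso e hab ε).continuous.measurable,
        fun k x => hf.le _ _, fun k x => hf.ge _ _⟩
    exact integral_weight_mul_sum_nonpos hδ hf hg fun s h2 h3 => hmax (planeRotIso e hab ε) s h2 h3
  have hpint : Integrable (fun v => weight f v *
      ∑ k, planeDiff (f k) e (v k) ε / f k (v k)) μ := by
    simp only [hplane]
    exact integrable_finsetSum _ fun a _ => integrable_finsetSum _ fun b _ => hRint a b
  have hfint : Integrable (fun v => weight f v *
      ∑ k, frameDiff (f k) v k ε / f k (v k)) μ := by
    simp only [← hsum]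
    exact integrable_finsetSum _ fun a _ => integrable_finsetSum _ fun b _ => htint a b
  have hfin : ∫ v, weight f v * ∑ k, frameDiff (f k) v k ε / f k (v k) ∂μ ≤
      W * (n * (C / δ)) * ε ^ 3 := by
    have hae : ∀ᵐ v ∂μ, weight f v * ∑ k, frameDiff (f k) v k ε / f k (v k) ≤
        weight f v * ∑ k, planeDiff (f k) e (v k) ε / f k (v k) + W * (n * (C / δ)) * ε ^ 3 := by
      filter_upwards [h.orthonormal] with v hv
      obtain ⟨u, rfl⟩ := exists_orthonormalBasis_coe_eq hv
      have hk : ∀ k, frameDiff (f k) u k ε / f k (u k) ≤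
          planeDiff (f k) e (u k) ε / f k (u k) + C / δ * ε ^ 3 := by
        intro k
        have hp : 0 < f k (u k) := hδ.trans_le (hf.le _ _)
        have hc := (abs_le.1 (hcomp k e u k ε h0 h1)).2
        rw [← sub_le_iff_le_add', ← sub_div]
        calc _ ≤ C * ε ^ 3 / f k (u k) := by gcongr
          _ ≤ C * ε ^ 3 / δ := by
            have := hf.le k (u k)
            have : 0 ≤ C * ε ^ 3 := by positivity
            gcongr
          _ = _ := by ring
      have hS := Finset.sum_le_sum fun k (_ : k ∈ Finset.univ) => hk k
      rw [Finset.sum_add_distrib] at hS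
      simp only [Finset.sum_const, Finset.card_univ, Fintype.card_fin, nsmul_eq_mul] at hS
      have hw := weight_pos f u
      have hw2 : weight f u * (n * (C / δ * ε ^ 3)) ≤ W * (n * (C / δ * ε ^ 3)) :=
        mul_le_mul_of_nonneg_right (hf.weight_le hδ _) (by positivity)
      have := mul_le_mul_of_nonneg_left hS hw.le
      linarith
    have h2 := integral_mono_ae hfint (hpint.add (integrable_const (W * (n * (C / δ)) * ε ^ 3))) hae
    simp only [Pi.add_apply] at h2
    rw [integral_add hpint (integrable_const _)] at h2
    simp only [integral_const, probReal_univ, one_smul] at h2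
    linarith
  simp only [hsum] at hstep
  have h3 := hstep.trans hfin
  rw [div_mul_eq_mul_div, le_div_iff₀ hκ0]
  linarith

/-- A rotation by `Mθ` is `M` rotations by `θ`. All steps have the same mean square increment by
invariance of the law, and Cauchy-Schwarz on the telescoping sum costs a factor `M` beyond their
number. -/
lemma IsHaarFrame.integral_sq_sub_mul_le (h : IsHaarFrame μ) {δ B : ℝ}
    {f : Fin n → Vec n → ℝ} (hf : Pinched δ B f) (hδ : 0 < δ) {i j : Fin n} (hij : i ≠ j) (θ : ℝ)
    (M : ℕ) :
    ∫ v, (f i (Real.cos (M * θ) • v i + Real.sin (M * θ) • v j) - f i (v i)) ^ 2 ∂μ ≤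
      M ^ 2 * ∫ v, (f i (Real.cos θ • v i + Real.sin θ • v j) - f i (v i)) ^ 2 ∂μ := by
  have := h.isProbabilityMeasure
  set g : (Fin n → Vec n) → ℝ := fun v => f i (v i) with hg
  have hgm : Measurable g := hf.measurable_eval i
  have hbd : ∀ v w, |g v - g w| ≤ B := fun v w => abs_le.2
    ⟨by linarith [hf.le i (v i), hf.ge i (w i)], by linarith [hf.le i (w i), hf.ge i (v i)]⟩
  have hq : ∀ φ v, f i (Real.cos φ • v i + Real.sin φ • v j) = g (pairRot i j φ v) := fun φ v => by
    simp only [hg, pairRot_left hij]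
  simp only [hq]
  change ∫ v, (g (pairRot i j (M * θ) v) - g v) ^ 2 ∂μ ≤
    M ^ 2 * ∫ v, (g (pairRot i j θ v) - g v) ^ 2 ∂μ
  have hint : ∀ φ ψ : ℝ,
      Integrable (fun v => (g (pairRot i j φ v) - g (pairRot i j ψ v)) ^ 2) μ := fun φ ψ =>
    integrable_of_measurable_of_bounded (((hgm.comp (measurable_pairRot i j φ)).sub
      (hgm.comp (measurable_pairRot i j ψ))).pow_const 2) (B ^ 2) fun v => by
        rw [abs_pow]; exact pow_le_pow_left₀ (abs_nonneg _) (hbd _ _) 2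
  have hp0 : ∀ v, pairRot i j 0 v = v := fun v => by
    funext k
    by_cases hi : k = i
    · subst hi; simp [pairRot_left hij]
    by_cases hj : k = j
    · subst hj; simp [pairRot_right]
    rw [pairRot_of_ne hi hj]
  have hpt : ∀ v, (g (pairRot i j (M * θ) v) - g v) ^ 2 ≤ M * ∑ k ∈ Finset.range M,
      (g (pairRot i j (((k + 1 : ℕ) : ℝ) * θ) v) - g (pairRot i j ((k : ℝ) * θ) v)) ^ 2 := by
    intro v
    have hs := Finset.sum_range_sub (fun k : ℕ => g (pairRot i j ((k : ℝ) * θ) v)) M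
    simp only [Nat.cast_zero, zero_mul, hp0] at hs
    rw [← hs]
    simpa using sq_sum_le_card_mul_sum_sq (s := Finset.range M) (f := fun k : ℕ =>
      g (pairRot i j (((k + 1 : ℕ) : ℝ) * θ) v) - g (pairRot i j ((k : ℝ) * θ) v))
  have hterm : ∀ k : ℕ, ∫ v, (g (pairRot i j (((k + 1 : ℕ) : ℝ) * θ) v) -
      g (pairRot i j ((k : ℝ) * θ) v)) ^ 2 ∂μ = ∫ v, (g (pairRot i j θ v) - g v) ^ 2 ∂μ := by
    intro k
    rw [← h.integral_pairRot hij (k * θ)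
      (F := fun v => (g (pairRot i j θ v) - g v) ^ 2)
      (((hgm.comp (measurable_pairRot i j θ)).sub hgm).pow_const 2)]
    simp only [pairRot_add hij]
    congr! 7
    push_cast
    ring
  have hint0 := hint (M * θ) 0
  simp only [hp0] at hint0
  calc _ ≤ ∫ v, M * ∑ k ∈ Finset.range M, (g (pairRot i j (((k + 1 : ℕ) : ℝ) * θ) v) -
        g (pairRot i j ((k : ℝ) * θ) v)) ^ 2 ∂μ :=
        integral_mono hint0
          ((integrable_finsetSum _ fun k _ => hint _ _).const_mul _) hpt
    _ = _ := by
        rw [integral_const_mul, integral_finsetSum _ fun k _ => hint _ _]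
        simp only [hterm, Finset.sum_const, Finset.card_range, nsmul_eq_mul]
        ring

/-- With `M` steps of size `θ/M` the bound is `M² · C'(θ/M)³`, which tends to zero: any exponent
above two forces invariance. -/
lemma IsHaarFrame.integral_sq_sub_eq_zero (h : IsHaarFrame μ) {δ B C' ε₀ : ℝ}
    {f : Fin n → Vec n → ℝ} (hf : Pinched δ B f) (hδ : 0 < δ) (hε₀ : 0 < ε₀)
    {i j : Fin n} (hij : i ≠ j)
    (hC' : ∀ ε : ℝ, 0 < ε → ε ≤ ε₀ →
      ∫ v, (f i (Real.cos ε • v i + Real.sin ε • v j) - f i (v i)) ^ 2 ∂μ ≤ C' * ε ^ 3)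
    {θ : ℝ} (hθ : 0 < θ) :
    ∫ v, (f i (Real.cos θ • v i + Real.sin θ • v j) - f i (v i)) ^ 2 ∂μ = 0 := by
  refine le_antisymm ?_ (integral_nonneg fun v => sq_nonneg _)
  have hev : ∀ᶠ M : ℕ in Filter.atTop,
      ∫ v, (f i (Real.cos θ • v i + Real.sin θ • v j) - f i (v i)) ^ 2 ∂μ ≤ C' * θ ^ 3 / M := by
    obtain ⟨M₀, hM₀⟩ := exists_nat_ge (θ / ε₀)
    filter_upwards [Filter.eventually_ge_atTop (max M₀ 1)] with M hM
    have hM1 : (1 : ℝ) ≤ M := by exact_mod_cast (le_max_right _ _).trans hM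
    have hM2 : (M₀ : ℝ) ≤ M := by exact_mod_cast (le_max_left _ _).trans hM
    have hM0 : (0 : ℝ) < M := by linarith
    have h1 : θ / M ≤ ε₀ := by
      rw [div_le_iff₀ hM0]
      have := (div_le_iff₀ hε₀).1 (hM₀.trans hM2)
      linarith
    have h2 := h.integral_sq_sub_mul_le hf hδ hij (θ / M) M
    rw [mul_div_cancel₀ _ hM0.ne'] at h2
    refine h2.trans ?_
    calc (M : ℝ) ^ 2 * _ ≤ (M : ℝ) ^ 2 * (C' * (θ / M) ^ 3) :=
          mul_le_mul_of_nonneg_left (hC' _ (by positivity) h1) (by positivity)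
      _ = C' * θ ^ 3 / M := by field_simp
  refine ge_of_tendsto (tendsto_const_div_atTop_nhds_zero_nat (C' * θ ^ 3)) hev

/-! ### From almost every frame to every point of the sphere. -/

lemma isCompact_setOf_orthonormal : IsCompact {v : Fin n → Vec n | Orthonormal ℝ v} := by
  refine Metric.isCompact_of_isClosed_isBounded ?_ ?_
  · simp only [orthonormal_iff_ite, Set.ofPred_forall]
    refine isClosed_iInter fun i => isClosed_iInter fun j => ?_
    exact isClosed_eq (by fun_prop) continuous_const
  · refine (Metric.isBounded_closedBall (x := (0 : Fin n → Vec n)) (r := 1)).subset fun v hv => ?_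
    rw [mem_closedBall_zero_iff, pi_norm_le_iff_of_nonneg zero_le_one]
    exact fun k => (hv.1 k).le

/-- The uniform distribution has full support. -/
lemma IsHaarFrame.eq_zero_of_ae (h : IsHaarFrame μ) {g : (Fin n → Vec n) → ℝ}
    (hg : ContinuousOn g {v | Orthonormal ℝ v}) (hae : ∀ᵐ v ∂μ, g v = 0)
    {v : Fin n → Vec n} (hv : Orthonormal ℝ v) : g v = 0 := by
  have := h.isProbabilityMeasure
  by_contra hne
  have hnhds : {w | g w ≠ 0} ∈ nhdsWithin v {v | Orthonormal ℝ v} :=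
    (hg v hv).eventually_ne hne
  -- A null neighbourhood of one frame is carried by isometries to a null neighbourhood of every
  -- frame, and compactness makes the whole set of frames null.
  have hzero : μ {v | Orthonormal ℝ v} = 0 := by
    refine isCompact_setOf_orthonormal.measure_zero_of_nhdsWithin fun w hw => ?_
    obtain ⟨b, rfl⟩ := exists_orthonormalBasis_coe_eq hv
    obtain ⟨b', rfl⟩ := exists_orthonormalBasis_coe_eq hw
    set U := b'.equiv b (Equiv.refl _) with hU
    have hUb : (fun k => U (b' k)) = b := by
      funext k; simp [hU]
    have hcont : Continuous fun (v : Fin n → Vec n) k => U (v k) :=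
      continuous_pi fun k => U.continuous.comp (continuous_apply k)
    refine ⟨{w | g (fun k => U (w k)) ≠ 0}, ?_, ?_⟩
    · have ht : Filter.Tendsto (fun (v : Fin n → Vec n) k => U (v k))
          (nhdsWithin b' {v | Orthonormal ℝ v}) (nhdsWithin b {v | Orthonormal ℝ v}) := by
        refine tendsto_nhdsWithin_of_tendsto_nhds_of_eventually_within _ ?_ ?_
        · rw [← hUb]
          exact (hcont.tendsto _).mono_left nhdsWithin_le_nhds
        · filter_upwards [self_mem_nhdsWithin] with w hw
          exact hw.comp_linearIsometryEquiv U
      exact ht hnhds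
    · have h1 : ∀ᵐ v ∂(μ.map fun (v : Fin n → Vec n) k => U (v k)), g v = 0 := by
        rwa [h.map_left U]
      exact ae_of_ae_map hcont.measurable.aemeasurable h1
  have h2 := h.orthonormal
  have h3 : μ Set.univ ≤ μ {v | Orthonormal ℝ v} + μ {v | Orthonormal ℝ v}ᶜ := by
    rw [← Set.union_compl_self {v : Fin n → Vec n | Orthonormal ℝ v}]
    exact measure_union_le _ _
  rw [hzero, measure_univ, show μ {v | Orthonormal ℝ v}ᶜ = 0 from h2] at h3
  simp at h3

lemma exists_orthonormal_rotation {i j : Fin n} (hij : i ≠ j) {x z : Vec n} (hx : ‖x‖ = 1)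
    (hz : ‖z‖ = 1) : ∃ (v : Fin n → Vec n) (θ : ℝ), Orthonormal ℝ v ∧ 0 ≤ θ ∧ v i = x ∧
      Real.cos θ • v i + Real.sin θ • v j = z := by
  set t : ℝ := inner ℝ x z with ht
  have ht1 : |t| ≤ 1 := by simpa [hx, hz] using abs_real_inner_le_norm x z
  have htt := abs_le.1 ht1
  set w := z - t • x with hw
  have hxw : inner ℝ x w = (0 : ℝ) := by
    rw [hw, inner_sub_right, real_inner_smul_right, real_inner_self_eq_norm_sq, hx]; simp [ht]
  have hwn : ‖w‖ ^ 2 = 1 - t ^ 2 := by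
    rw [hw, @norm_sub_sq_real, hz, norm_smul, hx, real_inner_smul_right, real_inner_comm, ← ht]
    simp only [Real.norm_eq_abs, mul_one, sq_abs]
    ring
  have hwsin : Real.sin (Real.arccos t) = ‖w‖ := by
    rw [Real.sin_arccos, ← hwn, Real.sqrt_sq (norm_nonneg _)]
  -- Here `z = ± x` and the sine vanishes, so the second vector of the rotation plane is arbitrary.
  by_cases hw0 : w = 0
  · obtain ⟨b, hb⟩ := Orthonormal.exists_orthonormalBasis_extension_of_card_eq
      (ι := Fin n) (E := Vec n) (𝕜 := ℝ) (by simp) (v := fun _ => x) (s := {i})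
      ⟨fun _ => hx, fun a c hac => absurd (Subsingleton.elim a c) hac⟩
    refine ⟨b, Real.arccos t, b.orthonormal, Real.arccos_nonneg t, hb i rfl, ?_⟩
    rw [hwsin, hw0, norm_zero, zero_smul, add_zero, hb i rfl, Real.cos_arccos htt.1 htt.2]
    exact (sub_eq_zero.1 hw0).symm
  · have hwn0 : ‖w‖ ≠ 0 := norm_ne_zero_iff.2 hw0
    set y := ‖w‖⁻¹ • w with hy
    have hy1 : ‖y‖ = 1 := by rw [hy, norm_smul, norm_inv, norm_norm, inv_mul_cancel₀ hwn0]
    have hxy : inner ℝ x y = (0 : ℝ) := by rw [hy, real_inner_smul_right, hxw, mul_zero]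
    set p : Fin n → Vec n := fun k => if k = i then x else y with hp
    have hpi : p i = x := by simp [hp]
    have hpj : p j = y := by simp [hp, hij.symm]
    obtain ⟨b, hb⟩ := Orthonormal.exists_orthonormalBasis_extension_of_card_eq
      (ι := Fin n) (E := Vec n) (𝕜 := ℝ) (by simp) (v := p) (s := {i, j}) (by
        refine ⟨?_, ?_⟩
        · rintro ⟨k, rfl | rfl⟩
          · simpa [hpi] using hx
          · simpa [hpj] using hy1
        · rintro ⟨k, rfl | rfl⟩ ⟨l, rfl | rfl⟩ hkl
          · exact absurd rfl hkl
          · simpa [hpi, hpj] using hxy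
          · rw [real_inner_comm]; simpa [hpi, hpj] using hxy
          · exact absurd rfl hkl)
    have hbi : b i = x := (hb i (by simp)).trans hpi
    have hbj : b j = y := (hb j (by simp)).trans hpj
    refine ⟨b, Real.arccos t, b.orthonormal, Real.arccos_nonneg t, hbi, ?_⟩
    rw [hwsin, hbi, hbj, Real.cos_arccos htt.1 htt.2, hy, smul_smul, mul_inv_cancel₀ hwn0, one_smul,
      hw]
    abel

/-- The components of a maximizer are constant on the sphere. -/
lemma IsHaarFrame.eq_of_isMax (h : IsHaarFrame μ) {δ B C ε₀ : ℝ} (hδ : 0 < δ) (hε₀ : 0 < ε₀)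
    (hC : 0 ≤ C) {f : Fin n → Vec n → ℝ} (hf : Pinched δ B f)
    (hcont : ∀ k, ContinuousOn (f k) (Metric.sphere 0 1))
    (hcomp : ∀ k, IsComparable C ε₀ (f k))
    (hmax : ∀ U : Vec n ≃ₗᵢ[ℝ] Vec n, ∀ s : ℝ, 0 < s → s ≤ 1 →
      ∫ v, weight (fun k x => (1 - s) * f k x + s * f k (U x)) v ∂μ ≤ ∫ v, weight f v ∂μ)
    {i j : Fin n} (hij : i ≠ j) {x z : Vec n} (hx : ‖x‖ = 1) (hz : ‖z‖ = 1) :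
    f i z = f i x := by
  have := h.isProbabilityMeasure
  obtain ⟨C', hC'⟩ := h.integral_sq_sub_le_of_isMax hδ hC hf hcomp hmax hij
  obtain ⟨v, θ, hv, hθ, rfl, rfl⟩ := exists_orthonormal_rotation hij hx hz
  rcases hθ.eq_or_lt with rfl | hθ
  · simp
  have hzero := h.integral_sq_sub_eq_zero hf hδ hε₀ hij hC' hθ
  have hB0 : 0 < B := hδ.trans_le ((hf.le i 0).trans (hf.ge i 0))
  have hint : Integrable (fun v : Fin n → Vec n =>
      (f i (Real.cos θ • v i + Real.sin θ • v j) - f i (v i)) ^ 2) μ :=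
    integrable_of_measurable_of_bounded ((((hf.measurable i).comp (by fun_prop)).sub
      (hf.measurable_eval i)).pow_const 2) (B ^ 2) fun v => by
        rw [abs_pow]
        refine pow_le_pow_left₀ (abs_nonneg _) (abs_le.2 ⟨?_, ?_⟩) 2
        · linarith [hf.le i (Real.cos θ • v i + Real.sin θ • v j), hf.ge i (v i)]
        · linarith [hf.ge i (Real.cos θ • v i + Real.sin θ • v j), hf.le i (v i)]
  have hae := (integral_eq_zero_iff_of_nonneg (fun v => sq_nonneg _) hint).1 hzero
  have hmaps : Set.MapsTo (fun v : Fin n → Vec n => Real.cos θ • v i + Real.sin θ • v j)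
      {v | Orthonormal ℝ v} (Metric.sphere 0 1) := fun v hv => by
    rw [mem_sphere_zero_iff_norm]
    change ‖Real.cos θ • v i + Real.sin θ • v j‖ = 1
    rw [← pairRot_left hij]
    exact (orthonormal_pairRot hv hij θ).1 i
  have hmaps2 : Set.MapsTo (fun v : Fin n → Vec n => v i)
      {v | Orthonormal ℝ v} (Metric.sphere 0 1) := fun v hv => by
    rw [mem_sphere_zero_iff_norm]; exact hv.1 i
  have hc : ContinuousOn (fun v : Fin n → Vec n =>
      (f i (Real.cos θ • v i + Real.sin θ • v j) - f i (v i)) ^ 2) {v | Orthonormal ℝ v} :=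
    (((hcont i).comp (by fun_prop) hmaps).sub ((hcont i).comp (by fun_prop) hmaps2)).pow 2
  have := h.eq_zero_of_ae hc hae hv
  exact sub_eq_zero.1 (pow_eq_zero_iff (two_ne_zero) |>.1 this)

end OMCRidge
end

noncomputable section

namespace OMCRidge

variable {n : ℕ} [NeZero n] {μ : Measure (Fin n → Vec n)}

/-! ### The Brascamp-Lieb inequality for orthonormal frames -/

/-- The unit sphere of `ℝⁿ`. -/
abbrev Sph (n : ℕ) : Type := Metric.sphere (0 : Vec n) 1

/-- The identity on the sphere, extended to `ℝⁿ` by a constant. -/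
def sphereProj (x : Vec n) : Sph n :=
  if h : ‖x‖ = 1 then ⟨x, mem_sphere_zero_iff_norm.2 h⟩
  else ⟨EuclideanSpace.single 0 1, by simp⟩

lemma sphereProj_of_norm {x : Vec n} (h : ‖x‖ = 1) :
    sphereProj x = ⟨x, mem_sphere_zero_iff_norm.2 h⟩ := dif_pos h

lemma measurable_sphereProj : Measurable (sphereProj : Vec n → Sph n) := by
  have hs : MeasurableSet {x : Vec n | ‖x‖ = 1} := measurable_norm (measurableSet_singleton 1)
  unfold sphereProj
  exact Measurable.dite (s := {x : Vec n | ‖x‖ = 1})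
    (f := fun x => (⟨x.1, mem_sphere_zero_iff_norm.2 x.2⟩ : Sph n))
    (g := fun _ => (⟨EuclideanSpace.single 0 1, by simp⟩ : Sph n))
    (measurable_subtype_coe.subtype_mk) measurable_const hs

/-- A function on the sphere, extended to `ℝⁿ`. -/
def hat (f : C(Sph n, ℝ)) (x : Vec n) : ℝ := f (sphereProj x)

lemma hat_of_norm (f : C(Sph n, ℝ)) {x : Vec n} (h : ‖x‖ = 1) :
    hat f x = f ⟨x, mem_sphere_zero_iff_norm.2 h⟩ := by rw [hat, sphereProj_of_norm h]

lemma measurable_hat (f : C(Sph n, ℝ)) : Measurable (hat f) :=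
  f.continuous.measurable.comp measurable_sphereProj

lemma continuousOn_hat (f : C(Sph n, ℝ)) : ContinuousOn (hat f) (Metric.sphere 0 1) := by
  rw [continuousOn_iff_continuous_domRestrict]
  convert f.continuous using 1
  funext x
  exact hat_of_norm f (mem_sphere_zero_iff_norm.1 x.2)

lemma continuous_hat_apply (x : Vec n) : Continuous fun f : C(Sph n, ℝ) => hat f x :=
  continuous_eval_const (sphereProj x)

lemma integrable_hat [IsFiniteMeasure μ] (f : C(Sph n, ℝ)) (k : Fin n) :
    Integrable (fun v : Fin n → Vec n => hat f (v k)) μ :=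
  integrable_of_measurable_of_bounded ((measurable_hat f).comp (measurable_pi_apply k)) ‖f‖
    fun _ => f.norm_coe_le_norm _

/-- A linear isometry as a map of the sphere. -/
def sphereMap (U : Vec n ≃ₗᵢ[ℝ] Vec n) : C(Sph n, Sph n) where
  toFun x := ⟨U x, mem_sphere_zero_iff_norm.2
    ((U.norm_map x).trans (mem_sphere_zero_iff_norm.1 x.2))⟩
  continuous_toFun := (U.continuous.comp continuous_subtype_val).subtype_mk _

lemma hat_comp_sphereMap (f : C(Sph n, ℝ)) (U : Vec n ≃ₗᵢ[ℝ] Vec n) {x : Vec n} (h : ‖x‖ = 1) :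
    hat (f.comp (sphereMap U)) x = hat f (U x) := by
  rw [hat_of_norm _ h, hat_of_norm _ ((U.norm_map x).trans h)]
  rfl

/-- Functions on the sphere with uniform bounds, a uniform modulus of continuity, uniformly
comparable second differences, and mean `1` at the `k`-th vector of the frame. -/
def frameClass (μ : Measure (Fin n → Vec n)) (δ B C ε₀ : ℝ) (d : ℝ → ℝ) (k : Fin n) :
    Set C(Sph n, ℝ) :=
  {f | (∀ x, f x ∈ Set.Icc δ B) ∧ (∀ η, 0 < η → ∀ x y, dist x y < d η → |f x - f y| ≤ η)} ∩
    ({f | IsComparable C ε₀ (hat f)} ∩ {f | ∫ v, hat f (v k) ∂μ = 1})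

/-! ### Compactness of the class and existence of a maximizer. -/

lemma continuous_integral_hat [IsProbabilityMeasure μ] (k : Fin n) :
    Continuous fun f : C(Sph n, ℝ) => ∫ v, hat f (v k) ∂μ := by
  refine (LipschitzWith.of_dist_le_mul (K := 1) fun f g => ?_).continuous
  rw [Real.dist_eq, ← integral_sub (integrable_hat f k) (integrable_hat g k), NNReal.coe_one,
    one_mul]
  have h := norm_integral_le_of_norm_le_const (μ := μ) (C := dist f g)
    (f := fun v => hat f (v k) - hat g (v k)) (Filter.Eventually.of_forall fun v => by
      rw [← dist_eq_norm]; exact ContinuousMap.dist_apply_le_dist _)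
  simpa using h

/-- For fixed bases and `ε` the condition involves finitely many point evaluations. Closedness
relies on `C` and `ε₀` being fixed for the whole class. -/
lemma isClosed_setOf_isComparable (C ε₀ : ℝ) :
    IsClosed {f : C(Sph n, ℝ) | IsComparable C ε₀ (hat f)} := by
  simp only [IsComparable, Set.ofPred_forall]
  refine isClosed_iInter fun e => isClosed_iInter fun u => isClosed_iInter fun i =>
    isClosed_iInter fun ε => isClosed_iInter fun _ => isClosed_iInter fun _ => ?_
  refine isClosed_le (Continuous.abs (Continuous.sub ?_ ?_)) continuous_const
  · exact continuous_finsetSum _ fun j _ =>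
      ((continuous_hat_apply _).sub (continuous_hat_apply _)).add
        ((continuous_hat_apply _).sub (continuous_hat_apply _))
  · exact continuous_finsetSum _ fun a _ => continuous_finsetSum _ fun b _ =>
      (continuous_hat_apply _).sub (continuous_hat_apply _)

/-- Arzelà-Ascoli; the class carries an explicit modulus of continuity `d` so that equicontinuity is
a closed condition. -/
lemma isCompact_frameClass [IsProbabilityMeasure μ] (δ B C ε₀ : ℝ) {d : ℝ → ℝ}
    (hd : ∀ η, 0 < η → 0 < d η) (k : Fin n) :
    IsCompact (frameClass μ δ B C ε₀ d k) := by
  refine IsCompact.inter_right ?_ ((isClosed_setOf_isComparable C ε₀).inter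
    (isClosed_eq (continuous_integral_hat k) continuous_const))
  refine ArzelaAscoli.isCompact_of_equicontinuous _ ?_ ?_
  · have himg : ContinuousMap.toFun '' {f : C(Sph n, ℝ) | (∀ x, f x ∈ Set.Icc δ B) ∧
        (∀ η, 0 < η → ∀ x y, dist x y < d η → |f x - f y| ≤ η)} =
        (Set.univ.pi fun _ => Set.Icc δ B) ∩
          {g : Sph n → ℝ | ∀ η, 0 < η → ∀ x y, dist x y < d η → |g x - g y| ≤ η} := by
      ext g
      constructor
      · rintro ⟨f, ⟨h1, h2⟩, rfl⟩
        exact ⟨fun x _ => h1 x, h2⟩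
      · rintro ⟨h1, h2⟩
        have hg : Continuous g := Metric.continuous_iff.2 fun x η hη =>
          ⟨d (η / 2), hd _ (by positivity), fun y hy => by
            rw [Real.dist_eq]
            linarith [h2 (η / 2) (by positivity) y x hy]⟩
        exact ⟨⟨g, hg⟩, ⟨fun x => h1 x trivial, h2⟩, rfl⟩
    rw [himg]
    refine (isCompact_univ_pi fun _ => isCompact_Icc).inter_right ?_
    simp only [Set.ofPred_forall]
    exact isClosed_iInter fun η => isClosed_iInter fun _ => isClosed_iInter fun x =>
      isClosed_iInter fun y => isClosed_iInter fun _ =>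
        isClosed_le ((continuous_apply x).sub (continuous_apply y)).abs continuous_const
  · intro x
    rw [Metric.equicontinuousAt_iff]
    intro η hη
    refine ⟨d (η / 2), hd _ (by positivity), fun y hy f => ?_⟩
    rw [Real.dist_eq]
    have := f.2.2 (η / 2) (by positivity) x y (by rwa [dist_comm])
    exact this.trans_lt (by linarith)

lemma pinched_hat {δ B C ε₀ : ℝ} {d : ℝ → ℝ} {f : Fin n → C(Sph n, ℝ)}
    (hf : ∀ k, f k ∈ frameClass μ δ B C ε₀ d k) : Pinched δ B fun k => hat (f k) :=
  ⟨fun _ => measurable_hat _, fun k _ => ((hf k).1.1 _).1, fun k _ => ((hf k).1.1 _).2⟩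

/-- Each defining condition is convex and invariant under rotations, the mean by left invariance.
Thus the variations needed at a maximizer never leave the class. -/
lemma IsHaarFrame.convexComb_mem_frameClass (h : IsHaarFrame μ) {δ B C ε₀ : ℝ} {d : ℝ → ℝ}
    {k : Fin n} {f : C(Sph n, ℝ)} (hf : f ∈ frameClass μ δ B C ε₀ d k)
    (U : Vec n ≃ₗᵢ[ℝ] Vec n) {s : ℝ} (h0 : 0 ≤ s) (h1 : s ≤ 1) :
    (1 - s) • f + s • f.comp (sphereMap U) ∈ frameClass μ δ B C ε₀ d k := by
  have := h.isProbabilityMeasure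
  have hU : ∀ x y : Sph n, dist (sphereMap U x) (sphereMap U y) = dist x y := fun x y =>
    U.dist_map x y
  obtain ⟨⟨hb, hmod⟩, hcomp, hmean⟩ := hf
  have e1 : ∀ x, hat ((1 - s) • f + s • f.comp (sphereMap U)) x =
      (1 - s) * hat f x + s * hat (f.comp (sphereMap U)) x := fun x => rfl
  refine ⟨⟨fun x => ?_, fun η hη x y hxy => ?_⟩, ?_, ?_⟩
  · exact convex_Icc δ B (hb x) (hb (sphereMap U x)) (by linarith) h0 (by ring)
  · have a1 := hmod η hη x y hxy
    have a2 := hmod η hη (sphereMap U x) (sphereMap U y) (by rwa [hU])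
    calc _ = |(1 - s) * (f x - f y) + s * (f (sphereMap U x) - f (sphereMap U y))| := by
          congr 1
          simp only [ContinuousMap.add_apply, ContinuousMap.smul_apply, ContinuousMap.comp_apply,
            smul_eq_mul]
          ring
      _ ≤ (1 - s) * |f x - f y| + s * |f (sphereMap U x) - f (sphereMap U y)| := by
          refine (abs_add_le _ _).trans (le_of_eq ?_)
          rw [abs_mul, abs_mul, abs_of_nonneg h0, abs_of_nonneg (by linarith : 0 ≤ 1 - s)]
      _ ≤ η := by nlinarith
  · have hc := hcomp.linear (hcomp.comp_isometry U) (1 - s) s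
    rw [abs_of_nonneg h0, abs_of_nonneg (by linarith : 0 ≤ 1 - s)] at hc
    refine (hc.mono (C' := C) (by linarith) le_rfl).congr fun x hx => ?_
    rw [e1, hat_comp_sphereMap f U hx]
  · simp only [Set.mem_ofPred_eq, e1]
    rw [integral_add ((integrable_hat f k).const_mul _) ((integrable_hat _ k).const_mul _),
      integral_const_mul, integral_const_mul, hmean]
    have e2 : ∫ v, hat (f.comp (sphereMap U)) (v k) ∂μ = 1 := by
      refine Eq.trans ?_ hmean
      refine Eq.trans ?_ (h.integral_left U ((measurable_hat f).comp (measurable_pi_apply k)))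
      refine integral_congr_ae ?_
      filter_upwards [h.orthonormal] with v hv
      exact hat_comp_sphereMap f U (hv.1 k)
    rw [e2]
    ring

/-- For `n = 1` there is no second vector to rotate with; the pointwise inequality `u ≤ 3/4 + u⁴/4`
suffices. -/
lemma integral_weight_le_one_of_eq_one [IsProbabilityMeasure μ] (hn : n = 1) {δ B C ε₀ : ℝ}
    (hδ : 0 < δ) {d : ℝ → ℝ} {f : Fin n → C(Sph n, ℝ)}
    (hf : ∀ k, f k ∈ frameClass μ δ B C ε₀ d k) :
    ∫ v, weight (fun k => hat (f k)) v ∂μ ≤ 1 := by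
  have hP := pinched_hat hf
  subst hn
  have hpt : ∀ v, weight (fun k => hat (f k)) v ≤ 3 / 4 + 1 / 4 * hat (f 0) (v 0) := by
    intro v
    have hp : 0 < hat (f 0) (v 0) := hδ.trans_le (hP.le 0 _)
    have hw : weight (fun k => hat (f k)) v =
        Real.exp (1 / 4 * Real.log (hat (f 0) (v 0))) := by
      simp only [weight, Finset.univ_unique, Fin.default_eq_zero, Finset.sum_singleton]
    rw [hw]
    set u := Real.exp (1 / 4 * Real.log (hat (f 0) (v 0))) with hu
    have hu4 : u ^ 4 = hat (f 0) (v 0) := by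
      rw [hu, ← Real.exp_nat_mul, Nat.cast_ofNat, ← mul_assoc]
      norm_num
      exact Real.exp_log hp
    rw [← hu4]
    nlinarith [sq_nonneg (u - 1), sq_nonneg (u ^ 2 - 1)]
  have hi := integrable_hat (μ := μ) (f 0) 0
  have hmean : ∫ v, hat (f 0) (v 0) ∂μ = 1 := (hf 0).2.2
  calc _ ≤ ∫ v, 3 / 4 + 1 / 4 * hat (f 0) (v 0) ∂μ :=
        integral_mono (hP.integrable_weight hδ) ((integrable_const _).add (hi.const_mul _)) hpt
    _ = 1 := by
        rw [integral_add (integrable_const _) (hi.const_mul _), integral_const_mul, hmean]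
        simp only [integral_const, probReal_univ, one_smul]
        norm_num

lemma continuousOn_integral_weight [IsProbabilityMeasure μ] {δ B C ε₀ : ℝ} (hδ : 0 < δ)
    {d : ℝ → ℝ} : ContinuousOn (fun f : Fin n → C(Sph n, ℝ) =>
      ∫ v, weight (fun k => hat (f k)) v ∂μ) (Set.univ.pi fun k => frameClass μ δ B C ε₀ d k) := by
  refine MeasureTheory.continuousOn_of_dominated
    (bound := fun _ => Real.exp (1 / 4 * (n * Real.log B))) ?_ ?_ (integrable_const _) ?_
  · intro g hg
    exact (pinched_hat fun k => hg k trivial).measurable_weight.aestronglyMeasurable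
  · intro g hg
    refine Filter.Eventually.of_forall fun v => ?_
    rw [Real.norm_eq_abs, abs_of_pos (weight_pos _ _)]
    exact (pinched_hat fun k => hg k trivial).weight_le hδ v
  · refine Filter.Eventually.of_forall fun v => ?_
    unfold weight
    refine Real.continuous_exp.comp_continuousOn (continuousOn_const.mul
      (continuousOn_finsetSum _ fun k _ => ContinuousOn.log ?_ fun g hg => ?_))
    · exact ((continuous_hat_apply _).comp (continuous_apply k)).continuousOn
    · exact (hδ.trans_le ((pinched_hat fun k => hg k trivial).le k (v k))).ne'

/-- The components of a maximizer are constant on the sphere, and having mean one they equal one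
there. -/
lemma IsHaarFrame.integral_weight_le_one (h : IsHaarFrame μ) {δ B C ε₀ : ℝ} (hδ : 0 < δ)
    (hC : 0 ≤ C) (hε₀ : 0 < ε₀) {d : ℝ → ℝ} (hd : ∀ η, 0 < η → 0 < d η)
    {f : Fin n → C(Sph n, ℝ)} (hf : ∀ k, f k ∈ frameClass μ δ B C ε₀ d k) :
    ∫ v, weight (fun k => hat (f k)) v ∂μ ≤ 1 := by
  have := h.isProbabilityMeasure
  by_cases hn : n = 1
  · exact integral_weight_le_one_of_eq_one hn hδ hf
  have hKc : IsCompact (Set.univ.pi fun k => frameClass μ δ B C ε₀ d k) :=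
    isCompact_univ_pi fun k => isCompact_frameClass δ B C ε₀ hd k
  obtain ⟨g, hg, hmax⟩ := hKc.exists_isMaxOn ⟨f, fun k _ => hf k⟩
    (continuousOn_integral_weight hδ)
  have hg' : ∀ k, g k ∈ frameClass μ δ B C ε₀ d k := fun k => hg k trivial
  refine (hmax (fun k _ => hf k : f ∈ Set.univ.pi fun k => frameClass μ δ B C ε₀ d k)).trans ?_
  have hP := pinched_hat hg'
  have hvar : ∀ U : Vec n ≃ₗᵢ[ℝ] Vec n, ∀ s : ℝ, 0 < s → s ≤ 1 →
      ∫ v, weight (fun k x => (1 - s) * hat (g k) x + s * hat (g k) (U x)) v ∂μ ≤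
        ∫ v, weight (fun k => hat (g k)) v ∂μ := by
    intro U s hs0 hs1
    have hmem : (fun k => (1 - s) • g k + s • (g k).comp (sphereMap U)) ∈
        Set.univ.pi fun k => frameClass μ δ B C ε₀ d k := fun k _ =>
      h.convexComb_mem_frameClass (hg' k) U hs0.le hs1
    refine le_trans (le_of_eq (integral_congr_ae ?_)) (hmax hmem)
    filter_upwards [h.orthonormal] with v hv
    unfold weight
    congr 2
    refine Finset.sum_congr rfl fun k _ => ?_
    change Real.log ((1 - s) * hat (g k) (v k) + s * hat (g k) (U (v k))) = _
    rw [← hat_comp_sphereMap (g k) U (hv.1 k)]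
    rfl
  have hone : ∀ k x, ‖x‖ = 1 → hat (g k) x = 1 := by
    intro k x hx
    have hnt : Nontrivial (Fin n) := Fin.nontrivial_iff_two_le.2 (by
      have := NeZero.pos n; omega)
    obtain ⟨j, hj⟩ := exists_ne k
    have hconst : ∀ z, ‖z‖ = 1 → hat (g k) z = hat (g k) x := fun z hz =>
      h.eq_of_isMax hδ hε₀ hC hP (fun k => continuousOn_hat _) (fun k => (hg' k).2.1) hvar
        hj.symm hx hz
    have hm := (hg' k).2.2
    simp only [Set.mem_ofPred_eq] at hm
    rw [← hm]
    have : ∫ v, hat (g k) (v k) ∂μ = ∫ _v, hat (g k) x ∂μ := by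
      refine integral_congr_ae ?_
      filter_upwards [h.orthonormal] with v hv
      exact hconst _ (hv.1 k)
    rw [this]
    simp
  change ∫ v, weight (fun k => hat (g k)) v ∂μ ≤ 1
  refine le_of_eq ?_
  have : ∫ v, weight (fun k => hat (g k)) v ∂μ = ∫ _v, (1 : ℝ) ∂μ := by
    refine integral_congr_ae ?_
    filter_upwards [h.orthonormal] with v hv
    simp [weight, hone _ _ (hv.1 _)]
  rw [this]
  simp

lemma IsHaarFrame.brascampLieb_of_isComparable (h : IsHaarFrame μ) {f : Fin n → C(Sph n, ℝ)}
    (hpos : ∀ k x, 0 < f k x)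
    (hcomp : ∀ k, ∃ C ε₀ : ℝ, 0 < C ∧ 0 < ε₀ ∧ IsComparable C ε₀ (hat (f k))) :
    ∫ v, weight (fun k => hat (f k)) v ∂μ ≤
      Real.exp (1 / 4 * ∑ k, Real.log (∫ v, hat (f k) (v k) ∂μ)) := by
  have := h.isProbabilityMeasure
  have hlow : ∀ g : C(Sph n, ℝ), (∀ x, 0 < g x) → ∃ δ : ℝ, 0 < δ ∧ ∀ x, δ ≤ g x := by
    intro g hg
    obtain ⟨x₀, -, hx₀⟩ := isCompact_univ.exists_isMinOn
      ⟨sphereProj 0, Set.mem_univ _⟩ g.continuous.continuousOn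
    exact ⟨g x₀, hg x₀, fun x => hx₀ (Set.mem_univ x)⟩
  set m : Fin n → ℝ := fun k => ∫ v, hat (f k) (v k) ∂μ with hm
  have hmpos : ∀ k, 0 < m k := by
    intro k
    obtain ⟨δ, hδ, hle⟩ := hlow (f k) (hpos k)
    calc 0 < δ := hδ
      _ = ∫ _v, δ ∂μ := by simp
      _ ≤ m k := integral_mono (integrable_const _) (integrable_hat _ k) fun v => hle _
  set g : Fin n → C(Sph n, ℝ) := fun k => (m k)⁻¹ • f k with hg
  have hghat : ∀ k x, hat (g k) x = (m k)⁻¹ * hat (f k) x := fun k x => rfl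
  have hgpos : ∀ k x, 0 < g k x := fun k x => mul_pos (inv_pos.2 (hmpos k)) (hpos k x)
  have hδ : ∃ δ : ℝ, 0 < δ ∧ ∀ k x, δ ≤ g k x := by
    have : ∀ᶠ δ in nhdsWithin (0 : ℝ) (Set.Ioi 0), ∀ k, ∀ x, δ ≤ g k x :=
      Filter.eventually_all.2 fun k => by
        obtain ⟨δ, hδ, hle⟩ := hlow (g k) (hgpos k)
        filter_upwards [Ioo_mem_nhdsGT hδ] with t ht x using ht.2.le.trans (hle x)
    obtain ⟨δ, h1, h2⟩ := (this.and self_mem_nhdsWithin).exists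
    exact ⟨δ, h2, h1⟩
  obtain ⟨δ, hδ, hδle⟩ := hδ
  have hB : ∃ B : ℝ, ∀ k x, g k x ≤ B := by
    have : ∀ᶠ B in Filter.atTop, ∀ k, ∀ x, g k x ≤ B :=
      Filter.eventually_all.2 fun k => by
        filter_upwards [Filter.eventually_ge_atTop ‖g k‖] with t ht x
        exact ((le_abs_self _).trans ((g k).norm_coe_le_norm x)).trans ht
    exact this.exists
  obtain ⟨B, hB⟩ := hB
  have hCe : ∃ C ε₀ : ℝ, 0 ≤ C ∧ 0 < ε₀ ∧ ∀ k, IsComparable C ε₀ (hat (g k)) := by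
    choose C ε₀ hC hε₀ hc using hcomp
    have h1 : ∀ᶠ ε in nhdsWithin (0 : ℝ) (Set.Ioi 0), ∀ k, ε ≤ ε₀ k :=
      Filter.eventually_all.2 fun k => by
        filter_upwards [Ioo_mem_nhdsGT (hε₀ k)] with t ht using ht.2.le
    obtain ⟨ε, h2, h3⟩ := (h1.and self_mem_nhdsWithin).exists
    have h4 : ∀ᶠ D in Filter.atTop, ∀ k, |(m k)⁻¹| * C k + |(0 : ℝ)| * C k ≤ D :=
      Filter.eventually_all.2 fun k => Filter.eventually_ge_atTop _
    obtain ⟨D, h5, h6⟩ := (h4.and (Filter.eventually_ge_atTop 0)).exists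
    refine ⟨D, ε, h6, h3, fun k => ?_⟩
    have h7 := ((hc k).linear (hc k) (m k)⁻¹ 0).mono (h5 k) (h2 k)
    simpa only [zero_mul, add_zero, ← hghat] using h7
  obtain ⟨C, ε₀, hC, hε₀, hcomp'⟩ := hCe
  have hmod : ∀ η : ℝ, ∃ r : ℝ, 0 < η → 0 < r ∧
      ∀ k x y, dist x y < r → |g k x - g k y| ≤ η := by
    intro η
    by_cases hη : 0 < η
    · have h1 : ∀ᶠ r in nhdsWithin (0 : ℝ) (Set.Ioi 0), ∀ k, ∀ x y, dist x y < r →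
          |g k x - g k y| ≤ η :=
        Filter.eventually_all.2 fun k => by
          obtain ⟨r, hr, hr'⟩ := Metric.uniformContinuous_iff.1
            (CompactSpace.uniformContinuous_of_continuous (g k).continuous) η hη
          filter_upwards [Ioo_mem_nhdsGT hr] with t ht x y hxy
          exact (hr' (hxy.trans ht.2)).le
      obtain ⟨r, h2, h3⟩ := (h1.and self_mem_nhdsWithin).exists
      exact ⟨r, fun _ => ⟨h3, h2⟩⟩
    · exact ⟨0, fun h => absurd h hη⟩
  choose d hd using hmod
  have hmem : ∀ k, g k ∈ frameClass μ δ B C ε₀ d k := fun k =>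
    ⟨⟨fun x => ⟨hδle k x, hB k x⟩, fun η hη x y hxy => (hd η hη).2 k x y hxy⟩, hcomp' k, by
      simp only [Set.mem_ofPred_eq, hghat, integral_const_mul]
      exact inv_mul_cancel₀ (hmpos k).ne'⟩
  have key := h.integral_weight_le_one hδ hC hε₀ (fun η hη => (hd η hη).1) hmem
  have hw : ∀ v, weight (fun k => hat (g k)) v =
      Real.exp (-(1 / 4 * ∑ k, Real.log (m k))) * weight (fun k => hat (f k)) v := by
    intro v
    unfold weight
    rw [← Real.exp_add]
    congr 1
    have : ∀ k, Real.log (hat (g k) (v k)) = Real.log (hat (f k) (v k)) - Real.log (m k) := by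
      intro k
      rw [hghat, Real.log_mul (inv_pos.2 (hmpos k)).ne' (show hat (f k) (v k) ≠ 0 from (hpos k _).ne'),
        Real.log_inv]
      ring
    simp only [this, Finset.sum_sub_distrib]
    ring
  simp only [hw] at key
  rw [integral_const_mul, Real.exp_neg, inv_mul_le_iff₀ (Real.exp_pos _), mul_one] at key
  exact key

/-- The function `x ↦ exp ⟨x, y⟩` on the sphere. -/
def sphereExp (y : Vec n) : C(Sph n, ℝ) where
  toFun x := Real.exp (inner ℝ (x : Vec n) y)
  continuous_toFun := by fun_prop

omit [NeZero n] in
lemma sphereExp_mem_of_mem_closure {g : C(Sph n, ℝ)}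
    (hg : g ∈ Submonoid.closure (Set.range (sphereExp : Vec n → C(Sph n, ℝ)))) :
    ∃ y, g = sphereExp y := by
  induction hg using Submonoid.closure_induction with
  | mem x hx => obtain ⟨y, rfl⟩ := hx; exact ⟨y, rfl⟩
  | one => exact ⟨0, by ext x; simp [sphereExp]⟩
  | mul x y _ _ hx hy =>
    obtain ⟨a, rfl⟩ := hx
    obtain ⟨b, rfl⟩ := hy
    exact ⟨a + b, by ext x; simp [sphereExp, inner_add_right, Real.exp_add]⟩

/-- Products of the exponentials are again such exponentials, so the algebra they generate is their
linear span, and comparability is stable under linear combinations. -/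
lemma exists_isComparable_of_mem_adjoin {g : C(Sph n, ℝ)}
    (hg : g ∈ Algebra.adjoin ℝ (Set.range (sphereExp : Vec n → C(Sph n, ℝ)))) :
    ∃ C ε₀ : ℝ, 0 < C ∧ 0 < ε₀ ∧ IsComparable C ε₀ (hat g) := by
  have hcongr : ∀ (a b : C(Sph n, ℝ)) (r s : ℝ),
      (∃ C ε₀ : ℝ, 0 < C ∧ 0 < ε₀ ∧ IsComparable C ε₀ (hat a)) →
      (∃ C ε₀ : ℝ, 0 < C ∧ 0 < ε₀ ∧ IsComparable C ε₀ (hat b)) →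
      ∃ C ε₀ : ℝ, 0 < C ∧ 0 < ε₀ ∧ IsComparable C ε₀ (hat (r • a + s • b)) := by
    rintro a b r s ⟨C, ε₀, hC, hε, ha⟩ ⟨D, ε₁, hD, hε', hb⟩
    have h1 := (ha.mono le_rfl (min_le_left ε₀ ε₁)).linear (hb.mono le_rfl (min_le_right ε₀ ε₁)) r s
    exact ⟨|r| * C + |s| * D + 1, min ε₀ ε₁, by positivity, lt_min hε hε',
      h1.mono (by linarith) le_rfl⟩
  have hexp : ∀ y, ∃ C ε₀ : ℝ, 0 < C ∧ 0 < ε₀ ∧ IsComparable C ε₀ (hat (sphereExp (n := n) y)) := by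
    intro y
    obtain ⟨C, ε₀, hC, hε, h⟩ := IsComparable.exp_inner y
    exact ⟨C, ε₀, hC, hε, h.congr fun x hx => (hat_of_norm (sphereExp y) hx).symm⟩
  rw [← Subalgebra.mem_toSubmodule, Algebra.adjoin_eq_span] at hg
  induction hg using Submodule.span_induction with
  | mem x hx =>
    obtain ⟨y, rfl⟩ := sphereExp_mem_of_mem_closure hx
    exact hexp y
  | zero => simpa using hcongr _ _ 0 0 (hexp 0) (hexp 0)
  | add x y _ _ hx hy => simpa using hcongr _ _ 1 1 hx hy
  | smul a x _ hx => simpa using hcongr _ _ a 0 hx hx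

omit [NeZero n] in
lemma separatesPoints_adjoin_sphereExp :
    (Algebra.adjoin ℝ (Set.range (sphereExp : Vec n → C(Sph n, ℝ)))).SeparatesPoints := by
  intro x z hxz
  refine ⟨_, ⟨sphereExp x, Algebra.subset_adjoin ⟨x, rfl⟩, rfl⟩, fun heq => hxz ?_⟩
  have hx := mem_sphere_zero_iff_norm.1 x.2
  have hz := mem_sphere_zero_iff_norm.1 z.2
  have h1 : inner ℝ (x : Vec n) x = inner ℝ (z : Vec n) x := Real.exp_injective heq
  rw [real_inner_self_eq_norm_sq, hx, one_pow] at h1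
  exact Subtype.ext ((inner_eq_one_iff_of_norm_eq_one hz hx).1 h1.symm).symm

/-- **Brascamp-Lieb inequality** for the vectors of a uniformly distributed orthonormal frame. -/
theorem IsHaarFrame.brascampLieb (h : IsHaarFrame μ) {f : Fin n → C(Sph n, ℝ)}
    (hpos : ∀ k x, 0 < f k x) :
    ∫ v, weight (fun k => hat (f k)) v ∂μ ≤
      Real.exp (1 / 4 * ∑ k, Real.log (∫ v, hat (f k) (v k) ∂μ)) := by
  have := h.isProbabilityMeasure
  have hlow : ∀ k, ∃ δ : ℝ, 0 < δ ∧ ∀ x, δ ≤ f k x := by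
    intro k
    obtain ⟨x₀, -, hx₀⟩ := isCompact_univ.exists_isMinOn
      ⟨sphereProj 0, Set.mem_univ _⟩ (f k).continuous.continuousOn
    exact ⟨f k x₀, hpos k x₀, fun x => hx₀ (Set.mem_univ x)⟩
  have hmpos : ∀ k, 0 < ∫ v, hat (f k) (v k) ∂μ := by
    intro k
    obtain ⟨δ, hδ, hle⟩ := hlow k
    calc 0 < δ := hδ
      _ = ∫ _v, δ ∂μ := by simp
      _ ≤ _ := integral_mono (integrable_const _) (integrable_hat _ k) fun v => hle _
  have key : ∀ η : ℝ, 0 < η → ∫ v, weight (fun k => hat (f k)) v ∂μ ≤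
      Real.exp (1 / 4 * ∑ k, Real.log (∫ v, hat (f k) (v k) ∂μ + 2 * η)) := by
    intro η hη
    have happ : ∀ k, ∃ g ∈ Algebra.adjoin ℝ (Set.range (sphereExp : Vec n → C(Sph n, ℝ))),
        ∀ x, f k x ≤ g x ∧ g x ≤ f k x + 2 * η := by
      intro k
      -- Approximating `f + η` within `η` gives an approximant between `f` and `f + 2η`, which is
      -- positive and dominates `f`.
      obtain ⟨g, hg⟩ := ContinuousMap.exists_mem_subalgebra_near_continuousMap_of_separatesPoints
        _ separatesPoints_adjoin_sphereExp (f k + ContinuousMap.const _ η) η hη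
      refine ⟨g, g.2, fun x => ?_⟩
      have h1 := ((g : C(Sph n, ℝ)) - (f k + ContinuousMap.const _ η)).norm_coe_le_norm x
      have h2 := abs_le.1 (h1.trans hg.le)
      simp only [ContinuousMap.sub_apply, ContinuousMap.add_apply, ContinuousMap.const_apply] at h2
      exact ⟨by linarith [h2.1], by linarith [h2.2]⟩
    choose g hgA hg using happ
    have hgpos : ∀ k x, 0 < g k x := fun k x => (hpos k x).trans_le (hg k x).1
    have hbl := h.brascampLieb_of_isComparable hgpos fun k =>
      exists_isComparable_of_mem_adjoin (hgA k)
    have hint : ∀ F : Fin n → C(Sph n, ℝ), (∀ k x, 0 < F k x) →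
        Integrable (weight fun k => hat (F k)) μ := by
      intro F hF
      have hm : Measurable (weight fun k => hat (F k)) :=
        Real.measurable_exp.comp ((Finset.measurable_sum _ fun k _ =>
          Real.measurable_log.comp ((measurable_hat _).comp (measurable_pi_apply k))).const_mul _)
      refine integrable_of_measurable_of_bounded hm
        (Real.exp (1 / 4 * ∑ k, Real.log ‖F k‖)) fun v => ?_
      rw [abs_of_pos (weight_pos _ _)]
      unfold weight
      gcongr with k
      · exact hF k _
      · exact (le_abs_self _).trans ((F k).norm_coe_le_norm _)
    calc ∫ v, weight (fun k => hat (f k)) v ∂μ ≤ ∫ v, weight (fun k => hat (g k)) v ∂μ := by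
          refine integral_mono (hint f hpos) (hint g hgpos) fun v => ?_
          unfold weight
          gcongr with k
          · exact hpos k _
          · exact (hg k _).1
      _ ≤ _ := hbl
      _ ≤ _ := by
          gcongr with k
          · exact (hmpos k).trans_le (integral_mono (integrable_hat _ k) (integrable_hat _ k)
              fun v => (hg k _).1)
          · calc ∫ v, hat (g k) (v k) ∂μ ≤ ∫ v, hat (f k) (v k) + 2 * η ∂μ :=
                  integral_mono (integrable_hat _ k) ((integrable_hat _ k).add
                    (integrable_const _)) fun v => (hg k _).2
              _ = _ := by
                  rw [integral_add (integrable_hat _ k) (integrable_const _)]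
                  simp
  have hlim : Filter.Tendsto (fun η : ℝ =>
      Real.exp (1 / 4 * ∑ k, Real.log (∫ v, hat (f k) (v k) ∂μ + 2 * η)))
      (nhdsWithin 0 (Set.Ioi 0))
      (nhds (Real.exp (1 / 4 * ∑ k, Real.log (∫ v, hat (f k) (v k) ∂μ)))) := by
    have hc : ContinuousAt (fun η : ℝ =>
        Real.exp (1 / 4 * ∑ k, Real.log (∫ v, hat (f k) (v k) ∂μ + 2 * η))) 0 := by
      refine Real.continuous_exp.continuousAt.comp (continuousAt_const.mul ?_)
      refine tendsto_finsetSum _ fun k _ => ?_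
      refine ContinuousAt.log (by fun_prop) ?_
      simpa using (hmpos k).ne'
    have := hc.tendsto.mono_left (nhdsWithin_le_nhds (s := Set.Ioi 0))
    simpa using this
  exact ge_of_tendsto hlim (by filter_upwards [self_mem_nhdsWithin] with η hη using key η hη)

end OMCRidge
end

noncomputable section

namespace OMCRidge

open InnerProductSpace (gramSchmidt gramSchmidtNormed)

variable {n : ℕ}

/-! ### Orthonormalized Gaussian vectors are uniformly distributed -/

/-- A proper subspace lies in a hyperplane, and the Gaussian has a nondegenerate component normal to
it. -/
lemma stdGaussian_submodule_eq_zero {S : Submodule ℝ (Vec n)} (hS : S ≠ ⊤) :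
    stdGaussian (Vec n) (S : Set (Vec n)) = 0 := by
  obtain ⟨u, hu, hu0⟩ := Submodule.exists_mem_ne_zero_of_ne_bot
    (mt Submodule.orthogonal_eq_bot_iff.1 hS)
  have hsub : (S : Set (Vec n)) ⊆ (innerSL ℝ u) ⁻¹' {0} := fun x hx => by
    simpa using (Submodule.mem_orthogonal' S u).1 hu x hx
  refine measure_mono_null hsub ?_
  rw [← Measure.map_apply (innerSL ℝ u).continuous.measurable (measurableSet_singleton 0),
    IsGaussian.map_eq_gaussianReal, variance_dual_stdGaussian]
  have hv : (‖innerSL ℝ u‖ ^ 2).toNNReal ≠ 0 := by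
    rw [Ne, Real.toNNReal_eq_zero, not_le, innerSL_apply_norm]
    exact pow_pos (norm_pos_iff.2 hu0) 2
  have := nullSingletonClass_gaussianReal hv (μ := ∫ x, innerSL ℝ u x ∂stdGaussian (Vec n))
  exact measure_singleton 0

lemma mem_span_of_gramSchmidt_eq_zero {g : Fin n → Vec n} {k : Fin n}
    (hk : gramSchmidt ℝ g k = 0) : g k ∈ Submodule.span ℝ (g '' Set.Iio k) := by
  rw [InnerProductSpace.gramSchmidt_def, sub_eq_zero] at hk
  rw [hk, ← InnerProductSpace.span_gramSchmidt_Iio]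
  refine Submodule.sum_mem _ fun i hi => ?_
  refine Submodule.span_mono ?_ (Submodule.starProjection_apply_mem _ _)
  rintro _ rfl
  exact ⟨i, Finset.mem_Iio.1 hi, rfl⟩

/-- With the other `m` vectors fixed, a vanishing output puts the `k`-th vector in their span, a
proper subspace of `ℝ^(m+1)`. -/
lemma pi_gramSchmidt_eq_zero {m : ℕ} {ν : Measure (Vec (m + 1))} [IsProbabilityMeasure ν]
    (hν : ∀ S : Submodule ℝ (Vec (m + 1)), S ≠ ⊤ → ν (S : Set (Vec (m + 1))) = 0)
    (k : Fin (m + 1)) :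
    (Measure.pi fun _ : Fin (m + 1) => ν) {g | gramSchmidt ℝ g k = 0} = 0 := by
  have hmeas : MeasurableSet {g : Fin (m + 1) → Vec (m + 1) | gramSchmidt ℝ g k = 0} :=
    measurable_gramSchmidt (f := fun g : Fin (m + 1) → Vec (m + 1) => g)
      (fun j => measurable_pi_apply j) k (measurableSet_singleton 0)
  have hmp := (measurePreserving_piFinSuccAbove (fun _ : Fin (m + 1) => ν) k).symm
  rw [← hmp.measure_preimage hmeas.nullMeasurableSet,
    Measure.prod_apply_symm (hmp.measurable hmeas)]
  refine lintegral_eq_zero_of_ae_eq_zero (Filter.Eventually.of_forall fun y => ?_)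
  refine measure_mono_null ?_ (hν (Submodule.span ℝ (Set.range y)) fun htop => ?_)
  · intro x hx
    set g := (MeasurableEquiv.piFinSuccAbove (fun _ : Fin (m + 1) => Vec (m + 1)) k).symm (x, y)
      with hg
    have hgk : g k = x :=
      Fin.insertNth_apply_same (α := fun _ => Vec (m + 1)) k x y
    have hgj : ∀ j, g (k.succAbove j) = y j :=
      Fin.insertNth_apply_succAbove (α := fun _ => Vec (m + 1)) k x y
    have h1 : g k ∈ Submodule.span ℝ (g '' Set.Iio k) := mem_span_of_gramSchmidt_eq_zero hx
    rw [hgk] at h1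
    refine Submodule.span_mono ?_ h1
    rintro _ ⟨i, hi, rfl⟩
    obtain ⟨j, rfl⟩ := Fin.exists_succAbove_eq (ne_of_lt hi)
    exact ⟨j, (hgj j).symm⟩
  · have h1 := finrank_range_le_card (R := ℝ) y
    rw [Set.finrank, htop, finrank_top] at h1
    simp at h1

lemma ae_gramSchmidt_ne_zero (k : Fin n) :
    ∀ᵐ g ∂(Measure.pi fun _ : Fin n => stdGaussian (Vec n)), gramSchmidt ℝ g k ≠ 0 := by
  obtain ⟨m, rfl⟩ : ∃ m, n = m + 1 := ⟨n - 1, by have := k.pos; omega⟩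
  have h := pi_gramSchmidt_eq_zero (ν := stdGaussian (Vec (m + 1)))
    (fun S hS => stdGaussian_submodule_eq_zero hS) k
  rw [ae_iff]
  simpa only [not_not] using h

lemma gramSchmidt_map (U : Vec n ≃ₗᵢ[ℝ] Vec n) (g : Fin n → Vec n) (k : Fin n) :
    gramSchmidt ℝ (fun j => U (g j)) k = U (gramSchmidt ℝ g k) := by
  induction k using WellFoundedLT.induction with
  | ind k ih =>
    rw [InnerProductSpace.gramSchmidt_def, InnerProductSpace.gramSchmidt_def, map_sub, map_sum]
    congr 1
    refine Finset.sum_congr rfl fun i hi => ?_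
    rw [ih i (Finset.mem_Iio.1 hi)]
    simp [Submodule.starProjection_singleton]

lemma gramSchmidtNormed_map (U : Vec n ≃ₗᵢ[ℝ] Vec n) (g : Fin n → Vec n) (k : Fin n) :
    gramSchmidtNormed ℝ (fun j => U (g j)) k = U (gramSchmidtNormed ℝ g k) := by
  simp [gramSchmidtNormed, gramSchmidt_map]

lemma measurable_gramSchmidtNormed :
    Measurable (gramSchmidtNormed ℝ : (Fin n → Vec n) → Fin n → Vec n) := by
  refine measurable_pi_lambda _ fun k => ?_
  have h := measurable_gramSchmidt (f := fun g : Fin n → Vec n => g)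
    (fun j => measurable_pi_apply j) k
  unfold gramSchmidtNormed
  simp only [RCLike.ofReal_real_eq_id, id]
  exact h.norm.inv.smul h

/-- The law of the Gram-Schmidt orthonormalization of `n` independent Gaussian vectors. -/
def gaussianFrame (n : ℕ) : Measure (Fin n → Vec n) :=
  (Measure.pi fun _ : Fin n => stdGaussian (Vec n)).map (gramSchmidtNormed ℝ)

instance : IsProbabilityMeasure (gaussianFrame n) :=
  Measure.isProbabilityMeasure_map measurable_gramSchmidtNormed.aemeasurable

lemma measurableSet_orthonormal : MeasurableSet {v : Fin n → Vec n | Orthonormal ℝ v} :=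
  isCompact_setOf_orthonormal.isClosed.measurableSet

lemma ae_orthonormal_gaussianFrame : ∀ᵐ v ∂gaussianFrame n, Orthonormal ℝ v := by
  rw [gaussianFrame, ae_map_iff measurable_gramSchmidtNormed.aemeasurable
    measurableSet_orthonormal]
  filter_upwards [ae_all_iff.2 (ae_gramSchmidt_ne_zero (n := n))] with g hg
  refine ⟨fun k => ?_, fun i j hij => ?_⟩
  · refine InnerProductSpace.gramSchmidtNormed_unit_length' ?_
    simpa [gramSchmidtNormed] using hg k
  · simp [gramSchmidtNormed, real_inner_smul_left, real_inner_smul_right,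
      InnerProductSpace.gramSchmidt_orthogonal ℝ g hij]

lemma measurable_map_isometry (U : Vec n ≃ₗᵢ[ℝ] Vec n) :
    Measurable fun (v : Fin n → Vec n) k => U (v k) :=
  measurable_pi_lambda _ fun k => U.continuous.measurable.comp (measurable_pi_apply k)

lemma gaussianFrame_map_left (U : Vec n ≃ₗᵢ[ℝ] Vec n) :
    (gaussianFrame n).map (fun v k => U (v k)) = gaussianFrame n := by
  have h1 : (Measure.pi fun _ : Fin n => stdGaussian (Vec n)).map
      (fun (v : Fin n → Vec n) k => U (v k)) = Measure.pi fun _ : Fin n => stdGaussian (Vec n) := by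
    have h := Measure.pi_map_pi (μ := fun _ : Fin n => stdGaussian (Vec n))
      (f := fun _ => U) fun _ => U.continuous.measurable.aemeasurable
    simp only [stdGaussian_map U] at h
    exact h
  conv_rhs => rw [gaussianFrame, ← h1]
  rw [gaussianFrame, Measure.map_map (measurable_map_isometry U) measurable_gramSchmidtNormed,
    Measure.map_map measurable_gramSchmidtNormed (measurable_map_isometry U)]
  congr 1
  funext g k
  exact (gramSchmidtNormed_map U g k).symm

/-- The matrix of the inner products of the vectors of two frames. -/
def frameInner (w v : Fin n → Vec n) (k : Fin n) : Vec n :=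
  WithLp.toLp 2 fun j => inner ℝ (w j) (v k)

/-- Transposition of the matrix whose columns are the vectors of a frame. -/
def frameTranspose (v : Fin n → Vec n) (k : Fin n) : Vec n := WithLp.toLp 2 fun j => v j k

lemma measurable_frameInner :
    Measurable fun p : (Fin n → Vec n) × (Fin n → Vec n) => frameInner p.1 p.2 := by
  refine measurable_pi_lambda _ fun k => ?_
  refine (WithLp.measurable_toLp 2 _).comp (measurable_pi_lambda _ fun j => ?_)
  fun_prop

lemma measurable_frameTranspose :
    Measurable (frameTranspose : (Fin n → Vec n) → Fin n → Vec n) := by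
  refine measurable_pi_lambda _ fun k => ?_
  refine (WithLp.measurable_toLp 2 _).comp (measurable_pi_lambda _ fun j => ?_)
  fun_prop

lemma frameInner_eq_repr (b : OrthonormalBasis (Fin n) ℝ (Vec n)) (v : Fin n → Vec n) :
    frameInner b v = fun k => b.repr (v k) := by
  funext k
  ext j
  simp [frameInner, b.repr_apply_apply]

/-- For independent frames `w` and `v`, the matrix `⟨w_j, v_k⟩` given `w` is `v` in the coordinates
of `w`, so left invariance gives it the law of `v`. Exchanging the two frames transposes this
matrix. -/
lemma gaussianFrame_map_transpose :
    (gaussianFrame n).map frameTranspose = gaussianFrame n := by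
  set μ := gaussianFrame n with hμ
  have h1 : (μ.prod μ).map (fun p => frameInner p.1 p.2) = μ := by
    ext A hA
    rw [Measure.map_apply measurable_frameInner hA,
      Measure.prod_apply (measurable_frameInner hA)]
    have : ∀ᵐ w ∂μ, μ (Prod.mk w ⁻¹'
        ((fun p : (Fin n → Vec n) × (Fin n → Vec n) => frameInner p.1 p.2) ⁻¹' A)) = μ A := by
      filter_upwards [ae_orthonormal_gaussianFrame] with w hw
      obtain ⟨b, rfl⟩ := exists_orthonormalBasis_coe_eq hw
      conv_rhs => rw [hμ, ← gaussianFrame_map_left b.repr,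
        Measure.map_apply (measurable_map_isometry _) hA]
      congr 1
      ext v
      simp only [Set.mem_preimage]
      rw [frameInner_eq_repr]
    rw [lintegral_congr_ae this]
    simp
  have h2 : (μ.prod μ).map (fun p => frameInner p.1 p.2) =
      ((μ.prod μ).map (fun p => frameInner p.1 p.2)).map frameTranspose := by
    conv_lhs => rw [← Measure.prod_swap]
    rw [Measure.map_map measurable_frameInner measurable_swap,
      Measure.map_map measurable_frameTranspose measurable_frameInner]
    congr 1
    funext p k
    ext j
    simp [frameInner, frameTranspose, real_inner_comm]
  rw [h1] at h2
  exact h2.symm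

/-- Transposition turns right multiplication into left multiplication. -/
lemma gaussianFrame_map_right {r : Fin n → Vec n} (hr : Orthonormal ℝ r) :
    (gaussianFrame n).map (fun v k => ∑ j, r k j • v j) = gaussianFrame n := by
  obtain ⟨b, rfl⟩ := exists_orthonormalBasis_coe_eq hr
  have hm : Measurable fun (v : Fin n → Vec n) k => ∑ j, b k j • v j :=
    measurable_pi_lambda _ fun k => Finset.measurable_sum _ fun j _ =>
      (measurable_pi_apply j).const_smul (b k j)
  conv_lhs => rw [← gaussianFrame_map_transpose]
  conv_rhs => rw [← gaussianFrame_map_transpose, ← gaussianFrame_map_left b.repr]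
  rw [Measure.map_map hm measurable_frameTranspose,
    Measure.map_map measurable_frameTranspose (measurable_map_isometry _)]
  congr 1
  funext v k
  ext i
  simp [frameTranspose, b.repr_apply_apply, PiLp.inner_apply, mul_comm]

/-- Orthonormalized Gaussian vectors form a uniformly distributed frame. -/
theorem isHaarFrame_gaussianFrame : IsHaarFrame (gaussianFrame n) where
  isProbabilityMeasure := inferInstance
  orthonormal := ae_orthonormal_gaussianFrame
  map_left := gaussianFrame_map_left
  map_right _ hr := gaussianFrame_map_right hr

/-! ### Polar form of isotropic distributions. -/

lemma exists_isometry_single (ω : Vec n) (k : Fin n) :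
    ∃ U : Vec n ≃ₗᵢ[ℝ] Vec n, U (‖ω‖ • EuclideanSpace.single k 1) = ω := by
  by_cases hω : ω = 0
  · exact ⟨LinearIsometryEquiv.refl ℝ _, by simp [hω]⟩
  have hn : ‖ω‖ ≠ 0 := norm_ne_zero_iff.2 hω
  obtain ⟨b, hb⟩ := Orthonormal.exists_orthonormalBasis_extension_of_card_eq
    (ι := Fin n) (E := Vec n) (𝕜 := ℝ) (by simp) (v := fun _ => ‖ω‖⁻¹ • ω) (s := {k})
    ⟨fun _ => by simp [norm_smul, hn], fun a c hac => absurd (Subsingleton.elim a c) hac⟩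
  refine ⟨(EuclideanSpace.basisFun (Fin n) ℝ).equiv b (Equiv.refl _), ?_⟩
  have h1 : (EuclideanSpace.basisFun (Fin n) ℝ).equiv b (Equiv.refl _)
      (EuclideanSpace.single k 1) = ‖ω‖⁻¹ • ω := by
    rw [← EuclideanSpace.basisFun_apply, OrthonormalBasis.equiv_apply_basis]
    exact hb k rfl
  rw [map_smul, h1, smul_smul, mul_inv_cancel₀ hn, one_smul]

/-- An isotropic distribution is the law of a uniformly distributed direction times an independent
length. -/
lemma map_smul_gaussianFrame {D : Measure (Vec n)} [IsProbabilityMeasure D] (hD : IsIsotropic D)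
    (k : Fin n) :
    ((gaussianFrame n).prod (D.map fun ω => ‖ω‖)).map (fun p => p.2 • p.1 k) = D := by
  set μ := gaussianFrame n with hμ
  have : IsProbabilityMeasure (D.map fun ω => ‖ω‖) :=
    Measure.isProbabilityMeasure_map (by fun_prop)
  have hm2 : Measurable fun p : (Fin n → Vec n) × Vec n => WithLp.toLp 2 fun j =>
      inner ℝ (p.1 j) p.2 :=
    (WithLp.measurable_toLp 2 _).comp (measurable_pi_lambda _ fun j => by fun_prop)
  have hm1 : Measurable fun p : (Fin n → Vec n) × ℝ => p.2 • p.1 k := by fun_prop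
  -- For a fixed frame the coordinates of `ω` are an isometric image of `ω`, so isotropy gives them
  -- the law `D`.
  have h1 : (μ.prod D).map (fun p => (WithLp.toLp 2 fun j => inner ℝ (p.1 j) p.2 : Vec n)) = D := by
    ext A hA
    rw [Measure.map_apply hm2 hA, Measure.prod_apply (hm2 hA)]
    have : ∀ᵐ w ∂μ, D (Prod.mk w ⁻¹' ((fun p : (Fin n → Vec n) × Vec n =>
        (WithLp.toLp 2 fun j => inner ℝ (p.1 j) p.2 : Vec n)) ⁻¹' A)) = D A := by
      filter_upwards [ae_orthonormal_gaussianFrame] with w hw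
      obtain ⟨b, rfl⟩ := exists_orthonormalBasis_coe_eq hw
      conv_rhs => rw [← hD b.repr, Measure.map_apply b.repr.continuous.measurable hA]
      congr 1
      ext x
      have : (WithLp.toLp 2 fun j => inner ℝ (b j) x : Vec n) = b.repr x := by
        ext j; simp [b.repr_apply_apply]
      simp only [Set.mem_preimage, this]
    rw [lintegral_congr_ae this]
    simp
  rw [← h1]
  ext A hA
  rw [Measure.map_apply hm1 hA, Measure.map_apply hm2 hA, Measure.prod_apply_symm (hm1 hA),
    Measure.prod_apply_symm (hm2 hA),
    lintegral_map (measurable_measure_prodMk_right (hm1 hA)) (by fun_prop)]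
  rw [h1]
  -- For fixed `ω = ‖ω‖ U e_k` the same coordinates are `‖ω‖` times the `k`-th vector of the
  -- transpose of the frame `U⁻¹ w`, which again is uniform.
  refine lintegral_congr fun ω => ?_
  obtain ⟨U, hU⟩ := exists_isometry_single ω k
  have hm3 : Measurable fun (v : Fin n → Vec n) =>
      frameTranspose fun k => U.symm (v k) :=
    measurable_frameTranspose.comp (measurable_map_isometry U.symm)
  have h3 : μ.map (fun (v : Fin n → Vec n) => frameTranspose fun k => U.symm (v k)) = μ := by
    conv_rhs => rw [hμ, ← gaussianFrame_map_transpose, ← gaussianFrame_map_left U.symm]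
    rw [Measure.map_map measurable_frameTranspose (measurable_map_isometry _)]
    rfl
  conv_lhs => rw [← h3]
  have hms : MeasurableSet ((fun v : Fin n → Vec n => (v, ‖ω‖)) ⁻¹'
      ((fun p : (Fin n → Vec n) × ℝ => p.2 • p.1 k) ⁻¹' A)) :=
    measurable_prodMk_right (hm1 hA)
  rw [Measure.map_apply hm3 hms]
  congr 1
  ext w
  have : (‖ω‖ • frameTranspose (fun k => U.symm (w k)) k : Vec n) =
      WithLp.toLp 2 fun j => inner ℝ (w j) ω := by
    ext j
    have e : inner ℝ (w j) ω = inner ℝ (U.symm (w j)) (‖ω‖ • EuclideanSpace.single k (1 : ℝ)) := by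
      rw [← U.inner_map_map (U.symm (w j)), U.apply_symm_apply, hU]
    simp only [PiLp.smul_apply, frameTranspose, smul_eq_mul]
    rw [e, real_inner_smul_right, EuclideanSpace.inner_single_right]
    simp
  simp only [Set.mem_preimage, this]

end OMCRidge
end

noncomputable section

namespace OMCRidge

open InnerProductSpace (gramSchmidt gramSchmidtNormed)

variable {n : ℕ}

/-! ### Exponential moments of block-orthogonal samples -/

/-- An output depends only on the inputs up to its position, so the filling of an incomplete last
block does not affect the directions in use. -/
lemma gramSchmidt_congr {f g : Fin n → Vec n} {k : Fin n} (h : ∀ j ≤ k, f j = g j) :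
    gramSchmidt ℝ f k = gramSchmidt ℝ g k := by
  induction k using WellFoundedLT.induction with
  | ind k ih =>
    rw [InnerProductSpace.gramSchmidt_def, InnerProductSpace.gramSchmidt_def, h k le_rfl]
    congr 1
    refine Finset.sum_congr rfl fun i hi => ?_
    have hik := Finset.mem_Iio.1 hi
    rw [ih i hik fun j hj => h j (hj.trans hik.le)]

/-- The number of the block of the `k`-th sample, and its position in this block. -/
def blockIndex (n : ℕ) [NeZero n] {m : ℕ} (k : Fin m) : Fin m × Fin n :=
  (⟨k / n, (Nat.div_le_self _ _).trans_lt k.2⟩, Fin.ofNat n k)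

lemma blockIndex_injective [NeZero n] {m : ℕ} :
    Function.Injective (blockIndex n : Fin m → Fin m × Fin n) := by
  intro k l hkl
  simp only [blockIndex, Prod.mk.injEq, Fin.mk.injEq] at hkl
  obtain ⟨h1, h2⟩ := hkl
  have h3 : (k : ℕ) % n = l % n := by simpa [Fin.ofNat] using congrArg Fin.val h2
  apply Fin.ext
  rw [← Nat.div_add_mod (k : ℕ) n, ← Nat.div_add_mod (l : ℕ) n, h1, h3]

lemma direction_blockIndex [NeZero n] {m : ℕ} (G : Fin m → Fin n → Vec n) (k : Fin m) :
    direction (fun k => G (blockIndex n k).1 (blockIndex n k).2) k =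
      gramSchmidtNormed ℝ (G (blockIndex n k).1) (blockIndex n k).2 := by
  have hn := NeZero.pos n
  have h : gramSchmidt ℝ (block (fun k => G (blockIndex n k).1 (blockIndex n k).2) (k / n))
      (Fin.ofNat n k) = gramSchmidt ℝ (G (blockIndex n k).1) (Fin.ofNat n k) := by
    refine gramSchmidt_congr fun j hj => ?_
    have hjv : (j : ℕ) ≤ k % n := hj
    have hlt : k / n * n + j < m := by
      have := Nat.div_add_mod' (k : ℕ) n
      have := k.2
      omega
    rw [block, dif_pos hlt]
    have hd : ((k : ℕ) / n * n + j) / n = k / n := by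
      rw [mul_comm, Nat.mul_add_div hn, Nat.div_eq_of_lt j.2, add_zero]
    have hm : Fin.ofNat n ((k : ℕ) / n * n + j) = j := by
      apply Fin.ext
      simp [Fin.ofNat, Nat.mod_eq_of_lt j.2]
    simp only [blockIndex, hd, hm]
  unfold direction gramSchmidtNormed
  rw [h]
  rfl

/-- Distinct coordinates of a product measure are independent. It allows every block to be completed
by auxiliary Gaussian vectors. -/
lemma map_comp_blockIndex [NeZero n] {m : ℕ} {α : Type*} [MeasurableSpace α] (ν : Measure α)
    [IsProbabilityMeasure ν] :
    (Measure.pi fun _ : Fin m => Measure.pi fun _ : Fin n => ν).map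
      (fun G k => G (blockIndex n k).1 (blockIndex n k).2) = Measure.pi fun _ : Fin m => ν := by
  symm
  refine Measure.pi_eq fun s hs => ?_
  set t : Fin m → Fin n → Set α := fun b j => ⋂ k, ⋂ (_ : blockIndex n k = (b, j)), s k with ht
  have hmeas : Measurable fun (G : Fin m → Fin n → α) (k : Fin m) =>
      G (blockIndex n k).1 (blockIndex n k).2 := measurable_pi_lambda _ fun k =>
    (measurable_pi_apply _).comp (measurable_pi_apply _)
  rw [Measure.map_apply hmeas (MeasurableSet.univ_pi hs)]
  have hpre : (fun (G : Fin m → Fin n → α) (k : Fin m) =>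
      G (blockIndex n k).1 (blockIndex n k).2) ⁻¹' Set.univ.pi s =
      Set.univ.pi fun b => Set.univ.pi fun j => t b j := by
    ext G
    simp only [Set.mem_preimage, Set.mem_univ_pi, ht, Set.mem_iInter]
    constructor
    · rintro h b j k hk
      have := h k
      rwa [hk] at this
    · intro h k
      exact h _ _ k rfl
  rw [hpre, Measure.pi_pi]
  simp only [Measure.pi_pi]
  rw [← Fintype.prod_prod_type' (f := fun b j => ν (t b j))]
  refine (Fintype.prod_of_injective (blockIndex n) blockIndex_injective _ _ ?_ ?_).symm
  · intro p hp
    have : t p.1 p.2 = Set.univ := by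
      simp only [ht]
      refine Set.iInter_eq_univ.2 fun k => Set.iInter_eq_univ.2 fun hk => ?_
      exact absurd ⟨k, hk⟩ hp
    rw [this, measure_univ]
  · intro k
    congr 1
    ext x
    simp only [ht, Set.mem_iInter]
    constructor
    · intro hx l hl
      rwa [blockIndex_injective hl]
    · intro hx
      exact hx k rfl

/-- Brascamp-Lieb inequality for continuous functions on `ℝⁿ`. -/
lemma integral_prod_gaussianFrame_le [NeZero n] {h : Fin n → Vec n → ℝ}
    (hc : ∀ j, Continuous (h j)) (hp : ∀ j x, 0 < h j x) :
    ∫ v, ∏ j, h j (v j) ∂gaussianFrame n ≤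
      ∏ j, Real.exp (1 / 4 * Real.log (∫ v, h j (v j) ^ 4 ∂gaussianFrame n)) := by
  set f : Fin n → C(Sph n, ℝ) := fun j =>
    ⟨fun x => h j x ^ 4, ((hc j).comp continuous_subtype_val).pow 4⟩ with hf
  have hfv : ∀ j x, ‖x‖ = 1 → hat (f j) x = h j x ^ 4 := fun j x hx => hat_of_norm (f j) hx
  have key := (isHaarFrame_gaussianFrame (n := n)).brascampLieb (f := f) fun j x =>
    pow_pos (hp j x) 4
  have e1 : ∫ v, weight (fun k => hat (f k)) v ∂gaussianFrame n =
      ∫ v, ∏ j, h j (v j) ∂gaussianFrame n := by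
    refine integral_congr_ae ?_
    filter_upwards [ae_orthonormal_gaussianFrame] with v hv
    unfold weight
    rw [Finset.mul_sum, Real.exp_sum]
    refine Finset.prod_congr rfl fun j _ => ?_
    change Real.exp (1 / 4 * Real.log (hat (f j) (v j))) = h j (v j)
    rw [hfv j _ (hv.1 j), Real.log_pow, ← mul_assoc]
    norm_num
    exact Real.exp_log (hp j _)
  have e2 : ∀ j, ∫ v, hat (f j) (v j) ∂gaussianFrame n = ∫ v, h j (v j) ^ 4 ∂gaussianFrame n := by
    intro j
    refine integral_congr_ae ?_
    filter_upwards [ae_orthonormal_gaussianFrame] with v hv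
    exact hfv j _ (hv.1 j)
  rw [e1] at key
  simp only [e2] at key
  rwa [Finset.mul_sum, Real.exp_sum] at key

/-- Exponential moments of block-orthogonal samples are controlled by those of one sample. -/
theorem integral_prod_omcLaw_le [NeZero n] {D : Measure (Vec n)} [IsProbabilityMeasure D]
    (hD : IsIsotropic D) (m : ℕ) {F : Vec n → ℝ} (hF : Continuous F) {δ B : ℝ} (hδ : 0 < δ)
    (hle : ∀ x, δ ≤ F x) (hge : ∀ x, F x ≤ B) :
    ∫ W, ∏ k, F (W k) ∂omcLaw D m ≤ Real.exp (1 / 4 * Real.log (∫ ω, F ω ^ 4 ∂D)) ^ m := by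
  set ν := D.map fun ω => ‖ω‖ with hν
  have hνp : IsProbabilityMeasure ν := Measure.isProbabilityMeasure_map (by fun_prop)
  have hFp : ∀ x, 0 < F x := fun x => hδ.trans_le (hle x)
  have hFB : ∀ x, |F x| ≤ B := fun x => by rw [abs_of_pos (hFp x)]; exact hge x
  have hFl : ∀ v, Integrable (fun l => F (l • v)) ν := fun v =>
    integrable_of_measurable_of_bounded (hF.comp (by fun_prop)).measurable B fun l => hFB _
  -- The lengths are independent of each other and of the directions, so they are integrated out
  -- first.
  set f : Vec n → ℝ := fun v => ∫ l, F (l • v) ∂ν with hf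
  have hfc : Continuous f := by
    refine continuous_of_dominated (bound := fun _ => B) ?_ ?_ (integrable_const _) ?_
    · exact fun v => (hFl v).aestronglyMeasurable
    · exact fun v => Filter.Eventually.of_forall fun l => hFB _
    · exact Filter.Eventually.of_forall fun l => hF.comp (by fun_prop)
  have hfp : ∀ v, 0 < f v := fun v => by
    calc 0 < δ := hδ
      _ = ∫ _l, δ ∂ν := by simp
      _ ≤ f v := integral_mono (integrable_const _) (hFl v) fun l => hle _
  have hfB : ∀ v, f v ≤ B := fun v => by
    calc f v ≤ ∫ _l, B ∂ν := integral_mono (hFl v) (integrable_const _) fun l => hge _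
      _ = B := by simp
  have hf4 : ∀ v, f v ^ 4 ≤ ∫ l, F (l • v) ^ 4 ∂ν := fun v =>
    (Even.convexOn_pow (n := 4) (by decide)).map_integral_le (continuous_pow 4).continuousOn
      isClosed_univ (by simp) (hFl v)
      (integrable_of_measurable_of_bounded ((hF.comp (by fun_prop)).measurable.pow_const 4)
        (B ^ 4) fun l => by
          change |F (l • v) ^ 4| ≤ B ^ 4
          rw [abs_pow]; exact pow_le_pow_left₀ (abs_nonneg _) (hFB _) 4)
  have hmarg : ∀ j, ∫ v, f (v j) ^ 4 ∂gaussianFrame n ≤ ∫ ω, F ω ^ 4 ∂D := by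
    intro j
    have hmeas : Measurable fun p : (Fin n → Vec n) × ℝ => p.2 • p.1 j := by fun_prop
    have hF4 : ∀ x, |F x ^ 4| ≤ B ^ 4 := fun x => by
      rw [abs_pow]; exact pow_le_pow_left₀ (abs_nonneg _) (hFB _) 4
    have hint : Integrable (fun p : (Fin n → Vec n) × ℝ => F (p.2 • p.1 j) ^ 4)
        ((gaussianFrame n).prod ν) :=
      integrable_of_measurable_of_bounded ((hF.measurable.comp hmeas).pow_const 4) (B ^ 4)
        fun p => hF4 _
    conv_rhs => rw [← map_smul_gaussianFrame hD j]
    rw [integral_map hmeas.aemeasurable (hF.measurable.pow_const 4).aestronglyMeasurable,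
      integral_prod _ hint]
    refine integral_mono ?_ hint.integral_prod_left fun v => hf4 (v j)
    refine integrable_of_measurable_of_bounded
      ((hfc.measurable.comp (measurable_pi_apply j)).pow_const 4) (B ^ 4) fun v => ?_
    rw [abs_pow, abs_of_pos (hfp _)]
    exact pow_le_pow_left₀ (hfp _).le (hfB _) 4
  have hPm : Measurable fun W : Fin m → Vec n => ∏ k, F (W k) :=
    Finset.measurable_prod _ fun k _ => hF.measurable.comp (measurable_pi_apply k)
  have hPb : ∀ W : Fin m → Vec n, |∏ k, F (W k)| ≤ B ^ m := fun W => by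
    rw [Finset.abs_prod]
    calc ∏ k, |F (W k)| ≤ ∏ _k : Fin m, B :=
          Finset.prod_le_prod (fun k _ => abs_nonneg _) fun k _ => hFB _
      _ = B ^ m := by simp
  have hstep1 : ∫ W, ∏ k, F (W k) ∂omcLaw D m =
      ∫ g, ∏ k, f (direction g k) ∂(Measure.pi fun _ : Fin m => stdGaussian (Vec n)) := by
    rw [omcLaw, integral_map measurable_blockOrthogonalize.aemeasurable
      hPm.aestronglyMeasurable, integral_prod]
    · refine integral_congr_ae (Filter.Eventually.of_forall fun g => ?_)
      exact integral_fintype_prod_eq_prod (μ := fun _ : Fin m => ν)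
        (fun (k : Fin m) l => F (l • direction g k))
    · exact integrable_of_measurable_of_bounded (hPm.comp measurable_blockOrthogonalize) (B ^ m)
        fun p => hPb _
  have hdir : Measurable fun g : Fin m → Vec n => ∏ k, f (direction g k) := by
    refine Finset.measurable_prod _ fun k _ => hfc.measurable.comp ?_
    have h1 := (measurable_pi_apply k).comp ((measurable_blockOrthogonalize (n := n) (m := m)).comp
      (measurable_prodMk_right (y := fun _ => (1 : ℝ))))
    simpa [blockOrthogonalize, Function.comp_def] using h1
  have hemeas : Measurable fun (G : Fin m → Fin n → Vec n) (k : Fin m) =>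
      G (blockIndex n k).1 (blockIndex n k).2 := measurable_pi_lambda _ fun k =>
    (measurable_pi_apply _).comp (measurable_pi_apply _)
  classical
  -- Auxiliary positions carry the constant factor one.
  set h : Fin m → Fin n → Vec n → ℝ := fun b j x =>
    if (b, j) ∈ Set.range (blockIndex n : Fin m → Fin m × Fin n) then f x else 1 with hh
  have hhc : ∀ b j, Continuous (h b j) := fun b j => by
    simp only [hh]; split_ifs; exacts [hfc, continuous_const]
  have hhp : ∀ b j x, 0 < h b j x := fun b j x => by
    simp only [hh]; split_ifs; exacts [hfp x, one_pos]
  have hprod : ∀ V : Fin m → Fin n → Vec n,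
      ∏ k : Fin m, f (V (blockIndex n k).1 (blockIndex n k).2) = ∏ b, ∏ j, h b j (V b j) := by
    intro V
    rw [← Fintype.prod_prod_type' (f := fun b j => h b j (V b j))]
    refine Fintype.prod_of_injective (blockIndex n) blockIndex_injective _ _ ?_ ?_
    · intro p hp
      simp only [hh, if_neg hp]
    · intro k
      have : ((blockIndex n k).1, (blockIndex n k).2) ∈
        Set.range (blockIndex n : Fin m → Fin m × Fin n) := ⟨k, rfl⟩
      simp only [hh, if_pos this]
  set c := Real.exp (1 / 4 * Real.log (∫ ω, F ω ^ 4 ∂D)) with hc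
  have hblock : ∀ b j, Real.exp (1 / 4 * Real.log (∫ v, h b j (v j) ^ 4 ∂gaussianFrame n)) ≤
      if (b, j) ∈ Set.range (blockIndex n : Fin m → Fin m × Fin n) then c else 1 := by
    intro b j
    simp only [hh]
    split_ifs with hr
    · rw [hc]
      have hpos : 0 < ∫ v, f (v j) ^ 4 ∂gaussianFrame n := by
        calc (0 : ℝ) < δ ^ 4 := by positivity
          _ = ∫ _v, δ ^ 4 ∂gaussianFrame n := by simp
          _ ≤ _ := by
            refine integral_mono (integrable_const _) ?_ fun v => ?_
            · refine integrable_of_measurable_of_bounded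
                ((hfc.measurable.comp (measurable_pi_apply j)).pow_const 4) (B ^ 4) fun v => ?_
              rw [abs_pow, abs_of_pos (hfp _)]
              exact pow_le_pow_left₀ (hfp _).le (hfB _) 4
            · refine pow_le_pow_left₀ hδ.le ?_ 4
              calc δ = ∫ _l, δ ∂ν := by simp
                _ ≤ f (v j) := integral_mono (integrable_const _) (hFl _) fun l => hle _
      have := hmarg j
      gcongr
    · simp
  calc ∫ W, ∏ k, F (W k) ∂omcLaw D m
      = ∫ g, ∏ k, f (direction g k) ∂(Measure.pi fun _ : Fin m => stdGaussian (Vec n)) := hstep1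
    _ = ∫ G : Fin m → Fin n → Vec n, ∏ b, ∏ j, h b j (gramSchmidtNormed ℝ (G b) j)
        ∂(Measure.pi fun _ : Fin m => Measure.pi fun _ : Fin n => stdGaussian (Vec n)) := by
        rw [← map_comp_blockIndex (n := n) (m := m) (stdGaussian (Vec n)),
          integral_map hemeas.aemeasurable hdir.aestronglyMeasurable]
        refine integral_congr_ae (Filter.Eventually.of_forall fun G => ?_)
        simp only [direction_blockIndex]
        exact hprod fun b => gramSchmidtNormed ℝ (G b)
    _ = ∏ b, ∫ g : Fin n → Vec n, ∏ j, h b j (gramSchmidtNormed ℝ g j)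
        ∂(Measure.pi fun _ : Fin n => stdGaussian (Vec n)) :=
        integral_fintype_prod_eq_prod
          (μ := fun _ : Fin m => Measure.pi fun _ : Fin n => stdGaussian (Vec n))
          fun (b : Fin m) (g : Fin n → Vec n) => ∏ j, h b j (gramSchmidtNormed ℝ g j)
    _ = ∏ b, ∫ v, ∏ j, h b j (v j) ∂gaussianFrame n := by
        refine Finset.prod_congr rfl fun b _ => ?_
        rw [gaussianFrame, integral_map measurable_gramSchmidtNormed.aemeasurable]
        exact (Finset.measurable_prod _ fun j _ =>
          (hhc b j).measurable.comp (measurable_pi_apply j)).aestronglyMeasurable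
    _ ≤ ∏ b, ∏ j, if (b, j) ∈ Set.range (blockIndex n : Fin m → Fin m × Fin n) then c else 1 := by
        refine Finset.prod_le_prod (fun b _ => integral_nonneg fun v =>
          Finset.prod_nonneg fun j _ => (hhp b j _).le) fun b _ => ?_
        refine (integral_prod_gaussianFrame_le (hhc b) (hhp b)).trans ?_
        exact Finset.prod_le_prod (fun j _ => (Real.exp_pos _).le) fun j _ => hblock b j
    _ = c ^ m := by
        rw [← Fintype.prod_prod_type' (f := fun b j =>
          if (b, j) ∈ Set.range (blockIndex n : Fin m → Fin m × Fin n) then c else 1)]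
        rw [← Fintype.prod_of_injective (blockIndex n : Fin m → Fin m × Fin n) blockIndex_injective
          (fun _ => c)]
        · simp
        · intro p hp
          simp only [if_neg hp]
        · intro k
          have : ((blockIndex n k).1, (blockIndex n k).2) ∈
            Set.range (blockIndex n : Fin m → Fin m × Fin n) := ⟨k, rfl⟩
          simp only [if_pos this]

/-- Exponential moments of independent samples are controlled by those of one sample. -/
theorem integral_prod_iidLaw_le {D : Measure (Vec n)} [IsProbabilityMeasure D]
    (m : ℕ) {F : Vec n → ℝ} (hF : Continuous F) {δ B : ℝ} (hδ : 0 < δ)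
    (hle : ∀ x, δ ≤ F x) (hge : ∀ x, F x ≤ B) :
    ∫ W, ∏ k, F (W k) ∂iidLaw D m ≤ Real.exp (1 / 4 * Real.log (∫ ω, F ω ^ 4 ∂D)) ^ m := by
  have hFp : ∀ x, 0 < F x := fun x => hδ.trans_le (hle x)
  have hFB : ∀ x, |F x| ≤ B := fun x => by rw [abs_of_pos (hFp x)]; exact hge x
  have hFi : Integrable F D := integrable_of_measurable_of_bounded hF.measurable B hFB
  have hI : 0 < ∫ ω, F ω ∂D := by
    calc 0 < δ := hδ
      _ = ∫ _l, δ ∂D := by simp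
      _ ≤ _ := integral_mono (integrable_const _) hFi hle
  have hf4 : (∫ ω, F ω ∂D) ^ 4 ≤ ∫ ω, F ω ^ 4 ∂D :=
    (Even.convexOn_pow (n := 4) (by decide)).map_integral_le (continuous_pow 4).continuousOn
      isClosed_univ (by simp) hFi
      (integrable_of_measurable_of_bounded (hF.measurable.pow_const 4)
        (B ^ 4) fun l => by
          change |F l ^ 4| ≤ B ^ 4
          rw [abs_pow]; exact pow_le_pow_left₀ (abs_nonneg _) (hFB _) 4)
  rw [iidLaw, integral_fintype_prod_eq_prod (μ := fun _ : Fin m => D) (fun _ => F)]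
  simp only [Finset.prod_const, Finset.card_univ, Fintype.card_fin]
  refine pow_le_pow_left₀ hI.le ?_ m
  calc ∫ ω, F ω ∂D = Real.exp (1 / 4 * Real.log ((∫ ω, F ω ∂D) ^ 4)) := by
        rw [Real.log_pow, ← mul_assoc]
        norm_num
        exact (Real.exp_log hI).symm
    _ ≤ _ := by gcongr

end OMCRidge
end

noncomputable section

namespace OMCRidge

variable {n : ℕ} {E : Type*} [NormedAddCommGroup E] [InnerProductSpace ℝ E]
  [FiniteDimensional ℝ E] [MeasurableSpace E] [BorelSpace E]

/-! ### Concentration of sums of random vectors -/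

/-- The moments of products over the sample `P` are at most those of independent variables with
the `L⁴`-norm in place of the `L¹`-norm. -/
def IsMomentDominated {m : ℕ} (P : Measure (Fin m → Vec n)) (D : Measure (Vec n)) : Prop :=
  ∀ (F : Vec n → ℝ) (δ B : ℝ), Continuous F → 0 < δ → (∀ x, δ ≤ F x) → (∀ x, F x ≤ B) →
    ∫ W, ∏ k, F (W k) ∂P ≤ Real.exp (1 / 4 * Real.log (∫ ω, F ω ^ 4 ∂D)) ^ m

/-- For centered variables the linear term integrates to zero, leaving only the exponential of the
square. -/
lemma exp_le_self_add_exp_sq (x : ℝ) : Real.exp x ≤ x + Real.exp (x ^ 2) := by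
  have h0 := Real.add_one_le_exp (x ^ 2)
  rcases le_or_gt |x| 1 with h | h
  · have := (abs_le.1 (Real.abs_exp_sub_one_sub_id_le h)).2
    linarith
  · rcases lt_abs.1 h with h | h
    · have : Real.exp x ≤ Real.exp (x ^ 2) := Real.exp_le_exp.2 (by nlinarith)
      linarith
    · have : Real.exp x ≤ 1 := Real.exp_le_one_iff.2 (by linarith)
      nlinarith

/-- The expectation of `exp (z² / 4)` for a standard Gaussian variable `z`. -/
def gaussianMoment : ℝ := ∫ z, Real.exp (z ^ 2 / 4) ∂gaussianReal 0 1

lemma integrable_exp_sq_gaussianReal :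
    Integrable (fun z : ℝ => Real.exp (z ^ 2 / 4)) (gaussianReal 0 1) := by
  rw [gaussianReal_of_var_ne_zero 0 one_ne_zero,
    integrable_withDensity_iff (measurable_gaussianPDF 0 1)
      (Filter.Eventually.of_forall fun x => gaussianPDF_lt_top)]
  have h := (integrable_exp_neg_mul_sq (b := 1 / 4) (by norm_num)).const_mul ((√(2 * Real.pi))⁻¹)
  refine h.congr (Filter.Eventually.of_forall fun z => ?_)
  simp only [toReal_gaussianPDF, gaussianPDFReal, NNReal.coe_one, mul_one, sub_zero]
  rw [mul_left_comm, ← Real.exp_add]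
  congr 2
  ring

lemma one_le_gaussianMoment : 1 ≤ gaussianMoment := by
  calc (1 : ℝ) = ∫ _z : ℝ, (1 : ℝ) ∂gaussianReal 0 1 := by simp
    _ ≤ gaussianMoment := integral_mono (integrable_const _) integrable_exp_sq_gaussianReal
        fun z => Real.one_le_exp (by positivity)

lemma map_inner_stdGaussian (x : E) :
    (stdGaussian E).map (fun g => inner ℝ x g) = gaussianReal 0 (‖x‖₊ ^ 2) := by
  have h := IsGaussian.map_eq_gaussianReal (μ := stdGaussian E) (innerSL ℝ x)
  rw [variance_dual_stdGaussian, innerSL_apply_norm, integral_strongDual_stdGaussian] at h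
  rw [Real.toNNReal_pow (norm_nonneg x), norm_toNNReal] at h
  exact h

lemma lintegral_exp_inner_stdGaussian (x : E) :
    ∫⁻ g, ENNReal.ofReal (Real.exp (inner ℝ x g)) ∂stdGaussian E =
      ENNReal.ofReal (Real.exp (‖x‖ ^ 2 / 2)) := by
  have hm : Measurable fun g : E => inner ℝ x g := by fun_prop
  rw [← lintegral_map (f := fun t => ENNReal.ofReal (Real.exp t)) (by fun_prop) hm,
    map_inner_stdGaussian,
    ← ofReal_integral_eq_lintegral_ofReal (by simpa using integrable_exp_mul_gaussianReal 1)
      (Filter.Eventually.of_forall fun t => (Real.exp_pos t).le)]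
  have h := congrFun (mgf_id_gaussianReal (μ := 0) (v := ‖x‖₊ ^ 2)) 1
  simp only [mgf, id, one_mul, one_pow, mul_one, zero_add] at h
  rw [h]
  simp

lemma lintegral_exp_sq_inner_stdGaussian_le {x : E} {κ : ℝ} (h : κ * ‖x‖ ^ 2 ≤ 1 / 4) :
    ∫⁻ g, ENNReal.ofReal (Real.exp (κ * inner ℝ x g ^ 2)) ∂stdGaussian E ≤
      ENNReal.ofReal gaussianMoment := by
  have hm : Measurable fun g : E => inner ℝ x g := by fun_prop
  have hs : (gaussianReal 0 1).map (‖x‖ * ·) = gaussianReal 0 (‖x‖₊ ^ 2) := by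
    rw [gaussianReal_map_const_mul]
    congr 1
    · simp
    · ext; simp
  rw [← lintegral_map (f := fun t => ENNReal.ofReal (Real.exp (κ * t ^ 2))) (by fun_prop) hm,
    map_inner_stdGaussian, ← hs, lintegral_map (by fun_prop) (by fun_prop), gaussianMoment,
    ofReal_integral_eq_lintegral_ofReal integrable_exp_sq_gaussianReal
      (Filter.Eventually.of_forall fun t => (Real.exp_pos _).le)]
  refine lintegral_mono fun z => ENNReal.ofReal_le_ofReal (Real.exp_le_exp.2 ?_)
  calc κ * (‖x‖ * z) ^ 2 = κ * ‖x‖ ^ 2 * z ^ 2 := by ring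
    _ ≤ 1 / 4 * z ^ 2 := by gcongr
    _ = z ^ 2 / 4 := by ring

/-- Sub-Gaussian bound in a fixed direction. -/
lemma IsMomentDominated.integral_exp_inner_sum_le {m : ℕ} {P : Measure (Fin m → Vec n)}
    {D : Measure (Vec n)} [IsProbabilityMeasure D] (hP : IsMomentDominated P D)
    {φ : Vec n → ℝ} (hφ : Continuous φ) {R : ℝ} (hR : ∀ ω, |φ ω| ≤ R) (h0 : ∫ ω, φ ω ∂D = 0) :
    ∫ W, ∏ k, Real.exp (φ (W k)) ∂P ≤ ∫ ω, Real.exp (16 * m * φ ω ^ 2) ∂D := by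
  have hi : ∀ {ψ : Vec n → ℝ}, Continuous ψ → ∀ C, (∀ ω, |ψ ω| ≤ C) → Integrable ψ D :=
    fun hψ C hC => integrable_of_measurable_of_bounded hψ.measurable C hC
  have hie : ∀ {ψ : Vec n → ℝ}, Continuous ψ → ∀ C, (∀ ω, ψ ω ≤ C) →
      Integrable (fun ω => Real.exp (ψ ω)) D := fun hψ C hC =>
    hi (Real.continuous_exp.comp hψ) (Real.exp C) fun ω => by
      rw [abs_of_pos (Real.exp_pos _)]; exact Real.exp_le_exp.2 (hC ω)
  have hsq : ∀ ω, φ ω ^ 2 ≤ R ^ 2 := fun ω => sq_le_sq.2 ((hR ω).trans (le_abs_self R))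
  have h16 : Integrable (fun ω => Real.exp ((4 * φ ω) ^ 2)) D :=
    hie (by fun_prop) (16 * R ^ 2) fun ω => by nlinarith [hsq ω]
  have h4 : Integrable (fun ω => Real.exp (4 * φ ω)) D :=
    hie (by fun_prop) (4 * R) fun ω => by linarith [(abs_le.1 (hR ω)).2]
  have hφi : Integrable φ D := hi hφ R hR
  have h1 := hP (fun ω => Real.exp (φ ω)) (Real.exp (-R)) (Real.exp R)
    (Real.continuous_exp.comp hφ) (Real.exp_pos _)
    (fun ω => Real.exp_le_exp.2 (abs_le.1 (hR ω)).1)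
    (fun ω => Real.exp_le_exp.2 (abs_le.1 (hR ω)).2)
  have e4 : ∀ ω, Real.exp (φ ω) ^ 4 = Real.exp (4 * φ ω) := fun ω => by
    rw [← Real.exp_nat_mul]; norm_num
  simp only [e4] at h1
  set J := ∫ ω, Real.exp ((4 * φ ω) ^ 2) ∂D with hJ
  have hIJ : ∫ ω, Real.exp (4 * φ ω) ∂D ≤ J := by
    calc ∫ ω, Real.exp (4 * φ ω) ∂D ≤ ∫ ω, (4 * φ ω + Real.exp ((4 * φ ω) ^ 2)) ∂D :=
          integral_mono h4 ((hφi.const_mul 4).add h16) fun ω => exp_le_self_add_exp_sq _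
      _ = J := by
          rw [integral_add (hφi.const_mul 4) h16, integral_const_mul, h0, mul_zero, zero_add]
  have hJ1 : 1 ≤ J := by
    calc (1 : ℝ) = ∫ _ω, (1 : ℝ) ∂D := by simp
      _ ≤ J := integral_mono (integrable_const _) h16 fun ω => Real.one_le_exp (sq_nonneg _)
  have hIpos : 0 < ∫ ω, Real.exp (4 * φ ω) ∂D := integral_exp_pos h4
  -- The fourth root is dropped, as `J ≥ 1`.
  have hroot : Real.exp (1 / 4 * Real.log (∫ ω, Real.exp (4 * φ ω) ∂D)) ≤ J := by
    have hl := Real.log_le_log hIpos hIJ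
    have hJl := Real.log_nonneg hJ1
    calc _ ≤ Real.exp (Real.log J) := Real.exp_le_exp.2 (by linarith)
      _ = J := Real.exp_log (by linarith)
  have epow : ∀ ω, Real.exp ((4 * φ ω) ^ 2) ^ m = Real.exp (16 * m * φ ω ^ 2) := fun ω => by
    rw [← Real.exp_nat_mul]; congr 1; ring
  -- Jensen's inequality moves the power inside, leaving one integral over a single frequency whose
  -- exponent is quadratic in `φ`; this form can be averaged over a Gaussian direction.
  have hpow : J ^ m ≤ ∫ ω, Real.exp ((4 * φ ω) ^ 2) ^ m ∂D := by
    refine (convexOn_pow m).map_integral_le (continuous_pow m).continuousOn isClosed_Ici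
      (Filter.Eventually.of_forall fun ω => (Real.exp_pos _).le) h16 ?_
    simp only [Function.comp_def, epow]
    refine hie (by fun_prop) (16 * m * R ^ 2) fun ω => ?_
    have := hsq ω
    gcongr
  calc _ ≤ _ := h1
    _ ≤ J ^ m := pow_le_pow_left₀ (Real.exp_pos _).le hroot m
    _ ≤ _ := by simpa only [epow] using hpow

/-- Exponential square integrability of sums of bounded centered random vectors, with a constant
that depends neither on the dimension nor on the number of vectors. -/
theorem IsMomentDominated.lintegral_exp_sq_norm_sum_le {m : ℕ} {P : Measure (Fin m → Vec n)}
    {D : Measure (Vec n)} [IsProbabilityMeasure P] [IsProbabilityMeasure D]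
    (hP : IsMomentDominated P D)
    {X : Vec n → E} (hX : Continuous X) {R : ℝ} (hR : ∀ ω, ‖X ω‖ ≤ R) (h0 : ∫ ω, X ω ∂D = 0)
    {τ : ℝ} (hτ : 16 * m * τ ^ 2 * R ^ 2 ≤ 1 / 4) :
    ∫⁻ W, ENNReal.ofReal (Real.exp (τ ^ 2 / 2 * ‖∑ k, X (W k)‖ ^ 2)) ∂P ≤
      ENNReal.ofReal gaussianMoment := by
  have hXi : Integrable X D := by
    refine Integrable.of_bound hX.aestronglyMeasurable R (Filter.Eventually.of_forall hR)
  have hXm := hX.measurable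
  have hstep : ∀ g : E, ∫⁻ W, ENNReal.ofReal (Real.exp (inner ℝ (τ • ∑ k, X (W k)) g)) ∂P ≤
      ∫⁻ ω, ENNReal.ofReal (Real.exp (16 * m * τ ^ 2 * inner ℝ (X ω) g ^ 2)) ∂D := by
    intro g
    have hφ : Continuous fun ω => τ * inner ℝ (X ω) g := by fun_prop
    have hφR : ∀ ω, |τ * inner ℝ (X ω) g| ≤ |τ| * (R * ‖g‖) := fun ω => by
      rw [abs_mul]
      have h1 := abs_real_inner_le_norm (X ω) g
      have h2 := hR ω
      exact mul_le_mul_of_nonneg_left (h1.trans (by gcongr)) (abs_nonneg τ)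
    have hφ0 : ∫ ω, τ * inner ℝ (X ω) g ∂D = 0 := by
      rw [integral_const_mul]
      simp only [real_inner_comm g]
      rw [integral_inner hXi, h0, inner_zero_right, mul_zero]
    have key := hP.integral_exp_inner_sum_le hφ hφR hφ0
    have e1 : ∀ W : Fin m → Vec n, ∏ k, Real.exp (τ * inner ℝ (X (W k)) g) =
        Real.exp (inner ℝ (τ • ∑ k, X (W k)) g) := fun W => by
      rw [← Real.exp_sum, ← Finset.mul_sum, inner_smul_left, sum_inner]
      simp
    have e2 : ∀ ω, 16 * m * (τ * inner ℝ (X ω) g) ^ 2 = 16 * m * τ ^ 2 * inner ℝ (X ω) g ^ 2 :=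
      fun ω => by ring
    simp only [e1, e2] at key
    rw [← ofReal_integral_eq_lintegral_ofReal, ← ofReal_integral_eq_lintegral_ofReal]
    · exact ENNReal.ofReal_le_ofReal key
    · refine integrable_of_measurable_of_bounded (by fun_prop)
        (Real.exp (16 * m * (|τ| * (R * ‖g‖)) ^ 2)) fun ω => ?_
      rw [abs_of_pos (Real.exp_pos _), ← e2]
      refine Real.exp_le_exp.2 (mul_le_mul_of_nonneg_left ?_ (by positivity))
      exact sq_le_sq.2 ((hφR ω).trans (le_abs_self _))
    · exact Filter.Eventually.of_forall fun t => (Real.exp_pos _).le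
    · refine integrable_of_measurable_of_bounded (by fun_prop)
        (Real.exp (|τ| * (R * ‖g‖)) ^ m) fun W => ?_
      rw [abs_of_pos (Real.exp_pos _), ← e1]
      calc _ ≤ ∏ _k : Fin m, Real.exp (|τ| * (R * ‖g‖)) := by
            refine Finset.prod_le_prod (fun k _ => (Real.exp_pos _).le) fun k _ => ?_
            exact Real.exp_le_exp.2 (abs_le.1 (hφR _)).2
        _ = _ := by simp
    · exact Filter.Eventually.of_forall fun t => (Real.exp_pos _).le
  -- Gaussian linearization: the exponential of the squared norm is an average of exponentials of
  -- linear functionals, to which the directional bound applies.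
  calc ∫⁻ W, ENNReal.ofReal (Real.exp (τ ^ 2 / 2 * ‖∑ k, X (W k)‖ ^ 2)) ∂P
      = ∫⁻ W, ∫⁻ g, ENNReal.ofReal (Real.exp (inner ℝ (τ • ∑ k, X (W k)) g)) ∂stdGaussian E ∂P := by
        refine lintegral_congr fun W => ?_
        rw [lintegral_exp_inner_stdGaussian, norm_smul, mul_pow, Real.norm_eq_abs, sq_abs]
        congr 2
        ring
    _ = ∫⁻ g, ∫⁻ W, ENNReal.ofReal (Real.exp (inner ℝ (τ • ∑ k, X (W k)) g)) ∂P ∂stdGaussian E := by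
        refine lintegral_lintegral_swap (Measurable.aemeasurable ?_)
        unfold Function.uncurry
        fun_prop
    _ ≤ ∫⁻ g, ∫⁻ ω, ENNReal.ofReal (Real.exp (16 * m * τ ^ 2 * inner ℝ (X ω) g ^ 2)) ∂D
          ∂stdGaussian E := lintegral_mono hstep
    _ = ∫⁻ ω, ∫⁻ g, ENNReal.ofReal (Real.exp (16 * m * τ ^ 2 * inner ℝ (X ω) g ^ 2))
          ∂stdGaussian E ∂D := by
        refine lintegral_lintegral_swap (Measurable.aemeasurable ?_)
        unfold Function.uncurry
        fun_prop
    -- For fixed `ω` the inner product is Gaussian with standard deviation at most `R`, whatever the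
    -- dimension of `E`; the hypothesis on `τ` keeps the quadratic coefficient below the critical
    -- `1/2`.
    _ ≤ ∫⁻ _ω, ENNReal.ofReal gaussianMoment ∂D := by
        refine lintegral_mono fun ω => lintegral_exp_sq_inner_stdGaussian_le (le_trans ?_ hτ)
        have := hR ω
        gcongr
    _ = ENNReal.ofReal gaussianMoment := by simp

theorem IsMomentDominated.measureReal_norm_sum_gt_le {m : ℕ} {P : Measure (Fin m → Vec n)}
    {D : Measure (Vec n)} [IsProbabilityMeasure P] [IsProbabilityMeasure D]
    (hP : IsMomentDominated P D)
    {X : Vec n → E} (hX : Continuous X) {R : ℝ} (hR : ∀ ω, ‖X ω‖ ≤ R) (h0 : ∫ ω, X ω ∂D = 0)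
    {τ : ℝ} (hτ : 16 * m * τ ^ 2 * R ^ 2 ≤ 1 / 4) {t : ℝ} (ht : 0 ≤ t) :
    P.real {W | t < ‖∑ k, X (W k)‖} ≤ gaussianMoment * Real.exp (-(τ ^ 2 / 2 * t ^ 2)) := by
  have hXm := hX.measurable
  have h1 := hP.lintegral_exp_sq_norm_sum_le hX hR h0 hτ
  have h2 := mul_meas_ge_le_lintegral (μ := P)
    (f := fun W => ENNReal.ofReal (Real.exp (τ ^ 2 / 2 * ‖∑ k, X (W k)‖ ^ 2))) (by fun_prop)
    (ENNReal.ofReal (Real.exp (τ ^ 2 / 2 * t ^ 2)))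
  have h3 : P {W | t < ‖∑ k, X (W k)‖} ≤ P {W | ENNReal.ofReal (Real.exp (τ ^ 2 / 2 * t ^ 2)) ≤
      ENNReal.ofReal (Real.exp (τ ^ 2 / 2 * ‖∑ k, X (W k)‖ ^ 2))} := by
    refine measure_mono fun W hW => ENNReal.ofReal_le_ofReal (Real.exp_le_exp.2 ?_)
    have : t ≤ ‖∑ k, X (W k)‖ := le_of_lt hW
    gcongr
  have h4 : ENNReal.ofReal (Real.exp (τ ^ 2 / 2 * t ^ 2)) * P {W | t < ‖∑ k, X (W k)‖} ≤
      ENNReal.ofReal gaussianMoment := (mul_le_mul_right h3 _).trans (h2.trans h1)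
  have h5 := ENNReal.toReal_mono ENNReal.ofReal_ne_top h4
  rw [ENNReal.toReal_mul, ENNReal.toReal_ofReal (Real.exp_pos _).le,
    ENNReal.toReal_ofReal (by linarith [one_le_gaussianMoment])] at h5
  rw [Real.exp_neg, ← div_eq_mul_inv, le_div_iff₀ (Real.exp_pos _), mul_comm]
  exact h5

end OMCRidge
end

noncomputable section

namespace OMCRidge

variable {n m N : ℕ}

/-! ### From the Frobenius norm to spectral approximation -/

lemma sigmaMin_nonneg (B : Matrix (Fin N) (Fin N) ℝ) : 0 ≤ sigmaMin B :=
  LinearMap.singularValues_nonneg _ _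

/-- Every eigenvalue of a positive semidefinite matrix is at least its smallest singular value. -/
lemma sigmaMin_le_of_hasEigenvector {B : Matrix (Fin N) (Fin N) ℝ} (hB : B.PosSemidef)
    (hN : 1 ≤ N) {c : ℝ} {u : EuclideanSpace ℝ (Fin N)} (hu : u ≠ 0)
    (h : Matrix.toEuclideanLin B u = c • u) : sigmaMin B ≤ c := by
  set T := Matrix.toEuclideanLin B with hT
  have hadj : LinearMap.adjoint T = T := by
    rw [hT, ← Matrix.toEuclideanLin_conjTranspose_eq_adjoint, hB.isHermitian.eq]
  have hc : 0 ≤ c := by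
    have h1 := hB.dotProduct_mulVec_nonneg u.ofLp
    have h2 : B *ᵥ u.ofLp = c • u.ofLp := by
      have := congrArg WithLp.ofLp h
      simpa [hT] using this
    rw [h2, dotProduct_smul, smul_eq_mul, star_trivial] at h1
    have h3 : 0 < u.ofLp ⬝ᵥ u.ofLp := by
      have := (Matrix.dotProduct_star_self_pos_iff (v := u.ofLp)).2 (by simpa using hu)
      simpa using this
    exact nonneg_of_mul_nonneg_left h1 h3
  -- Singular values are square roots of eigenvalues of `T* T`, which is `T²` here.
  have hev : Module.End.HasEigenvalue (LinearMap.adjoint T ∘ₗ T) (c ^ 2) := by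
    refine Module.End.hasEigenvalue_of_hasEigenvector (x := u)
      ⟨Module.End.mem_eigenspace_iff.2 ?_, hu⟩
    rw [hadj, LinearMap.comp_apply, h, map_smul, h, smul_smul, sq]
  obtain ⟨i, hi⟩ := T.isSymmetric_adjoint_comp_self.exists_eigenvalues_eq
    (finrank_euclideanSpace_fin (𝕜 := ℝ) (n := N)) hev
  have hsv : T.singularValues i = c := by
    rw [T.singularValues_fin (finrank_euclideanSpace_fin (𝕜 := ℝ) (n := N)) i]
    have hi' : T.isSymmetric_adjoint_comp_self.eigenvalues
      (finrank_euclideanSpace_fin (𝕜 := ℝ) (n := N)) i = c ^ 2 := by simpa using hi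
    rw [hi', Real.sqrt_sq hc]
  rw [← hsv]
  exact T.singularValues_antitone (by omega)

lemma sigmaMin_mul_le {B : Matrix (Fin N) (Fin N) ℝ} (hB : B.PosSemidef) (hN : 1 ≤ N)
    (x : Fin N → ℝ) : sigmaMin B * (x ⬝ᵥ x) ≤ x ⬝ᵥ (B *ᵥ x) := by
  set C := B - sigmaMin B • (1 : Matrix (Fin N) (Fin N) ℝ) with hC
  have hCh : C.IsHermitian := hB.isHermitian.sub
    (by simp [Matrix.IsHermitian])
  have hCv : ∀ v, C *ᵥ v = B *ᵥ v - sigmaMin B • v := fun v => by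
    rw [hC, Matrix.sub_mulVec, Matrix.smul_mulVec, Matrix.one_mulVec]
  have hCp : C.PosSemidef := by
    rw [hCh.posSemidef_iff_eigenvalues_nonneg]
    intro j
    have h1 := hCh.mulVec_eigenvectorBasis j
    have hne : hCh.eigenvectorBasis j ≠ 0 := (hCh.eigenvectorBasis.orthonormal.ne_zero j)
    have h2 : sigmaMin B ≤ hCh.eigenvalues j + sigmaMin B := by
      refine sigmaMin_le_of_hasEigenvector hB hN hne ?_
      rw [hCv, sub_eq_iff_eq_add, ← add_smul] at h1
      ext i
      simpa [Matrix.toEuclideanLin] using congrFun h1 i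
    simpa using h2
  have h := hCp.dotProduct_mulVec_nonneg x
  rw [hCv, dotProduct_sub, dotProduct_smul, star_trivial, smul_eq_mul] at h
  linarith

/-- Cauchy-Schwarz for the matrix against `x ⊗ x`, whose Frobenius norm is `|x|²`. -/
lemma abs_dotProduct_mulVec_le {Q : Matrix (Fin N) (Fin N) ℝ} {t : ℝ} (ht : 0 ≤ t)
    (hQ : ∑ p : Fin N × Fin N, Q p.1 p.2 ^ 2 ≤ t ^ 2) (x : Fin N → ℝ) :
    |x ⬝ᵥ (Q *ᵥ x)| ≤ t * (x ⬝ᵥ x) := by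
  have hx : 0 ≤ x ⬝ᵥ x := Finset.sum_nonneg fun i _ => mul_self_nonneg _
  have e1 : x ⬝ᵥ (Q *ᵥ x) = ∑ p : Fin N × Fin N, Q p.1 p.2 * (x p.1 * x p.2) := by
    rw [Fintype.sum_prod_type]
    simp only [dotProduct, Matrix.mulVec, Finset.mul_sum]
    exact Finset.sum_congr rfl fun i _ => Finset.sum_congr rfl fun j _ => by ring
  have e2 : ∑ p : Fin N × Fin N, (x p.1 * x p.2) ^ 2 = (x ⬝ᵥ x) ^ 2 := by
    rw [Fintype.sum_prod_type, sq, dotProduct, Finset.sum_mul_sum]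
    exact Finset.sum_congr rfl fun i _ => Finset.sum_congr rfl fun j _ => by ring
  refine abs_le_of_sq_le_sq ?_ (mul_nonneg ht hx)
  rw [e1, mul_pow, ← e2]
  exact (Finset.sum_mul_sq_le_sq_mul_sq _ _ _).trans
    (mul_le_mul_of_nonneg_right hQ (Finset.sum_nonneg fun p _ => sq_nonneg _))

lemma isSpectralApprox_of_frobenius_le {A B : Matrix (Fin N) (Fin N) ℝ} (hA : A.IsHermitian)
    (hB : B.PosSemidef) (hN : 1 ≤ N) {a : ℝ} (ha : 0 ≤ a)
    (h : ∑ p : Fin N × Fin N, (A - B) p.1 p.2 ^ 2 ≤ (a * sigmaMin B) ^ 2) :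
    IsSpectralApprox a A B := by
  have hBs : ∀ s : ℝ, (s • B).IsHermitian := fun s => by
    rw [Matrix.IsHermitian, Matrix.conjTranspose_smul, hB.isHermitian.eq, star_trivial]
  have key : ∀ x : Fin N → ℝ, |x ⬝ᵥ ((A - B) *ᵥ x)| ≤ a * (x ⬝ᵥ (B *ᵥ x)) := fun x =>
    (abs_dotProduct_mulVec_le (mul_nonneg ha (sigmaMin_nonneg B)) h x).trans (by
      rw [mul_assoc]
      exact mul_le_mul_of_nonneg_left (sigmaMin_mul_le hB hN x) ha)
  constructor
  · refine .of_dotProduct_mulVec_nonneg (hA.sub (hBs _)) fun x => ?_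
    have := (abs_le.1 (key x)).1
    have e : A - (1 - a) • B = (A - B) + a • B := by rw [sub_smul, one_smul]; abel
    rw [e, Matrix.add_mulVec, Matrix.smul_mulVec, dotProduct_add, dotProduct_smul, star_trivial,
      smul_eq_mul]
    linarith
  · refine .of_dotProduct_mulVec_nonneg ((hBs _).sub hA) fun x => ?_
    have := (abs_le.1 (key x)).2
    have e : (1 + a) • B - A = a • B - (A - B) := by rw [add_smul, one_smul]; abel
    rw [e, Matrix.sub_mulVec, Matrix.smul_mulVec, dotProduct_sub, dotProduct_smul, star_trivial,
      smul_eq_mul]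
    linarith

lemma spectralError_le {A B : Matrix (Fin N) (Fin N) ℝ} {a : ℝ} (ha : 0 < a)
    (h : IsSpectralApprox a A B) : spectralError A B ≤ a :=
  csInf_le ⟨0, fun _ hx => hx.1.le⟩ ⟨ha, h⟩

/-! ### Kernel matrices -/

variable {K : Vec n → Vec n → ℝ} {D : Measure (Vec n)}

lemma abs_cos_integral_le [IsProbabilityMeasure D] (hK : IsSpectralDistribution D K)
    (y z : Vec n) : |K y z| ≤ 1 := by
  rw [hK y z, ← Real.norm_eq_abs]
  refine (norm_integral_le_of_norm_le_const (C := 1)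
    (Filter.Eventually.of_forall fun ω => Real.abs_cos_le_one _)).trans (by simp)

lemma posSemidef_kernelMatrix [IsProbabilityMeasure D] (hK : IsSpectralDistribution D K)
    (x : Fin N → Vec n) : (kernelMatrix K x).PosSemidef := by
  refine .of_dotProduct_mulVec_nonneg ?_ fun v => ?_
  · ext i j
    simp only [Matrix.conjTranspose_apply, kernelMatrix, Matrix.of_apply, star_trivial, hK _ _]
    congr 1 with ω
    rw [← neg_sub (x i), inner_neg_right, Real.cos_neg]
  · have hi : ∀ i j, Integrable (fun ω => v i * (Real.cos (inner ℝ ω (x i - x j)) * v j)) D :=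
      fun i j => by
        refine Integrable.const_mul (Integrable.mul_const ?_ _) _
        exact integrable_of_measurable_of_bounded (by fun_prop) 1 fun ω => Real.abs_cos_le_one _
    have e : star v ⬝ᵥ (kernelMatrix K x *ᵥ v) =
        ∫ ω, ∑ i, ∑ j, v i * (Real.cos (inner ℝ ω (x i - x j)) * v j) ∂D := by
      rw [integral_finsetSum _ fun i _ => integrable_finsetSum _ fun j _ => hi i j]
      simp only [dotProduct, Matrix.mulVec, Finset.mul_sum, star_trivial]
      refine Finset.sum_congr rfl fun i _ => ?_
      rw [integral_finsetSum _ fun j _ => hi i j]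
      refine Finset.sum_congr rfl fun j _ => ?_
      rw [integral_const_mul, integral_mul_const, kernelMatrix, Matrix.of_apply, hK]
    rw [e]
    refine integral_nonneg fun ω => ?_
    have e2 : ∑ i, ∑ j, v i * (Real.cos (inner ℝ ω (x i - x j)) * v j) =
        (∑ i, v i * Real.cos (inner ℝ ω (x i))) ^ 2 +
        (∑ i, v i * Real.sin (inner ℝ ω (x i))) ^ 2 := by
      rw [sq, sq, Finset.sum_mul_sum, Finset.sum_mul_sum, ← Finset.sum_add_distrib]
      refine Finset.sum_congr rfl fun i _ => ?_
      rw [← Finset.sum_add_distrib]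
      refine Finset.sum_congr rfl fun j _ => ?_
      rw [inner_sub_right, Real.cos_sub]
      ring
    change 0 ≤ ∑ i, ∑ j, v i * (Real.cos (inner ℝ ω (x i - x j)) * v j)
    rw [e2]
    positivity

lemma posSemidef_regularized {A : Matrix (Fin N) (Fin N) ℝ} (hA : A.PosSemidef) {lam : ℝ}
    (hl : 0 ≤ lam) : (regularized lam A).PosSemidef :=
  hA.add (Matrix.PosSemidef.one.smul (by positivity))

lemma approxKernelMatrix_apply (W : Fin m → Vec n) (x : Fin N → Vec n) (i j : Fin N) :
    approxKernelMatrix W x i j = (∑ k, Real.cos (inner ℝ (W k) (x i - x j))) / m := by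
  have hm : √(m : ℝ) * √(m : ℝ) = m := Real.mul_self_sqrt (Nat.cast_nonneg m)
  simp only [approxKernelMatrix, Matrix.of_apply, dotProduct, featureMap, Fintype.sum_sum_type,
    Sum.elim_inl, Sum.elim_inr]
  rw [← Finset.sum_add_distrib, Finset.sum_div]
  refine Finset.sum_congr rfl fun k _ => ?_
  rw [div_mul_div_comm, div_mul_div_comm, hm, ← add_div, inner_sub_right, Real.cos_sub]

lemma isHermitian_regularized_approxKernelMatrix (W : Fin m → Vec n) (x : Fin N → Vec n)
    (lam : ℝ) : (regularized lam (approxKernelMatrix W x)).IsHermitian := by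
  refine Matrix.IsHermitian.add ?_ (by simp [Matrix.IsHermitian])
  ext i j
  simp only [Matrix.conjTranspose_apply, approxKernelMatrix, Matrix.of_apply, star_trivial]
  exact dotProduct_comm _ _

/-- The centered kernel estimate of a single frequency. -/
def kernelDeviation (K : Vec n → Vec n → ℝ) (x : Fin N → Vec n) (ω : Vec n) :
    EuclideanSpace ℝ (Fin N × Fin N) :=
  WithLp.toLp 2 fun p => Real.cos (inner ℝ ω (x p.1 - x p.2)) - K (x p.1) (x p.2)

lemma continuous_kernelDeviation (x : Fin N → Vec n) : Continuous (kernelDeviation K x) := by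
  unfold kernelDeviation
  fun_prop

/-- There are `N²` entries of size at most two; this is the source of the `N` in `aσ/N`. -/
lemma norm_kernelDeviation_le [IsProbabilityMeasure D] (hK : IsSpectralDistribution D K)
    (x : Fin N → Vec n) (ω : Vec n) : ‖kernelDeviation K x ω‖ ≤ 2 * N := by
  have h : ∀ p : Fin N × Fin N, ‖kernelDeviation K x ω p‖ ^ 2 ≤ 4 := fun p => by
    have h1 := abs_le.1 (Real.abs_cos_le_one (inner ℝ ω (x p.1 - x p.2)))
    have h2 := abs_le.1 (abs_cos_integral_le hK (x p.1) (x p.2))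
    rw [Real.norm_eq_abs, sq_abs]
    simp only [kernelDeviation]
    nlinarith
  refine abs_le_of_sq_le_sq' ?_ (by positivity) |>.2
  rw [EuclideanSpace.norm_sq_eq]
  calc ∑ p, ‖kernelDeviation K x ω p‖ ^ 2 ≤ ∑ _p : Fin N × Fin N, (4 : ℝ) :=
        Finset.sum_le_sum fun p _ => h p
    _ = (2 * N) ^ 2 := by
        simp only [Finset.sum_const, Finset.card_univ, Fintype.card_prod, Fintype.card_fin,
          nsmul_eq_mul]
        push_cast
        ring

lemma integral_kernelDeviation [IsProbabilityMeasure D] (hK : IsSpectralDistribution D K)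
    (x : Fin N → Vec n) : ∫ ω, kernelDeviation K x ω ∂D = 0 := by
  have hi : Integrable (kernelDeviation K x) D :=
    Integrable.of_bound (continuous_kernelDeviation x).aestronglyMeasurable (2 * N)
      (Filter.Eventually.of_forall (norm_kernelDeviation_le hK x))
  ext p
  have h := (EuclideanSpace.proj (𝕜 := ℝ) p).integral_comp_comm hi
  change ∫ ω, kernelDeviation K x ω p ∂D = (∫ ω, kernelDeviation K x ω ∂D) p at h
  rw [← h]
  simp only [kernelDeviation]
  rw [integral_sub _ (integrable_const _), ← hK]
  · simp
  · exact integrable_of_measurable_of_bounded (by fun_prop) 1 fun ω => Real.abs_cos_le_one _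

lemma lt_norm_sum_of_lt_deltaHat [IsProbabilityMeasure D] (hK : IsSpectralDistribution D K)
    (hN : 1 ≤ N) (hm : 1 ≤ m) (x : Fin N → Vec n) {lam a : ℝ} (hl : 0 ≤ lam) (ha : 0 < a)
    {W : Fin m → Vec n} (h : a < deltaHat K x lam W) :
    m * (a * sigmaMin (regularized lam (kernelMatrix K x))) < ‖∑ k, kernelDeviation K x (W k)‖ := by
  set B := regularized lam (kernelMatrix K x) with hB
  have hm0 : (0 : ℝ) < m := by exact_mod_cast hm
  contrapose! h
  have hσ : 0 ≤ m * (a * sigmaMin B) := mul_nonneg hm0.le (mul_nonneg ha.le (sigmaMin_nonneg B))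
  refine spectralError_le ha (isSpectralApprox_of_frobenius_le
    (isHermitian_regularized_approxKernelMatrix W x lam)
    (posSemidef_regularized (posSemidef_kernelMatrix hK x) hl) hN ha.le ?_)
  have h2 : ‖∑ k, kernelDeviation K x (W k)‖ ^ 2 ≤ (m * (a * sigmaMin B)) ^ 2 := by gcongr
  -- The ridge term cancels in the difference.
  have e : ∀ p : Fin N × Fin N, (regularized lam (approxKernelMatrix W x) - B) p.1 p.2 =
      (∑ k, kernelDeviation K x (W k)) p / m := fun p => by
    have e1 : (regularized lam (approxKernelMatrix W x) - B) p.1 p.2 =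
        approxKernelMatrix W x p.1 p.2 - K (x p.1) (x p.2) := by
      simp [hB, regularized, kernelMatrix]
    rw [e1, approxKernelMatrix_apply, eq_div_iff hm0.ne', sub_mul, div_mul_cancel₀ _ hm0.ne']
    simp only [WithLp.ofLp_sum, Finset.sum_apply, kernelDeviation, Finset.sum_sub_distrib]
    simp [mul_comm]
  have hsum : ∑ p : Fin N × Fin N, (regularized lam (approxKernelMatrix W x) - B) p.1 p.2 ^ 2 =
      (∑ p, (∑ k, kernelDeviation K x (W k)) p ^ 2) / m ^ 2 := by
    rw [Finset.sum_div]
    exact Finset.sum_congr rfl fun p _ => by rw [e p, div_pow]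
  refine hsum.trans_le ?_
  rw [div_le_iff₀ (by positivity)]
  rw [EuclideanSpace.norm_sq_eq, mul_pow] at h2
  simp only [Real.norm_eq_abs, sq_abs] at h2
  linarith

/-! ### Tail bound for the spectral error. -/

lemma isMomentDominated_iidLaw [IsProbabilityMeasure D] : IsMomentDominated (iidLaw D m) D :=
  fun _ _ _ hF hδ hle hge => integral_prod_iidLaw_le m hF hδ hle hge

lemma isMomentDominated_omcLaw [NeZero n] [IsProbabilityMeasure D] (hD : IsIsotropic D) :
    IsMomentDominated (omcLaw D m) D :=
  fun _ _ _ hF hδ hle hge => integral_prod_omcLaw_le hD m hF hδ hle hge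

lemma IsMomentDominated.measureReal_lt_deltaHat_le [IsProbabilityMeasure D]
    {P : Measure (Fin m → Vec n)} [IsProbabilityMeasure P] (hP : IsMomentDominated P D)
    (hK : IsSpectralDistribution D K) (hN : 1 ≤ N) (hm : 1 ≤ m) (x : Fin N → Vec n) {lam a : ℝ}
    (hl : 0 ≤ lam) (ha : 0 < a) :
    P.real {W | a < deltaHat K x lam W} ≤ gaussianMoment *
      Real.exp (-(m * (a * sigmaMin (regularized lam (kernelMatrix K x)) / N) ^ 2 / 512)) := by
  set σ := sigmaMin (regularized lam (kernelMatrix K x)) with hσ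
  have hm0 : (0 : ℝ) < m := by exact_mod_cast hm
  have hN0 : (0 : ℝ) < N := by exact_mod_cast hN
  have hs : √(m : ℝ) ^ 2 = m := Real.sq_sqrt hm0.le
  -- With `R = 2N` this `τ` gives equality in `16 m τ² R² ≤ 1/4`; then `τ²/2 · (maσ)² = m
  -- (aσ/N)²/512`.
  have hτ2 : (1 / (16 * √(m : ℝ) * N)) ^ 2 = 1 / (256 * m * N ^ 2) := by
    rw [div_pow, mul_pow, mul_pow, hs]; norm_num
  have h1 := hP.measureReal_norm_sum_gt_le (continuous_kernelDeviation (K := K) x)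
    (norm_kernelDeviation_le hK x) (integral_kernelDeviation hK x)
    (τ := 1 / (16 * √(m : ℝ) * N)) (by rw [hτ2]; apply le_of_eq; field_simp; norm_num)
    (t := m * (a * σ)) (mul_nonneg hm0.le (mul_nonneg ha.le (sigmaMin_nonneg _)))
  refine (measureReal_mono fun W hW => lt_norm_sum_of_lt_deltaHat hK hN hm x hl ha hW).trans
    (h1.trans (le_of_eq ?_))
  rw [hτ2]
  congr 3
  field_simp
  ring

/-- A constant factor in a tail bound can be traded for the rate. -/
lemma le_of_le_mul_exp_neg {p G A u θ : ℝ} (hp : p ≤ 1) (hG : 0 < G) (h : p ≤ G * Real.exp (-u))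
    (hθ : 0 ≤ θ) (hθ1 : θ ≤ 1) (hA : 0 < A) (hGA : θ * Real.log G ≤ Real.log A) :
    p ≤ A * Real.exp (-(θ * u)) := by
  have hA' : A * Real.exp (-(θ * u)) = Real.exp (Real.log A - θ * u) := by
    rw [sub_eq_add_neg, Real.exp_add, Real.exp_log hA]
  have hG' : G * Real.exp (-u) = Real.exp (Real.log G - u) := by
    rw [sub_eq_add_neg, Real.exp_add, Real.exp_log hG]
  rw [hA']
  -- With `b = log G - u`, both cases are `min(1, e^b) ≤ e^(θb)` for `θ ∈ [0, 1]`.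
  rcases le_total 0 (Real.log G - u) with hb | hb
  · refine hp.trans (Real.one_le_exp ?_)
    nlinarith
  · refine (h.trans hG'.le).trans (Real.exp_le_exp.2 ?_)
    nlinarith

lemma failureBound_antitone {A C C' : ℝ} (hA : 0 ≤ A) (hC : C ≤ C') (m : ℕ) (x : ℝ) :
    failureBound A C' m x ≤ failureBound A C m x := by
  unfold failureBound
  gcongr

lemma failureBound_strictAnti {A C C' : ℝ} (hA : 0 < A) (hC : C < C') {m : ℕ} (hm : 1 ≤ m)
    {x : ℝ} (hx : 0 < x) : failureBound A C' m x < failureBound A C m x := by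
  have hm0 : (0 : ℝ) < m := by exact_mod_cast hm
  unfold failureBound
  gcongr

end OMCRidge
end

/-! ### Choice of the constants. -/

theorem mainTheorem8 :
    ∀ A : ℝ, 1 < A → ∃ Ciid Cort : ℝ, 0 < Ciid ∧ 0 < Cort ∧
      (∀ (m : ℕ) (x : ℝ), 1 ≤ m → 0 < x →
        OMCRidge.failureBound A Cort m x < OMCRidge.failureBound A Ciid m x) ∧
      ∀ (n : ℕ) [NeZero n]
        (K : OMCRidge.Vec n → OMCRidge.Vec n → ℝ) (_ : OMCRidge.IsRBF K)
        (D : Measure (OMCRidge.Vec n)) [IsProbabilityMeasure D]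
        (_ : OMCRidge.IsIsotropic D) (_ : OMCRidge.IsSpectralDistribution D K)
        (M : Set (OMCRidge.Vec n)) (_ : IsCompact M)
        (N : ℕ) (_ : 1 ≤ N) (x : Fin N → OMCRidge.Vec n) (_ : ∀ i j, x i - x j ∈ M)
        (lam : ℝ) (_ : 0 < lam) (m : ℕ) (_ : 1 ≤ m) (a : ℝ) (_ : 0 < a),
        let σ := OMCRidge.sigmaMin (OMCRidge.regularized lam (OMCRidge.kernelMatrix K x))
        (OMCRidge.iidLaw D m).real {W | a < OMCRidge.deltaHat K x lam W}
            ≤ OMCRidge.failureBound A Ciid m (a * σ / N) ∧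
        (OMCRidge.omcLaw D m).real {W | a < OMCRidge.deltaHat K x lam W}
            ≤ OMCRidge.failureBound A Cort m (a * σ / N) := by
  intro A hA
  have hA0 : 0 < A := zero_lt_one.trans hA
  have hlA : 0 < Real.log A := Real.log_pos hA
  have hG := OMCRidge.one_le_gaussianMoment
  have hlG : 0 ≤ Real.log OMCRidge.gaussianMoment := Real.log_nonneg hG
  -- This `θ` satisfies `θ ≤ 1` and `θ log G ≤ log A`, as needed to lower the prefactor `G` to `A`
  -- at the cost of the rate.
  set θ := Real.log A / (Real.log A + Real.log OMCRidge.gaussianMoment) with hθ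
  have hθ0 : 0 < θ := by positivity
  have hθ1 : θ ≤ 1 := (div_le_one (by positivity)).2 (by linarith)
  have hθA : θ * Real.log OMCRidge.gaussianMoment ≤ Real.log A := by
    rw [hθ, div_mul_eq_mul_div, div_le_iff₀ (by positivity)]
    nlinarith
  -- The rate `θ/512` holds for both laws; the one for independent samples is halved to make the
  -- bounds strictly ordered.
  refine ⟨θ / 1024, θ / 512, by positivity, by positivity, fun m x hm hx =>
    OMCRidge.failureBound_strictAnti hA0 (by linarith) hm hx, ?_⟩
  intro n _ K _ D _ hD hK M _ N hN x _ lam hlam m hm a ha σ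
  have key : ∀ (P : Measure (Fin m → OMCRidge.Vec n)) [IsProbabilityMeasure P],
      OMCRidge.IsMomentDominated P D → P.real {W | a < OMCRidge.deltaHat K x lam W} ≤
        OMCRidge.failureBound A (θ / 512) m (a * σ / N) := by
    intro P _ hP
    have h := OMCRidge.le_of_le_mul_exp_neg measureReal_le_one (zero_lt_one.trans_le hG)
      (hP.measureReal_lt_deltaHat_le hK hN hm x hlam.le ha) hθ0.le hθ1 hA0 hθA
    refine h.trans (le_of_eq ?_)
    unfold OMCRidge.failureBound
    congr 3
    ring
  have : IsProbabilityMeasure (OMCRidge.iidLaw D m) := by unfold OMCRidge.iidLaw; infer_instance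
  exact ⟨(key _ OMCRidge.isMomentDominated_iidLaw).trans
    (OMCRidge.failureBound_antitone hA0.le (by linarith) m _),
    key _ (OMCRidge.isMomentDominated_omcLaw hD)⟩
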